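/- For graphs $F,G$ let $p(F,G)$ be the number of $|V(F)|$-subsets of $V(G)$ inducing a copy of $F$, divided by $\binom{|V(G)|}{|V(F)|}$. Let $i(F,n)$ (resp. $i_k(F,n)$) be the maximum of $p(F,G)$ over all (resp. all $K_k$-free) graphs $G$ on $n$ vertices, and let $i(F)=\lim_{n\to\infty} i(F,n)$, $i_k(F)=\lim_{n\to\infty} i_k(F,n)$. A graphon is a symmetric measurable function $W:[0,1]^2\to\{0,1\}$; the induced density of $F$ in $W$ is the probability that $|V(F)|$ independent uniform points of $[0,1]$ induce a copy of $F$ in $W$ (distinct points $u,v$ being adjacent iff $W(u,v)=1$), and $W$ is $K_k$-free if the density of $K_k$ in $W$ is $0$. Let $W[x_1,\dots,x_\ell]$ be the graphon obtained by partitioning $[0,1]$ into consecutive intervals of lengths $x_1,\dots,x_\ell$ and setting $W(x,y)=1$ iff $x,y$ lie in distinct intervals. Let $T(s,r)$ be the Turán graph with $s$ vertices and $r$ parts. A graphon attains $i(F)$ if its induced density of $F$ equals $i(F)$; it attains $i_k(F)$ if it is $K_k$-free and its induced density of $F$ equals $i_k(F)$. It is the unique such graphon if every graphon $W$ attaining the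 value satisfies $W(x,y)=U(\varphi(x),\varphi(y))$ for almost all $(x,y)$ and some measure-preserving $\varphi:[0,1]\to[0,1]$, where $U$ is the given graphon. **Theorem.** Let $2\le r<s\le 3r+1$ and write $s=pr+q$ with $0\le q<r$. There is a largest integer $t\ge r$ such that $t=r$ or $$\frac{t}{t-r}\left(1-\frac1t\right)^s>1 .$$ For this $t$, every $k>r$, and $\ell=\min\{k-1,t\}$, the value $i_k(T(s,r))$ is uniquely attained by $W[\frac1\ell,\dots,\frac1\ell]$ ($\ell$ parts), and $i(T(s,r))$ is uniquely attained by $W[\frac1t,\dots,\frac1t]$ ($t$ parts). Moreover $$i_k(T(s,r))=\frac{\ell!\,s!}{(\ell-r)!\,(r-q)!\,q!\,(p!)^r(p+1)^q\,\ell^s},\qquad i(T(s,r))=\frac{t!\,s!}{(t-r)!\,(r-q)!\,q!\,(p!)^r(p+1)^q\,t^s}.$$ -/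

import Mathlib

open Filter Topology MeasureTheory

namespace Inducibility

section FiniteGraphs

variable {U V : Type*}

/-- `P(F, G)`: the number of vertex subsets of `G` that induce a subgraph isomorphic to `F`. -/
noncomputable def inducedCopies (F : SimpleGraph U) (G : SimpleGraph V) : ℕ :=
  Nat.card {S : Finset V // Nonempty (G.induce (S : Set V) ≃g F)}

/-- `p(F, G) = P(F, G) / C(|V(G)|, |V(F)|)`: the induced density of `F` in `G`. -/
noncomputable def inducedDensity (F : SimpleGraph U) (G : SimpleGraph V) : ℝ :=
  (inducedCopies F G : ℝ) / ((Nat.card V).choose (Nat.card U) : ℝ)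

/-- `i(F, n)`: the maximum induced density of `F` over all graphs with `n` vertices. -/
noncomputable def maxDensity (F : SimpleGraph U) (n : ℕ) : ℝ :=
  ⨆ G : SimpleGraph (Fin n), inducedDensity F G

/-- `i_k(F, n)`: the maximum induced density of `F` over all `K_k`-free graphs with
`n` vertices. -/
noncomputable def maxDensityCliqueFree (k : ℕ) (F : SimpleGraph U) (n : ℕ) : ℝ :=
  ⨆ G : {G : SimpleGraph (Fin n) // G.CliqueFree k}, inducedDensity F G.1

/-- `i(F) = c`, that is, `i(F, n)` converges to `c` as `n → ∞`. -/
def HasInducibility (F : SimpleGraph U) (c : ℝ) : Prop :=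
  Tendsto (fun n : ℕ => maxDensity F n) atTop (𝓝 c)

/-- `i_k(F) = c`, that is, `i_k(F, n)` converges to `c` as `n → ∞`. -/
def HasCliqueFreeInducibility (k : ℕ) (F : SimpleGraph U) (c : ℝ) : Prop :=
  Tendsto (fun n : ℕ => maxDensityCliqueFree k F n) atTop (𝓝 c)

end FiniteGraphs

/-- A graphon: a (measurable) symmetric function `[0,1]² → {0,1}`. -/
structure Graphon where
  toFun : unitInterval → unitInterval → Fin 2
  symm : ∀ a b, toFun a b = toFun b a
  measurable : Measurable (Function.uncurry toFun)

namespace Graphon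

/-- The graph that `W` induces on the points `x v`: distinct `u`, `v` are adjacent if and only if
`W (x u) (x v) = 1`. -/
def graphOn {V : Type*} (W : Graphon) (x : V → unitInterval) : SimpleGraph V where
  Adj u v := u ≠ v ∧ W.toFun (x u) (x v) = 1
  symm := ⟨fun _ _ h => ⟨h.1.symm, (W.symm _ _).trans h.2⟩⟩
  loopless := ⟨fun _ h => h.1 rfl⟩

/-- The induced density of `H` in `W`: the probability that `|V(H)|` independent uniformly random
points of `[0,1]` induce a copy of `H` in `W`. -/
noncomputable def density {V : Type*} [Fintype V] (H : SimpleGraph V) (W : Graphon) : ℝ :=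
  (volume : Measure (V → unitInterval)).real {x | Nonempty (W.graphOn x ≃g H)}

/-- `W` is `K_k`-free: the density of `K_k` in `W` is zero. -/
def CliqueFree (W : Graphon) (k : ℕ) : Prop :=
  density (⊤ : SimpleGraph (Fin k)) W = 0

/-- `W` and `U` are the same graphon up to a measure preserving rearrangement of `[0,1]`:
`W(a,b) = U(φ a, φ b)` for almost all `(a,b)` and some measure preserving `φ`. -/
def IsRearrangement (W U : Graphon) : Prop :=
  ∃ φ : unitInterval → unitInterval, MeasurePreserving φ volume volume ∧
    ∀ᵐ z : unitInterval × unitInterval, W.toFun z.1 z.2 = U.toFun (φ z.1) (φ z.2)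

/-- The complete partite graphon `W[x₁, …, x_ℓ]`: the interval `[0,1]` is cut at the points
`x₁ + ⋯ + x_j` into consecutive intervals of lengths `x₁, …, x_ℓ`, and `W(a,b) = 1` if and only if
`a` and `b` lie in distinct intervals, that is, some cut point separates them. -/
noncomputable def completePartite {l : ℕ} (x : Fin l → ℝ) : Graphon where
  toFun a b := by
    classical exact if ∃ j : Fin l, min (a : ℝ) b < ∑ i ∈ Finset.Iio j, x i ∧
      ∑ i ∈ Finset.Iio j, x i ≤ max (a : ℝ) b then 1 else 0
  symm a b := by simp only [min_comm, max_comm]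
  measurable := by
    refine Measurable.ite ?_ measurable_const measurable_const
    have h1 : Measurable fun z : unitInterval × unitInterval => min (z.1 : ℝ) z.2 := by fun_prop
    have h2 : Measurable fun z : unitInterval × unitInterval => max (z.1 : ℝ) z.2 := by fun_prop
    rw [Set.ofPred_exists]
    exact MeasurableSet.iUnion fun j =>
      (measurableSet_lt h1 measurable_const).inter (measurableSet_le measurable_const h2)

/-- The equipartite graphon `W[1/ℓ, …, 1/ℓ]` with `ℓ` parts. -/
noncomputable def equipartite (l : ℕ) : Graphon :=
  completePartite fun _ : Fin l => (1 : ℝ) / l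

end Graphon

end Inducibility

/-! A copy of the Turán graph is a set of `s = pr + q` vertices inducing a complete `r`-partite
graph with all parts of size `p` or `p + 1` (`IsBalanced`). Every density in question is therefore
the measure of the balanced `s`-tuples. The hypothesis `s ≤ 3r + 1` enters only as `p ≤ 3`.

Upper bound. On a finite graph the density is a polynomial in vertex weights ranging over a simplex;
take a maximiser of smallest support. In a balanced graph non-adjacent vertices are twins, so Zykov
symmetrisation works: for non-adjacent `x`, `z` the density is at most a weighted average of the two
densities obtained by giving all their weight to `x` or to `z` (`weightedDensity_merge`). Hence the
support is a clique. For adjacent `x`, `y` joined to everything else, the coordinates at `x` are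
either absent or a whole part, so only the exponents `0`, `p`, `p + 1` occur. For a fixed sum of the
two weights, the resulting symmetric polynomial lies below the chord joining the merged pair to the
equal pair (`pairPolynomial_chord`). Hence the weights are equal and the optimum is an equal blow-up
of some `K_n` contained in the graph (`exists_weightedDensity_le`). Random sampling carries the
bound to measures (`blowupDensity_le`). The ratio of the densities of consecutive equal blow-ups,
together with convexity of `(1 - u)^s`, shows that they increase strictly up to `t` parts and
decrease strictly afterwards (`exists_isGreatest_equipartiteDensity`).

Uniqueness. Expand the density around an extremal probability measure `μ`. The first order says that
almost every point has the same point density. The second order, applied to concentrating a set at a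
point, says that the pair density `k` satisfies `k(x,x) + k(z,z) ≤ 2k(x,z)` almost everywhere.
Cloning gives `k(x,z) ≤ k(x,x)` for non-adjacent points, so equality holds there, and this makes
non-adjacency transitive at almost all triples (`IsExtremal.ae_not_adj_trans`). Collapsing the
classes of two generic adjacent points to atoms preserves the density and reduces the comparison of
their masses to a polynomial inequality, which excludes unequal masses (`pairPolynomial_false`). So
there are finitely many classes, of equal positive measure, and moving them onto consecutive
intervals yields the equipartite graphon. -/

namespace Inducibility

/-! ### Turán graphs as balanced multipartite graphs -/

/-- `H` is complete multipartite with `r` parts, each of size `p` or `p + 1`. -/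
def IsBalanced {V : Type*} [Fintype V] (r p : ℕ) (H : SimpleGraph V) : Prop :=
  ∃ f : V → Fin r, (∀ u v, H.Adj u v ↔ f u ≠ f v) ∧
    ∀ i, Nat.card {v // f v = i} = p ∨ Nat.card {v // f v = i} = p + 1

theorem exists_equiv_of_card_fiber_eq {α β γ : Type*} [Finite α] [Finite β] (f : α → γ) (g : β → γ)
    (h : ∀ c, Nat.card {a // f a = c} = Nat.card {b // g b = c}) :
    ∃ e : α ≃ β, ∀ a, g (e a) = f a := by
  have h' : ∀ c, Nonempty ({a // f a = c} ≃ {b // g b = c}) := fun c =>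
    Finite.card_eq.1 (h c)
  exact ⟨Equiv.ofFiberEquiv fun c => Classical.choice (h' c), fun a => Equiv.ofFiberEquiv_map _ a⟩

theorem sum_card_fiber {V ι : Type*} [Fintype V] [Fintype ι] (f : V → ι) :
    ∑ i, Nat.card {v // f v = i} = Fintype.card V := by
  classical
  rw [← Fintype.card_congr (Equiv.sigmaFiberEquiv f), Fintype.card_sigma]
  simp [Nat.card_eq_fintype_card]

/-- Each part exceeds `p` by `0` or `1`, and the total excess is `q`. -/
theorem card_large_fiber {V : Type*} [Fintype V] {r p q : ℕ} (hV : Fintype.card V = p * r + q)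
    (f : V → Fin r) (hf : ∀ i, Nat.card {v // f v = i} = p ∨ Nat.card {v // f v = i} = p + 1) :
    Nat.card {i // Nat.card {v // f v = i} = p + 1} = q := by
  classical
  have h1 := sum_card_fiber f
  have h2 : ∀ i, Nat.card {v // f v = i} =
      p + if Nat.card {v // f v = i} = p + 1 then 1 else 0 := by
    intro i
    rcases hf i with h | h
    · rw [if_neg (by omega), h, add_zero]
    · rw [if_pos h, h]
  rw [Finset.sum_congr rfl (fun i _ => h2 i), Finset.sum_add_distrib, Finset.sum_boole] at h1
  rw [Nat.card_eq_fintype_card, Fintype.card_subtype]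
  simp at h1 ⊢
  rw [hV] at h1
  nlinarith

theorem card_small_fiber {V : Type*} [Fintype V] {r p q : ℕ} (hV : Fintype.card V = p * r + q)
    (f : V → Fin r) (hf : ∀ i, Nat.card {v // f v = i} = p ∨ Nat.card {v // f v = i} = p + 1) :
    Nat.card {i // Nat.card {v // f v = i} = p} = r - q := by
  classical
  have h1 := card_large_fiber hV f hf
  have h2 := Fintype.card_subtype_compl (fun i : Fin r => Nat.card {v // f v = i} = p + 1)
  rw [Nat.card_eq_fintype_card] at h1
  rw [h1, Fintype.card_fin] at h2
  rw [← h2, Nat.card_eq_fintype_card]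
  refine Fintype.card_congr (Equiv.subtypeEquivRight fun i => ?_)
  rcases hf i with h | h <;> omega

theorem isBalanced_iff_of_iso {V W : Type*} [Fintype V] [Fintype W] {r p : ℕ}
    {H : SimpleGraph V} {K : SimpleGraph W} (e : H ≃g K) (h : IsBalanced r p K) :
    IsBalanced r p H := by
  obtain ⟨f, hf, hc⟩ := h
  refine ⟨f ∘ e, fun u v => by rw [← e.map_adj_iff, hf]; rfl, fun i => ?_⟩
  have : Nat.card {v // (f ∘ e) v = i} = Nat.card {v // f v = i} :=
    Nat.card_congr (e.toEquiv.subtypeEquiv fun a => Iff.rfl)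
  rw [this]
  exact hc i

/-- The order of the graph forces the number of parts of each size, so parts are matched by size
first and vertices within matched parts afterwards. -/
theorem IsBalanced.nonempty_iso {V W : Type*} [Fintype V] [Fintype W] {r p q : ℕ}
    {H : SimpleGraph V} {K : SimpleGraph W}
    (hV : Fintype.card V = p * r + q) (hW : Fintype.card W = p * r + q)
    (h : IsBalanced r p H) (h' : IsBalanced r p K) : Nonempty (H ≃g K) := by
  obtain ⟨f, hf, hc⟩ := h
  obtain ⟨g, hg, hd⟩ := h'
  obtain ⟨π, hπ⟩ := exists_equiv_of_card_fiber_eq (fun i => Nat.card {v // f v = i})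
    (fun i => Nat.card {v // g v = i}) (by
      intro c
      by_cases h1 : c = p
      · subst h1
        rw [card_small_fiber hV f hc, card_small_fiber hW g hd]
      by_cases h2 : c = p + 1
      · subst h2
        rw [card_large_fiber hV f hc, card_large_fiber hW g hd]
      have e1 : IsEmpty {i // Nat.card {v // f v = i} = c} :=
        ⟨fun ⟨i, hi⟩ => by rcases hc i with h | h <;> omega⟩
      have e2 : IsEmpty {i // Nat.card {v // g v = i} = c} :=
        ⟨fun ⟨i, hi⟩ => by rcases hd i with h | h <;> omega⟩
      rw [Nat.card_of_isEmpty, Nat.card_of_isEmpty])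
  obtain ⟨e, he⟩ := exists_equiv_of_card_fiber_eq (fun v => π (f v)) g (by
    intro c
    have := hπ (π.symm c)
    simp only [Equiv.apply_symm_apply] at this
    rw [this]
    refine Nat.card_congr (Equiv.subtypeEquivRight fun v => ?_)
    rw [Equiv.eq_symm_apply])
  exact ⟨⟨e, fun {u v} => by rw [hf, hg, he, he, π.injective.ne_iff]⟩⟩

theorem isBalanced_turanGraph {r p q s : ℕ} (hpq : s = p * r + q) (hq : q < r) :
    IsBalanced r p (SimpleGraph.turanGraph s r) := by
  have hr : 0 < r := by omega
  refine ⟨fun v => ⟨v % r, Nat.mod_lt _ hr⟩, fun u v => ?_, fun i => ?_⟩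
  · rw [SimpleGraph.turanGraph_adj]; simp
  · have h1 : Nat.card {v : Fin s // (⟨v % r, Nat.mod_lt _ hr⟩ : Fin r) = i} =
        Nat.count (· ≡ (i : ℕ) [MOD r]) s := by
      classical
      rw [Nat.count_eq_card_filter_range, Nat.card_eq_fintype_card, Fintype.card_subtype]
      refine Finset.card_bij (fun a _ => (a : ℕ)) ?_ ?_ ?_
      · intro a ha
        simp only [Finset.mem_filter, Finset.mem_univ, true_and, Fin.ext_iff] at ha
        simp [Nat.ModEq, ha, Nat.mod_eq_of_lt i.2]
      · intro a _ b _ h; exact Fin.ext h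
      · intro b hb
        simp only [Finset.mem_filter, Finset.mem_range] at hb
        refine ⟨⟨b, hb.1⟩, ?_, rfl⟩
        have := hb.2
        simp only [Nat.ModEq, Nat.mod_eq_of_lt i.2] at this
        simp [Fin.ext_iff, this]
    rw [h1, Nat.count_modEq_card _ hr, hpq]
    have : (p * r + q) / r = p := by
      rw [Nat.add_comm, Nat.add_mul_div_right _ _ hr, Nat.div_eq_of_lt hq, zero_add]
    rw [this]
    split_ifs <;> simp

/-- This turns isomorphism into a colouring condition, which makes sense for graphs pulled back
along any map, injective or not. -/
theorem nonempty_iso_turanGraph_iff {V : Type*} [Fintype V] {r p q s : ℕ} (hpq : s = p * r + q)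
    (hq : q < r) (hV : Fintype.card V = s) (H : SimpleGraph V) :
    Nonempty (H ≃g SimpleGraph.turanGraph s r) ↔ IsBalanced r p H :=
  ⟨fun ⟨e⟩ => isBalanced_iff_of_iso e (isBalanced_turanGraph hpq hq),
    fun h => h.nonempty_iso (hV.trans hpq) (by simpa using hpq) (isBalanced_turanGraph hpq hq)⟩

/-! ### Cloning vertices of balanced graphs -/

section Clones

variable {V Ω : Type*} [Fintype V] [DecidableEq V] {r p : ℕ} {G : SimpleGraph Ω} {t : V → Ω}

omit [DecidableEq V] in
/-- Vertices of a balanced multipartite graph may be replaced by clones of nonadjacent vertices. -/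
theorem IsBalanced.comp_of_not_adj (h : IsBalanced r p (G.comap t)) (g : V → V)
    (hg : ∀ v, ¬ G.Adj (t (g v)) (t v)) : IsBalanced r p (G.comap (t ∘ g)) := by
  obtain ⟨f, hf, hc⟩ := h
  have hfg : ∀ v, f (g v) = f v := fun v => by
    by_contra hne
    exact hg v ((hf _ _).2 hne)
  exact ⟨f, fun a b => (hf (g a) (g b)).trans (by rw [hfg, hfg]), hc⟩

theorem IsBalanced.update_of_not_adj (h : IsBalanced r p (G.comap t)) {v w : V}
    (hvw : ¬ G.Adj (t v) (t w)) : IsBalanced r p (G.comap (Function.update t w (t v))) := by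
  have := h.comp_of_not_adj (Function.update id w v) fun u => by
    by_cases hu : u = w
    · subst hu; simpa using hvw
    · simp [hu]
  convert this using 2
  funext u
  by_cases hu : u = w
  · subst hu; simp
  · simp [hu]

/-- The vertices of `T` are pairwise non-adjacent and joined to all others, so `T` is empty or
exactly one part. -/
theorem IsBalanced.card_clone (h : IsBalanced r p (G.comap t)) {x : Ω} (T : Finset V)
    (hT : ∀ v ∈ T, t v = x) (hT' : ∀ v, v ∉ T → G.Adj x (t v)) :
    T.card = 0 ∨ T.card = p ∨ T.card = p + 1 := by
  classical
  obtain ⟨f, hf, hc⟩ := h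
  rcases T.eq_empty_or_nonempty with rfl | ⟨v, hv⟩
  · simp
  right
  have : T.card = Nat.card {w // f w = f v} := by
    rw [Nat.card_eq_fintype_card, Fintype.card_subtype]
    congr 1
    ext w
    simp only [Finset.mem_filter, Finset.mem_univ, true_and]
    have h1 := hf w v
    rw [SimpleGraph.comap_adj, hT v hv] at h1
    constructor
    · intro hw
      rw [hT w hw] at h1
      by_contra hne
      exact G.loopless.irrefl x (h1.2 hne)
    · intro hw
      by_contra hne
      exact h1.1 ((hT' w hne).symm) hw
  rw [this]
  exact hc _

/-- A vertex `a` of a balanced multipartite graph that is not a clique can be cloned, at the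
expense of a vertex different from a given neighbour `b` of `a`. -/
theorem IsBalanced.exists_update (h : IsBalanced r p (G.comap t)) (hp : 1 ≤ p)
    (hV : r < Fintype.card V) {a b : V} (hab : G.Adj (t a) (t b)) :
    ∃ v, v ≠ a ∧ v ≠ b ∧ IsBalanced r p (G.comap (Function.update t v (t a))) := by
  classical
  have h0 := h
  obtain ⟨f, hf, hc⟩ := h
  have hfab : f a ≠ f b := (hf a b).1 hab
  -- Another vertex in the part of `a` is already a twin of `a`, so overwriting it changes nothing.
  by_cases hv : ∃ v, v ≠ a ∧ f v = f a
  · obtain ⟨v, hva, hfv⟩ := hv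
    refine ⟨v, hva, fun hvb => hfab (by rw [← hfv, hvb]), h0.update_of_not_adj fun hadj => ?_⟩
    exact (hf a v).1 hadj hfv.symm
  push Not at hv
  -- Here `a` is alone in its part, so `p = 1`. Since there are more than `r` vertices, some part
  -- has two; moving one of them, chosen different from `b`, to the part of `a` merely exchanges the
  -- sizes `2` and `1`.
  have hsing : Nat.card {v // f v = f a} = 1 := by
    rw [Nat.card_eq_one_iff_unique]
    exact ⟨⟨fun u v => Subtype.ext ((by_contra fun hne => hv _ hne u.2 : u.1 = a).trans
      (by_contra fun hne => hv _ hne v.2 : v.1 = a).symm)⟩, ⟨⟨a, rfl⟩⟩⟩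
  have hp1 : p = 1 := by
    rcases hc (f a) with h | h <;> omega
  subst hp1
  obtain ⟨i, hi⟩ : ∃ i, Nat.card {v // f v = i} = 2 := by
    by_contra hne
    push Not at hne
    have h1 := sum_card_fiber f
    rw [Finset.sum_congr rfl (fun i _ => (hc i).resolve_right (hne i))] at h1
    simp at h1
    omega
  obtain ⟨v, hvi, hvb⟩ : ∃ v, f v = i ∧ v ≠ b := by
    by_contra hne
    push Not at hne
    have : Nat.card {v // f v = i} ≤ 1 := by
      rw [Finite.card_le_one_iff_subsingleton]
      exact ⟨fun u v => Subtype.ext ((hne u u.2).trans (hne v v.2).symm)⟩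
    omega
  have hia : i ≠ f a := fun h => by rw [h] at hi; omega
  have hva : v ≠ a := fun h => hia (by rw [← hvi, h])
  refine ⟨v, hva, hvb, Function.update f v (f a), fun u w => ?_, fun j => ?_⟩
  · simp only [SimpleGraph.comap_adj] at hf
    rw [SimpleGraph.comap_adj]
    by_cases ha : u = v <;> by_cases hb : w = v
    · subst ha; subst hb; simp
    · subst ha; rw [Function.update_self, Function.update_of_ne hb, hf, Function.update_self,
        Function.update_of_ne hb]
    · subst hb; rw [Function.update_self, Function.update_of_ne ha, hf, Function.update_self,
        Function.update_of_ne ha]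
    · rw [Function.update_of_ne hb, Function.update_of_ne ha, hf, Function.update_of_ne hb,
        Function.update_of_ne ha]
  · simp only [Nat.card_eq_fintype_card, Fintype.card_subtype] at hc hi hsing ⊢
    by_cases hja : j = f a
    · subst hja
      have : Finset.univ.filter (fun w => Function.update f v (f a) w = f a) =
          insert v (Finset.univ.filter (fun w => f w = f a)) := by
        ext w
        by_cases hw : w = v
        · subst hw; simp
        · simp [hw]
      rw [this, Finset.card_insert_of_notMem (by simp [hvi, hia]), hsing]
      simp
    by_cases hji : j = i
    · subst hji
      have : Finset.univ.filter (fun w => Function.update f v (f a) w = j) =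
          (Finset.univ.filter (fun w => f w = j)).erase v := by
        ext w
        by_cases hw : w = v
        · subst hw; simp [Ne.symm hja]
        · simp [hw]
      rw [this, Finset.card_erase_of_mem (by simp [hvi]), hi]
      simp
    · have : Finset.univ.filter (fun w => Function.update f v (f a) w = j) =
          (Finset.univ.filter (fun w => f w = j)) := by
        ext w
        by_cases hw : w = v
        · subst hw; simp [Ne.symm hja, hvi, Ne.symm hji]
        · simp [hw]
      rw [this]
      exact hc j

end Clones

end Inducibility

namespace Inducibility

/-! ### Counting maps that pull a complete graph back to a balanced graph -/

section Counting

variable {α ι : Type*} [Fintype α] [Fintype ι]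

open scoped Nat

/-- Orbit counting: permutations of `α` act transitively on the maps with these fibre sizes, and
each map is reached by `∏ (n i)!` permutations. -/
theorem card_fiber_eq_mul_prod_factorial (n : ι → ℕ) (hn : ∑ i, n i = Fintype.card α) :
    Nat.card {f : α → ι // ∀ i, Nat.card {a // f a = i} = n i} * ∏ i, (n i)! =
      (Fintype.card α)! := by
  classical
  obtain ⟨f₀, hf₀⟩ : ∃ f₀ : α → ι, ∀ i, Nat.card {a // f₀ a = i} = n i := by
    have e : α ≃ (Σ i, Fin (n i)) := Fintype.equivOfCardEq (by simp [hn])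
    refine ⟨fun a => (e a).1, fun i => ?_⟩
    rw [Nat.card_congr ((e.subtypeEquiv fun a => Iff.rfl :
      {a // (e a).1 = i} ≃ {b : Σ i, Fin (n i) // b.1 = i}).trans (Equiv.sigmaSubtype i))]
    simp
  let X := {f : α → ι // ∀ i, Nat.card {a // f a = i} = n i}
  let Φ : Equiv.Perm α → X := fun g => ⟨f₀ ∘ g, fun i => by
    rw [← hf₀ i]
    exact Nat.card_congr (g.subtypeEquiv fun a => Iff.rfl)⟩
  have hfib : ∀ f : X, Nat.card {g // Φ g = f} = ∏ i, (n i)! := by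
    intro f
    obtain ⟨g₀, hg₀⟩ := exists_equiv_of_card_fiber_eq f.1 f₀ (fun i => by rw [f.2, hf₀])
    have h1 := DomMulAct.stabilizer_card f₀
    simp_rw [← Nat.card_eq_fintype_card (α := {a // f₀ a = _}), hf₀] at h1
    rw [← h1, Nat.card_eq_fintype_card]
    refine Fintype.card_congr ((Equiv.mulRight g₀⁻¹).subtypeEquiv fun g => ?_)
    constructor
    · intro h
      have h2 : f₀ ∘ g = f.1 := congrArg Subtype.val h
      funext a
      have := congrFun h2 (g₀⁻¹ a)
      simp only [Function.comp_apply] at this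
      simp only [Equiv.coe_mulRight, Equiv.Perm.coe_mul, Function.comp_apply, this]
      rw [← hg₀]
      simp
    · intro h
      refine Subtype.ext (funext fun a => ?_)
      have := congrFun h (g₀ a)
      simp only [Equiv.coe_mulRight, Equiv.Perm.coe_mul, Function.comp_apply,
        hg₀] at this
      rw [show g₀⁻¹ (g₀ a) = a from g₀.symm_apply_apply a] at this
      exact this
  have h2 := Nat.card_congr (Equiv.sigmaFiberEquiv Φ)
  rw [Nat.card_sigma, Finset.sum_congr rfl (fun f _ => hfib f)] at h2
  rw [Nat.card_eq_fintype_card (α := Equiv.Perm α), Fintype.card_perm] at h2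
  rw [← h2]
  simp [X, Nat.card_eq_fintype_card]

/-- Since `1 ≤ p`, every part is non-empty, so the parts are exactly the non-empty fibres of `σ`. -/
theorem isBalanced_comap_top_iff {r p : ℕ} (hp : 1 ≤ p) (σ : α → ι) :
    IsBalanced r p ((⊤ : SimpleGraph ι).comap σ) ↔
      (∀ i, Nat.card {a // σ a = i} = 0 ∨ Nat.card {a // σ a = i} = p ∨
        Nat.card {a // σ a = i} = p + 1) ∧ Nat.card {i // Nat.card {a // σ a = i} ≠ 0} = r := by
  classical
  have hne : ∀ i, Nat.card {a // σ a = i} ≠ 0 ↔ ∃ a, σ a = i := by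
    intro i
    rw [Nat.card_ne_zero]
    exact ⟨fun ⟨⟨a⟩, _⟩ => ⟨a, a.2⟩, fun ⟨a, ha⟩ => ⟨⟨⟨a, ha⟩⟩, inferInstance⟩⟩
  constructor
  · rintro ⟨f, hf, hc⟩
    have hf' : ∀ u v, σ u = σ v ↔ f u = f v := fun u v => by
      have := hf u v
      rw [SimpleGraph.comap_adj, SimpleGraph.top_adj] at this
      exact not_iff_not.1 this
    constructor
    · intro i
      by_cases h : Nat.card {a // σ a = i} = 0
      · exact Or.inl h
      right
      obtain ⟨a, rfl⟩ := (hne i).1 h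
      have : Nat.card {b // σ b = σ a} = Nat.card {b // f b = f a} :=
        Nat.card_congr (Equiv.subtypeEquivRight fun b => hf' b a)
      rw [this]
      exact hc _
    · have hsurj : ∀ j, ∃ a, f a = j := by
        intro j
        by_contra h
        push Not at h
        have : Nat.card {v // f v = j} = 0 := by
          rw [Nat.card_eq_zero]
          exact Or.inl ⟨fun a => h _ a.2⟩
        rcases hc j with h | h <;> omega
      choose g hg using hsurj
      have hbij : Function.Bijective
          (fun j => (⟨σ (g j), (hne _).2 ⟨g j, rfl⟩⟩ : {i // Nat.card {a // σ a = i} ≠ 0})) := by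
        constructor
        · intro j k hjk
          have := (hf' _ _).1 (congrArg Subtype.val hjk)
          rwa [hg, hg] at this
        · rintro ⟨i, hi⟩
          obtain ⟨a, rfl⟩ := (hne i).1 hi
          exact ⟨f a, Subtype.ext ((hf' _ _).2 (hg _))⟩
      rw [← Nat.card_eq_of_bijective _ hbij]
      simp
  · rintro ⟨h1, h2⟩
    have e : {i // Nat.card {a // σ a = i} ≠ 0} ≃ Fin r :=
      Fintype.equivOfCardEq (by rw [← Nat.card_eq_fintype_card, h2, Fintype.card_fin])
    refine ⟨fun a => e ⟨σ a, (hne _).2 ⟨a, rfl⟩⟩, fun u v => ?_, fun j => ?_⟩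
    · rw [SimpleGraph.comap_adj, SimpleGraph.top_adj, e.injective.ne_iff, Ne, Ne, Subtype.mk.injEq]
    · have : Nat.card {v // e ⟨σ v, (hne _).2 ⟨v, rfl⟩⟩ = j} =
          Nat.card {a // σ a = (e.symm j).1} :=
        Nat.card_congr (Equiv.subtypeEquivRight fun b => by
          rw [← Equiv.eq_symm_apply, Subtype.ext_iff])
      rw [this]
      exact (h1 _).resolve_left (e.symm j).2

variable (α ι) in
/-- The number of maps `α → ι` under which the complete graph on `ι` pulls back to a balanced
multipartite graph. -/
noncomputable def balancedMaps (r p : ℕ) : ℕ :=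
  Nat.card {σ : α → ι // IsBalanced r p ((⊤ : SimpleGraph ι).comap σ)}

theorem balancedMaps_eq_zero {r p : ℕ} (hp : 1 ≤ p) (h : Fintype.card ι < r) :
    balancedMaps α ι r p = 0 := by
  rw [balancedMaps, Nat.card_eq_zero]
  left
  refine ⟨fun ⟨σ, hσ⟩ => ?_⟩
  have := ((isBalanced_comap_top_iff hp σ).1 hσ).2
  have h2 : Nat.card {i // Nat.card {a // σ a = i} ≠ 0} ≤ Nat.card ι :=
    Nat.card_le_card_of_injective _ Subtype.val_injective
  rw [Nat.card_eq_fintype_card (α := ι)] at h2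
  omega

/-- Choose first which points have a fibre of size `0`, `p` or `p + 1`, then a map with these fibre
sizes. Both choices are multinomial, and `(p!)^(r-q) ((p+1)!)^q = (p!)^r (p+1)^q`. -/
theorem balancedMaps_mul {r p q : ℕ} (hp : 1 ≤ p) (hα : Fintype.card α = p * r + q) (hq : q < r)
    (h : r ≤ Fintype.card ι) :
    balancedMaps α ι r p * ((Fintype.card ι - r)! * (r - q)! * q ! * p ! ^ r * (p + 1) ^ q) =
      (Fintype.card ι)! * (Fintype.card α)! := by
  classical
  -- The type `j` stands for fibre size `val j` and occurs `cnt j` times. As `1 ≤ p`, the three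
  -- sizes are distinct, so a map determines its types.
  let val : Fin 3 → ℕ := ![0, p, p + 1]
  let cnt : Fin 3 → ℕ := ![Fintype.card ι - r, r - q, q]
  have hcnt : ∑ j, cnt j = Fintype.card ι := by
    simp only [Fin.sum_univ_three, cnt]
    simp
    omega
  let H := {h : ι → Fin 3 // ∀ j, Nat.card {i // h i = j} = cnt j}
  have hH := card_fiber_eq_mul_prod_factorial cnt hcnt
  have hval : Function.Injective val := by
    intro a b hab
    fin_cases a <;> fin_cases b <;> simp [val] at hab ⊢ <;> omega
  have hprod : ∀ (F : ℕ → ℕ) (h : H), ∏ i, F (val (h.1 i)) = ∏ j, F (val j) ^ cnt j := by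
    intro F h
    rw [← Finset.prod_fiberwise (s := Finset.univ) (g := h.1)]
    refine Finset.prod_congr rfl fun j _ => ?_
    rw [Finset.prod_congr rfl (g := fun _ => F (val j))
      (fun i hi => by rw [(Finset.mem_filter.1 hi).2]), Finset.prod_const]
    congr 1
    rw [← h.2 j, Nat.card_eq_fintype_card, Fintype.card_subtype]
  have hsum : ∀ (h : H), ∑ i, val (h.1 i) = ∑ j, cnt j * val j := by
    intro h
    rw [← Finset.sum_fiberwise (s := Finset.univ) (g := h.1)]
    refine Finset.sum_congr rfl fun j _ => ?_
    rw [Finset.sum_congr rfl (g := fun _ => (val j))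
      (fun i hi => by rw [(Finset.mem_filter.1 hi).2]), Finset.sum_const]
    rw [← h.2 j, Nat.card_eq_fintype_card, Fintype.card_subtype, smul_eq_mul]
  have hα' : ∑ j, cnt j * val j = Fintype.card α := by
    simp only [Fin.sum_univ_three, cnt, val]
    simp
    rw [hα]
    zify [hq.le]
    ring
  have hX : ∀ h : H, Nat.card {σ : α → ι // ∀ i, Nat.card {a // σ a = i} = val (h.1 i)} *
      (p ! ^ r * (p + 1) ^ q) = (Fintype.card α)! := by
    intro h
    rw [← card_fiber_eq_mul_prod_factorial (fun i => val (h.1 i)) ((hsum h).trans hα'),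
      hprod Nat.factorial h]
    congr 1
    simp only [Fin.prod_univ_three, cnt, val]
    simp only [Matrix.cons_val_zero, Matrix.cons_val_one, Matrix.cons_val]
    rw [Nat.factorial_succ, mul_pow]
    have : p ! ^ r = p ! ^ (r - q) * p ! ^ q := by rw [← pow_add]; congr 1; omega
    rw [this]
    simp
    ring
  have hcard : balancedMaps α ι r p =
      ∑ h : H, Nat.card {σ : α → ι // ∀ i, Nat.card {a // σ a = i} = val (h.1 i)} := by
    rw [balancedMaps, ← Nat.card_sigma]
    symm
    refine Nat.card_eq_of_bijective (fun x => ⟨x.2.1, ?_⟩) ⟨?_, ?_⟩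
    · rw [isBalanced_comap_top_iff hp]
      obtain ⟨h, σ, hσ⟩ := x
      simp only
      constructor
      · intro i
        rw [hσ]
        generalize h.1 i = j
        fin_cases j <;> simp [val]
      · have h1 := h.2 0
        have h2 := Fintype.card_subtype_compl (fun i : ι => h.1 i = 0)
        rw [Nat.card_eq_fintype_card] at h1
        rw [h1] at h2
        rw [Nat.card_eq_fintype_card]
        have h3 : Fintype.card {i // Nat.card {a // σ a = i} ≠ 0} =
            Fintype.card {i // ¬ h.1 i = 0} := by
          refine Fintype.card_congr (Equiv.subtypeEquivRight fun i => ?_)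
          rw [hσ]
          rw [show (0 : ℕ) = val 0 from rfl, hval.ne_iff]
        rw [h3, h2]
        simp only [cnt, Matrix.cons_val_zero]
        omega
    · rintro ⟨h, σ, hσ⟩ ⟨h', σ', hσ'⟩ heq
      have : σ = σ' := congrArg Subtype.val heq
      subst this
      have : h = h' := Subtype.ext (funext fun i => hval (by rw [← hσ, ← hσ']))
      subst this
      rfl
    · rintro ⟨σ, hσ⟩
      rw [isBalanced_comap_top_iff hp] at hσ
      obtain ⟨h1, h2⟩ := hσ
      have h3 : ∀ i, ∃ j, Nat.card {a // σ a = i} = val j := by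
        intro i
        rcases h1 i with h | h | h
        · exact ⟨0, h⟩
        · exact ⟨1, h⟩
        · exact ⟨2, h⟩
      choose g hg using h3
      have hs : ∑ i, val (g i) = Fintype.card α := by
        rw [← sum_card_fiber σ]
        exact Finset.sum_congr rfl fun i _ => (hg i).symm
      have hc := sum_card_fiber g
      rw [Fin.sum_univ_three] at hc
      have h0 : Nat.card {i // g i = 0} = Fintype.card ι - r := by
        have h4 := Fintype.card_subtype_compl (fun i : ι => g i = 0)
        have h5 : Fintype.card {i // ¬ g i = 0} = r := by
          rw [← h2, Nat.card_eq_fintype_card]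
          refine Fintype.card_congr (Equiv.subtypeEquivRight fun i => ?_)
          rw [hg]
          rw [show (0 : ℕ) = val 0 from rfl, hval.ne_iff]
        have h6 := Fintype.card_subtype_le (fun i : ι => g i = 0)
        rw [Nat.card_eq_fintype_card]
        omega
      -- Summing fibre sizes by type gives `pr + q`; with exactly `r` non-empty fibres this forces
      -- `q` large ones.
      have hs2 : ∑ i, val (g i) = ∑ j, Nat.card {i // g i = j} * val j := by
        rw [← Finset.sum_fiberwise (s := Finset.univ) (g := g)]
        refine Finset.sum_congr rfl fun j _ => ?_
        rw [Finset.sum_congr rfl (g := fun _ => (val j))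
          (fun i hi => by rw [(Finset.mem_filter.1 hi).2]), Finset.sum_const]
        rw [Nat.card_eq_fintype_card, Fintype.card_subtype, smul_eq_mul]
      rw [hs, hα, Fin.sum_univ_three] at hs2
      simp only [val, Matrix.cons_val_zero, Matrix.cons_val_one, Matrix.cons_val] at hs2
      have h12 : Nat.card {i // g i = 1} + Nat.card {i // g i = 2} = r := by omega
      have h22 : Nat.card {i // g i = 2} = q := by
        rw [← h12] at hs2
        nlinarith
      have hgH : ∀ j, Nat.card {i // g i = j} = cnt j := by
        intro j
        fin_cases j
        · exact h0
        · show Nat.card {i // g i = 1} = r - q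
          omega
        · exact h22
      exact ⟨⟨⟨g, hgH⟩, ⟨σ, hg⟩⟩, rfl⟩
  have hH' : Nat.card H * ((Fintype.card ι - r)! * (r - q)! * q !) = (Fintype.card ι)! := by
    rw [← hH]
    congr 1
    simp only [Fin.prod_univ_three, cnt]
    rfl
  rw [hcard]
  calc _ = (∑ h : H, Nat.card {σ : α → ι // ∀ i, Nat.card {a // σ a = i} = val (h.1 i)} *
      (p ! ^ r * (p + 1) ^ q)) * ((Fintype.card ι - r)! * (r - q)! * q !) := by
        rw [← Finset.sum_mul]; ring
    _ = _ := by
      rw [Finset.sum_congr rfl (fun h _ => hX h), ← hH']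
      simp [Nat.card_eq_fintype_card]
      ring

end Counting

end Inducibility

/-! ### Equal blow-ups of cliques: dependence on the number of parts -/

namespace Inducibility

open scoped Nat

/-- The density of a balanced `r`-partite graph on `s` vertices with smallest part of size `p` in
the blow-up of `K_m` with equal parts. -/
noncomputable def equipartiteDensity (s r p m : ℕ) : ℝ :=
  (balancedMaps (Fin s) (Fin m) r p : ℝ) / (m : ℝ) ^ s

theorem equipartiteDensity_eq {s r p q m : ℕ} (hp : 1 ≤ p) (hs : s = p * r + q) (hq : q < r)
    (h : r ≤ m) : equipartiteDensity s r p m = ((m ! : ℝ) * s !) /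
      ((m - r)! * (r - q)! * q ! * (p ! : ℝ) ^ r * ((p : ℝ) + 1) ^ q * (m : ℝ) ^ s) := by
  have h1 := balancedMaps_mul (α := Fin s) (ι := Fin m) hp (by simpa using hs) hq (by simpa using h)
  rw [Fintype.card_fin, Fintype.card_fin] at h1
  have h2 : (m : ℝ) ^ s ≠ 0 := by
    have : 0 < m := by omega
    positivity
  have h3 : (((m - r)! * (r - q)! * q ! * p ! ^ r * (p + 1) ^ q : ℕ) : ℝ) ≠ 0 := by
    norm_cast
    positivity
  have h4 : (balancedMaps (Fin s) (Fin m) r p : ℝ) =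
      (m ! * s ! : ℕ) / (((m - r)! * (r - q)! * q ! * p ! ^ r * (p + 1) ^ q : ℕ) : ℝ) := by
    rw [eq_div_iff h3]
    exact_mod_cast h1
  rw [equipartiteDensity, h4, div_div]
  push_cast
  rfl

theorem equipartiteDensity_pos {s r p q m : ℕ} (hp : 1 ≤ p) (hs : s = p * r + q) (hq : q < r)
    (h : r ≤ m) : 0 < equipartiteDensity s r p m := by
  rw [equipartiteDensity_eq hp hs hq h]
  have : 0 < m := by omega
  positivity

theorem equipartiteDensity_of_lt {s r p m : ℕ} (hp : 1 ≤ p) (h : m < r) :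
    equipartiteDensity s r p m = 0 := by
  rw [equipartiteDensity, balancedMaps_eq_zero hp (by simpa using h)]
  simp

/-- Only the factors `m!`, `(m - r)!` and `m^s` change with `m`. The sign of the increment is thus
decided by comparing `(1 - u)^s` with `1 - ru` at `u = 1/(m+1)`. -/
theorem equipartiteDensity_succ {s r p q m : ℕ} (hp : 1 ≤ p) (hs : s = p * r + q) (hq : q < r)
    (h : r ≤ m) : equipartiteDensity s r p (m + 1) * (1 - r / ((m + 1 : ℕ) : ℝ)) =
      equipartiteDensity s r p m * (1 - 1 / ((m + 1 : ℕ) : ℝ)) ^ s := by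
  rw [equipartiteDensity_eq hp hs hq h, equipartiteDensity_eq hp hs hq (by omega)]
  have e1 : (1 - 1 / ((m + 1 : ℕ) : ℝ)) = m / ((m + 1 : ℕ) : ℝ) := by
    push_cast; field_simp; ring
  have e2 : (1 - r / ((m + 1 : ℕ) : ℝ)) = ((m - r + 1 : ℕ) : ℝ) / ((m + 1 : ℕ) : ℝ) := by
    push_cast [Nat.cast_sub h]; field_simp; ring
  rw [e1, e2, div_pow, show m + 1 - r = (m - r) + 1 by omega, Nat.factorial_succ,
    Nat.factorial_succ]
  have hm : (0 : ℝ) < m := by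
    have : 0 < m := by omega
    exact_mod_cast this
  have h5 : ((m - r + 1 : ℕ) : ℝ) ≠ 0 := by positivity
  push_cast at h5 ⊢
  field_simp

section Convexity

variable {s r : ℕ}

/-- The convex function `(1 - u)^s` agrees with `1 - ru` at `0`, so an inequality at `u` passes to
all of `[0, u]` along the chord. -/
theorem one_sub_pow_le_of_le {u v : ℝ} (hv : 0 ≤ v) (hvu : v ≤ u) (hu : u ≤ 1)
    (h : (1 - u) ^ s ≤ 1 - r * u) : (1 - v) ^ s ≤ 1 - r * v := by
  rcases hv.eq_or_lt with rfl | hv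
  · simp
  have hu0 : 0 < u := hv.trans_le hvu
  have h1 : v / u ≤ 1 := (div_le_one hu0).2 hvu
  have h0 : 0 ≤ v / u := by positivity
  have hx : 1 - u ∈ Set.Ici (0 : ℝ) := by simp; linarith
  have hy : (1 : ℝ) ∈ Set.Ici (0 : ℝ) := by simp
  have := (convexOn_pow (𝕜 := ℝ) s).2 hx hy h0 (sub_nonneg.2 h1) (add_sub_cancel _ _)
  simp only [smul_eq_mul, one_pow, mul_one] at this
  have e : v / u * (1 - u) + (1 - v / u) = 1 - v := by field_simp; ring
  rw [e] at this
  refine this.trans ?_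
  have h2 := mul_le_mul_of_nonneg_left h h0
  have e2 : v / u * (1 - r * u) = v / u - r * v := by field_simp
  linarith

/-- With `u = 1/n`, `(1 - u)^s ≤ (1 + u)^(-s) ≤ (1 + su)^(-1) ≤ 1 - ru`; the last step uses `rsu ≤ 1
≤ s - r`. -/
theorem one_sub_pow_le_of_small (hrs : r < s) {n : ℕ} (hn : r * s ≤ n) (hn1 : 1 ≤ n) :
    (1 - 1 / (n : ℝ)) ^ s ≤ 1 - r * (1 / (n : ℝ)) := by
  set u : ℝ := 1 / n
  have hn0 : (0 : ℝ) < n := by exact_mod_cast hn1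
  have hu0 : 0 < u := by positivity
  have hu1 : u ≤ 1 := by rw [div_le_one hn0]; exact_mod_cast hn1
  have hru : r * s * u ≤ 1 := by
    have : (r * s : ℝ) ≤ n := by exact_mod_cast hn
    calc r * s * u ≤ n * u := by gcongr
      _ = 1 := by simp [u, hn0.ne']
  have h1 : (1 - u) ^ s * (1 + u) ^ s ≤ 1 := by
    rw [← mul_pow]
    exact pow_le_one₀ (by nlinarith) (by nlinarith)
  have h2 : 1 + s * u ≤ (1 + u) ^ s := one_add_mul_le_pow (by linarith) s
  have hsr : (r : ℝ) + 1 ≤ s := by exact_mod_cast hrs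
  have h3 : 0 ≤ (1 - u) ^ s := pow_nonneg (by linarith) _
  have h4 : (1 - u) ^ s * (1 + s * u) ≤ 1 := (mul_le_mul_of_nonneg_left h2 h3).trans h1
  have h5 : 1 ≤ (1 - r * u) * (1 + s * u) := by
    have : (1 - r * u) * (1 + s * u) = 1 + u * ((s - r) - r * s * u) := by ring
    rw [this]
    have : 0 ≤ u * ((s - r) - r * s * u) := mul_nonneg hu0.le (by linarith)
    linarith
  have h6 : 0 < 1 + s * u := by positivity
  exact le_of_mul_le_mul_right (h4.trans h5) h6

/-- Clearing denominators, equality would make `n` divide a power of `n - 1`, which is coprime to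
`n`. This excludes ties between consecutive numbers of parts. -/
theorem one_sub_pow_ne {n : ℕ} (hrn : r < n) (hs : 2 ≤ s) (hn : 2 ≤ n) :
    (1 - 1 / (n : ℝ)) ^ s ≠ 1 - r * (1 / (n : ℝ)) := by
  intro h
  have hn0 : (0 : ℝ) < n := by positivity
  have e1 : 1 - 1 / (n : ℝ) = ((n - 1 : ℕ) : ℝ) / n := by
    rw [Nat.cast_sub (by omega)]; field_simp; simp
  have e2 : 1 - r * (1 / (n : ℝ)) = ((n - r : ℕ) : ℝ) / n := by
    rw [Nat.cast_sub hrn.le]; field_simp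
  rw [e1, e2, div_pow, div_eq_div_iff (by positivity) (by positivity)] at h
  obtain ⟨k, rfl⟩ : ∃ k, s = k + 2 := ⟨s - 2, by omega⟩
  have h2 : ((n - 1 : ℕ) : ℝ) ^ (k + 2) = (n - r : ℕ) * (n : ℝ) ^ (k + 1) := by
    have : ((n - 1 : ℕ) : ℝ) ^ (k + 2) * n = ((n - r : ℕ) * (n : ℝ) ^ (k + 1)) * n := by
      rw [h]; ring
    exact mul_right_cancel₀ hn0.ne' this
  have h3 : (n - 1) ^ (k + 2) = (n - r) * n ^ (k + 1) := by exact_mod_cast h2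
  have h4 : n ∣ (n - 1) ^ (k + 2) := by
    rw [h3]
    exact Dvd.dvd.mul_left (dvd_pow_self n (by omega)) _
  have h5 : Nat.Coprime n (n - 1) := by
    rw [Nat.coprime_self_sub_right (by omega)]
    exact Nat.coprime_one_right n
  have h6 := Nat.Coprime.eq_one_of_dvd (h5.pow_right _) h4
  omega

theorem one_lt_ratio_iff {n : ℕ} (hrn : r < n) :
    (1 : ℝ) < (n : ℝ) / ((n : ℝ) - r) * (1 - 1 / (n : ℝ)) ^ s ↔
      1 - r * (1 / (n : ℝ)) < (1 - 1 / (n : ℝ)) ^ s := by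
  have hn0 : (0 : ℝ) < n := by
    have : 0 < n := by omega
    exact_mod_cast this
  have h1 : (0 : ℝ) < n - r := by
    have : (r : ℝ) < n := by exact_mod_cast hrn
    linarith
  have e : 1 - r * (1 / (n : ℝ)) = (n - r) / n := by field_simp
  rw [e, div_lt_iff₀ hn0, div_mul_eq_mul_div, lt_div_iff₀ h1, one_mul, mul_comm]

end Convexity

/-- For `n > r`, membership in the set means that the density grows strictly from `n - 1` to `n`
parts. Convexity makes the set downward closed above `r`, and `rs` bounds it, so the density rises
up to its greatest element and falls after it. -/
theorem exists_isGreatest_equipartiteDensity {s r p q : ℕ} (hr : 2 ≤ r) (hrs : r < s)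
    (hs : s = p * r + q) (hq : q < r) :
    ∃ t : ℕ, IsGreatest {n : ℕ | n = r ∨
        (r < n ∧ (1 : ℝ) < (n : ℝ) / ((n : ℝ) - r) * (1 - 1 / (n : ℝ)) ^ s)} t ∧ r ≤ t ∧
      (∀ l m, r ≤ l → m < l → l ≤ t → equipartiteDensity s r p m < equipartiteDensity s r p l) ∧
      ∀ m, t < m → equipartiteDensity s r p m < equipartiteDensity s r p t := by
  have hp : 1 ≤ p := by
    rcases Nat.eq_zero_or_pos p with h | h
    · subst h; omega
    · exact h
  set X := {n : ℕ | n = r ∨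
        (r < n ∧ (1 : ℝ) < (n : ℝ) / ((n : ℝ) - r) * (1 - 1 / (n : ℝ)) ^ s)} with hX
  have hmem : ∀ n, r < n → (n ∈ X ↔ 1 - r * (1 / (n : ℝ)) < (1 - 1 / (n : ℝ)) ^ s) := by
    intro n hn
    rw [← one_lt_ratio_iff hn, hX, Set.mem_ofPred_eq]
    constructor
    · rintro (h | h)
      · omega
      · exact h.2
    · exact fun h => Or.inr ⟨hn, h⟩
  have hbdd : ∀ n ∈ X, n ≤ r * s := by
    intro n hn
    by_contra hlt
    push Not at hlt
    have h1 : r < n := lt_of_le_of_lt (by nlinarith) hlt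
    exact absurd ((hmem n h1).1 hn) (not_lt.2 (one_sub_pow_le_of_small hrs hlt.le (by omega)))
  have hdown : ∀ n m, r < n → n ≤ m → m ∈ X → n ∈ X := by
    intro n m hn hnm hm
    rw [hmem n hn]
    by_contra h
    push Not at h
    have h1 := (hmem m (hn.trans_le hnm)).1 hm
    refine absurd h1 (not_lt.2 (one_sub_pow_le_of_le (u := 1 / (n : ℝ)) (by positivity)
      ?_ ?_ h))
    · have : (0 : ℝ) < n := by
        have : 0 < n := by omega
        exact_mod_cast this
      gcongr
    · rw [div_le_one]
      · have : 1 ≤ n := by omega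
        exact_mod_cast this
      · have : 0 < n := by omega
        exact_mod_cast this
  obtain ⟨t, ht⟩ : ∃ t, IsGreatest X t := by
    have hne : X.Nonempty := ⟨r, Or.inl rfl⟩
    exact ⟨sSup X, Nat.sSup_mem hne ⟨r * s, hbdd⟩, fun n hn => le_csSup ⟨r * s, hbdd⟩ hn⟩
  have hrt : r ≤ t := ht.2 (Or.inl rfl)
  have hpos := fun m (h : r ≤ m) => equipartiteDensity_pos hp hs hq h
  have hup : ∀ n, r ≤ n → n + 1 ≤ t →
      equipartiteDensity s r p n < equipartiteDensity s r p (n + 1) := by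
    intro n hn hnt
    have h1 := (hmem (n + 1) (by omega)).1 (hdown (n + 1) t (by omega) hnt ht.1)
    have h2 := equipartiteDensity_succ hp hs hq hn
    have h3 : (0 : ℝ) < 1 - r * (1 / ((n + 1 : ℕ) : ℝ)) := by
      have : (r : ℝ) < (n + 1 : ℕ) := by exact_mod_cast (by omega : r < n + 1)
      rw [mul_one_div, sub_pos, div_lt_one (by positivity)]
      exact this
    rw [mul_one_div] at h1 h3
    have h4 := mul_lt_mul_of_pos_left h1 (hpos n hn)
    rw [← h2] at h4
    exact lt_of_mul_lt_mul_right h4 h3.le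
  have hdn : ∀ n, t ≤ n → equipartiteDensity s r p (n + 1) < equipartiteDensity s r p n := by
    intro n hn
    have h0 : n + 1 ∉ X := fun h => by have := ht.2 h; omega
    rw [hmem (n + 1) (by omega), not_lt] at h0
    have h1 := lt_of_le_of_ne h0
      (one_sub_pow_ne (s := s) (n := n + 1) (by omega) (by omega) (by omega))
    have h2 := equipartiteDensity_succ hp hs hq (hrt.trans hn)
    have h3 : (0 : ℝ) < 1 - r * (1 / ((n + 1 : ℕ) : ℝ)) := by
      have : (r : ℝ) < (n + 1 : ℕ) := by exact_mod_cast (by omega : r < n + 1)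
      rw [mul_one_div, sub_pos, div_lt_one (by positivity)]
      exact this
    rw [mul_one_div] at h1 h3
    have h4 := mul_lt_mul_of_pos_left h1 (hpos n (hrt.trans hn))
    rw [← h2] at h4
    exact lt_of_mul_lt_mul_right h4 h3.le
  refine ⟨t, ht, hrt, ?_, ?_⟩
  · intro l m hl hml hlt
    by_cases hm : m < r
    · rw [equipartiteDensity_of_lt hp hm]
      exact hpos l hl
    push Not at hm
    induction l, hml using Nat.le_induction with
    | base => exact hup m hm hlt
    | succ l hml ih =>
      exact (ih (by omega) (by omega)).trans (hup l (by omega) hlt)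
  · intro m hm
    induction m, hm using Nat.le_induction with
    | base => exact hdn t le_rfl
    | succ l hml ih => exact (hdn l (by omega)).trans ih

end Inducibility

/-! ### Product measures and densities of measurable graphs -/

namespace Inducibility

open scoped NNReal ENNReal

section PiMeasure

variable {V Ω : Type*} [Fintype V] [MeasurableSpace Ω]

/-- The multinomial expansion: each coordinate chooses a component `σ v` of the mixture. It makes
densities of mixtures polynomials in the weights. -/
theorem pi_sum_smul [DecidableEq V] {J : Type*} [Fintype J] (w : J → ℝ≥0) (ν : J → Measure Ω)
    [∀ j, IsFiniteMeasure (ν j)] :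
    Measure.pi (fun _ : V => ∑ j, w j • ν j) =
      ∑ σ : V → J, (∏ v, w (σ v)) • Measure.pi (fun v => ν (σ v)) := by
  classical
  refine Measure.pi_eq fun B _ => ?_
  rw [Measure.finsetSum_apply]
  simp only [Measure.smul_apply, Measure.pi_pi, Measure.finsetSum_apply]
  rw [Finset.prod_univ_sum, Fintype.piFinset_univ]
  refine Finset.sum_congr rfl fun σ _ => ?_
  simp only [ENNReal.smul_def, smul_eq_mul]
  rw [Finset.prod_mul_distrib]
  push_cast
  rfl

theorem pi_real_sum_smul [DecidableEq V] {J : Type*} [Fintype J] (w : J → ℝ≥0)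
    (ν : J → Measure Ω) [∀ j, IsFiniteMeasure (ν j)] (S : Set (V → Ω)) :
    (Measure.pi (fun _ : V => ∑ j, w j • ν j)).real S =
      ∑ σ : V → J, (∏ v, (w (σ v) : ℝ)) * (Measure.pi (fun v => ν (σ v))).real S := by
  rw [pi_sum_smul, measureReal_def, Measure.finsetSum_apply, ENNReal.toReal_sum]
  · refine Finset.sum_congr rfl fun σ _ => ?_
    rw [Measure.smul_apply, ENNReal.smul_def, smul_eq_mul, ENNReal.toReal_mul, measureReal_def]
    simp
  · intro σ _
    exact measure_ne_top _ _

theorem ae_pi_forall {ν : V → Measure Ω} [∀ v, SigmaFinite (ν v)] {P : V → Ω → Prop}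
    (h : ∀ v, ∀ᵐ z ∂ν v, P v z) : ∀ᵐ t ∂Measure.pi ν, ∀ v, P v (t v) :=
  eventually_all.2 fun v => Measure.tendsto_eval_ae_ae.eventually (h v)

/-- Overwriting coordinate `v` integrates it out, which leaves its total mass as a factor. -/
theorem pi_map_update [DecidableEq V] (ν : V → Measure Ω) [∀ v, IsFiniteMeasure (ν v)] (v : V)
    (x : Ω) : (Measure.pi ν).map (fun t => Function.update t v x) =
      ν v Set.univ • Measure.pi (Function.update ν v (Measure.dirac x)) := by
  have inst : ∀ u, IsFiniteMeasure (Function.update ν v (Measure.dirac x) u) := by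
    intro u
    by_cases h : u = v
    · subst h; rw [Function.update_self]; infer_instance
    · rw [Function.update_of_ne h]; infer_instance
  have inst' : ∀ u, IsFiniteMeasure
      (Function.update ν v (ν v Set.univ • Measure.dirac x) u) := by
    intro u
    by_cases h : u = v
    · subst h; rw [Function.update_self]; exact Measure.smul_finite _ (measure_ne_top _ _)
    · rw [Function.update_of_ne h]; infer_instance
  have hm : Measurable (fun t : V → Ω => Function.update t v x) := by
    refine measurable_pi_lambda _ fun u => ?_
    by_cases h : u = v
    · subst h; simp
    · simp only [Function.update_of_ne h]; exact measurable_pi_apply u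
  have key : ∀ B : V → Set Ω, (∀ u, MeasurableSet (B u)) →
      (Measure.pi ν).map (fun t => Function.update t v x) (Set.univ.pi B) =
        ∏ u, Function.update ν v (ν v Set.univ • Measure.dirac x) u (B u) := by
    intro B hB
    rw [Measure.map_apply hm (MeasurableSet.univ_pi hB)]
    by_cases hx : x ∈ B v
    · have : (fun t : V → Ω => Function.update t v x) ⁻¹' (Set.univ.pi B) =
          Set.univ.pi (Function.update B v Set.univ) := by
        ext t
        simp only [Set.mem_preimage, Set.mem_univ_pi]
        refine forall_congr' fun u => ?_
        by_cases h : u = v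
        · subst h; simp [hx]
        · simp [Function.update_of_ne h]
      rw [this, Measure.pi_pi]
      refine Finset.prod_congr rfl fun u _ => ?_
      by_cases h : u = v
      · subst h; simp [hx]
      · simp [Function.update_of_ne h]
    · have : (fun t : V → Ω => Function.update t v x) ⁻¹' (Set.univ.pi B) = ∅ := by
        ext t
        simp only [Set.mem_preimage, Set.mem_univ_pi, Set.mem_empty_iff_false, iff_false]
        intro h
        have := h v
        rw [Function.update_self] at this
        exact hx this
      rw [this, measure_empty]
      symm
      refine Finset.prod_eq_zero (Finset.mem_univ v) ?_
      simp [hx, hB v]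
  have h1 : Measure.pi (Function.update ν v (ν v Set.univ • Measure.dirac x)) =
      (Measure.pi ν).map (fun t => Function.update t v x) :=
    Measure.pi_eq (μ := Function.update ν v (ν v Set.univ • Measure.dirac x)) key
  rw [← h1]
  refine Measure.pi_eq (μ := Function.update ν v (ν v Set.univ • Measure.dirac x)) fun B hB => ?_
  rw [Measure.smul_apply, Measure.pi_pi, smul_eq_mul,
    ← Finset.mul_prod_erase _ _ (Finset.mem_univ v), ← mul_assoc,
    ← Finset.mul_prod_erase _ _ (Finset.mem_univ v)]
  congr 1
  · simp
  · refine Finset.prod_congr rfl fun u hu => ?_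
    have h := Finset.ne_of_mem_erase hu
    rw [Function.update_of_ne h, Function.update_of_ne h]

end PiMeasure

section Density

variable {V Ω : Type*} [Fintype V] [MeasurableSpace Ω]

/-- The adjacency relation of `G` is measurable. -/
def MeasurableAdj (G : SimpleGraph Ω) : Prop :=
  MeasurableSet {z : Ω × Ω | G.Adj z.1 z.2}

theorem MeasurableAdj.measurableSet_comap {G : SimpleGraph Ω} (hG : MeasurableAdj G)
    (P : SimpleGraph V → Prop) : MeasurableSet {t : V → Ω | P (G.comap t)} := by
  classical
  have : {t : V → Ω | P (G.comap t)} =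
      ⋃ H : {H : SimpleGraph V // P H}, ⋂ u : V, ⋂ v : V,
        {t : V → Ω | G.Adj (t u) (t v) ↔ H.1.Adj u v} := by
    ext t
    simp only [Set.mem_ofPred_eq, Set.mem_iUnion, Set.mem_iInter]
    constructor
    · exact fun h => ⟨⟨_, h⟩, fun u v => Iff.rfl⟩
    · rintro ⟨⟨H, hH⟩, h⟩
      have : G.comap t = H := by
        ext u v
        exact h u v
      rwa [this]
  rw [this]
  refine MeasurableSet.iUnion fun H => MeasurableSet.iInter fun u => MeasurableSet.iInter fun v => ?_
  have hm : MeasurableSet {t : V → Ω | G.Adj (t u) (t v)} :=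
    by
    have hm : Measurable fun t : V → Ω => (t u, t v) :=
      (measurable_pi_apply u).prodMk (measurable_pi_apply v)
    exact hm (show MeasurableSet {z : Ω × Ω | G.Adj z.1 z.2} from hG)
  by_cases h : H.1.Adj u v
  · simp only [h, iff_true]; exact hm
  · simp only [h, iff_false]; exact hm.compl

/-- The tuples of points inducing a balanced multipartite graph. -/
def balancedTuples (V : Type*) [Fintype V] (r p : ℕ) (G : SimpleGraph Ω) : Set (V → Ω) :=
  {t | IsBalanced r p (G.comap t)}

theorem MeasurableAdj.measurableSet_balancedTuples {G : SimpleGraph Ω} (hG : MeasurableAdj G)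
    (r p : ℕ) : MeasurableSet (balancedTuples V r p G) :=
  hG.measurableSet_comap _

/-- The measure of the tuples of points inducing a balanced multipartite graph. -/
noncomputable def blowupDensity (V : Type*) [Fintype V] (r p : ℕ) (G : SimpleGraph Ω)
    (ν : Measure Ω) : ℝ :=
  (Measure.pi fun _ : V => ν).real (balancedTuples V r p G)

end Density

/-! ### The density as a polynomial in two adjacent atoms -/

section PairPolynomial

variable {V Ω : Type*} [Fintype V] [DecidableEq V] [MeasurableSpace Ω] [MeasurableSingletonClass Ω]
  {r p : ℕ} {G : SimpleGraph Ω} {ρ : Measure Ω} [IsFiniteMeasure ρ] {x y : Ω}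

/-- The atoms at `x` and `y` and the remaining measure `ρ`. -/
noncomputable def pairMeasures (x y : Ω) (ρ : Measure Ω) : Fin 3 → Measure Ω :=
  ![Measure.dirac x, Measure.dirac y, ρ]

instance (j : Fin 3) : IsFiniteMeasure (pairMeasures x y ρ j) := by
  fin_cases j
  · exact inferInstanceAs (IsFiniteMeasure (Measure.dirac x))
  · exact inferInstanceAs (IsFiniteMeasure (Measure.dirac y))
  · exact inferInstanceAs (IsFiniteMeasure ρ)

/-- The measure of the balanced tuples with coordinates distributed as prescribed by `σ`. -/
noncomputable def pairWeight (r p : ℕ) (G : SimpleGraph Ω) (x y : Ω) (ρ : Measure Ω)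
    (σ : V → Fin 3) : ℝ :=
  (Measure.pi fun v => pairMeasures x y ρ (σ v)).real (balancedTuples V r p G)

/-- The number of coordinates of type `j`. -/
def typeCount (σ : V → Fin 3) (j : Fin 3) : ℕ := (Finset.univ.filter fun v => σ v = j).card

omit [DecidableEq V] in
theorem ae_pairMeasures (hx : ∀ᵐ v ∂ρ, G.Adj x v) (hy : ∀ᵐ v ∂ρ, G.Adj y v) (σ : V → Fin 3) :
    ∀ᵐ t ∂(Measure.pi fun v => pairMeasures x y ρ (σ v)), ∀ v,
      (σ v = 0 → t v = x) ∧ (σ v = 1 → t v = y) ∧ (σ v = 2 → G.Adj x (t v) ∧ G.Adj y (t v)) := by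
  refine ae_pi_forall (P := fun v z => (σ v = 0 → z = x) ∧ (σ v = 1 → z = y) ∧
    (σ v = 2 → G.Adj x z ∧ G.Adj y z)) fun v => ?_
  generalize σ v = j
  fin_cases j
  · show ∀ᵐ z ∂Measure.dirac x, _
    rw [ae_dirac_eq]
    simp
  · show ∀ᵐ z ∂Measure.dirac y, _
    rw [ae_dirac_eq]
    simp
  · show ∀ᵐ z ∂ρ, _
    filter_upwards [hx, hy] with z h1 h2
    simp [h1, h2]

-- A non-zero weight supplies an actual balanced tuple outside any prescribed null set, to which the
-- combinatorics of clones applies.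
omit [DecidableEq V] in
theorem exists_of_pairWeight_ne_zero (hx : ∀ᵐ v ∂ρ, G.Adj x v) (hy : ∀ᵐ v ∂ρ, G.Adj y v)
    {σ : V → Fin 3} (h : pairWeight r p G x y ρ σ ≠ 0) {P : (V → Ω) → Prop}
    (hP : ∀ᵐ t ∂(Measure.pi fun v => pairMeasures x y ρ (σ v)), P t) :
    ∃ t : V → Ω, IsBalanced r p (G.comap t) ∧ P t ∧ ∀ v,
      (σ v = 0 → t v = x) ∧ (σ v = 1 → t v = y) ∧ (σ v = 2 → G.Adj x (t v) ∧ G.Adj y (t v)) := by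
  by_contra hne
  refine h ?_
  rw [pairWeight, measureReal_eq_zero_iff, ← compl_compl (balancedTuples V r p G)]
  change ∀ᵐ t ∂_, t ∈ (balancedTuples V r p G)ᶜ
  filter_upwards [ae_pairMeasures hx hy σ, hP] with t h1 h2 h3
  exact hne ⟨t, h3, h2, h1⟩

theorem typeCount_zero_of_pairWeight_ne_zero (hxy : G.Adj x y) (hx : ∀ᵐ v ∂ρ, G.Adj x v)
    (hy : ∀ᵐ v ∂ρ, G.Adj y v) {σ : V → Fin 3} (h : pairWeight r p G x y ρ σ ≠ 0) :
    typeCount σ 0 = 0 ∨ typeCount σ 0 = p ∨ typeCount σ 0 = p + 1 := by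
  obtain ⟨t, ht, -, h1⟩ := exists_of_pairWeight_ne_zero hx hy h (P := fun _ => True) (by simp)
  refine ht.card_clone (x := x) _ (fun v hv => (h1 v).1 (Finset.mem_filter.1 hv).2) fun v hv => ?_
  have hv' : σ v ≠ 0 := fun h => hv (Finset.mem_filter.2 ⟨Finset.mem_univ _, h⟩)
  have : σ v = 1 ∨ σ v = 2 := by
    generalize σ v = j at hv' ⊢
    fin_cases j <;> simp_all
  rcases this with h | h
  · rw [(h1 v).2.1 h]; exact hxy
  · exact ((h1 v).2.2 h).1

theorem typeCount_one_of_pairWeight_ne_zero (hxy : G.Adj x y) (hx : ∀ᵐ v ∂ρ, G.Adj x v)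
    (hy : ∀ᵐ v ∂ρ, G.Adj y v) {σ : V → Fin 3} (h : pairWeight r p G x y ρ σ ≠ 0) :
    typeCount σ 1 = 0 ∨ typeCount σ 1 = p ∨ typeCount σ 1 = p + 1 := by
  obtain ⟨t, ht, -, h1⟩ := exists_of_pairWeight_ne_zero hx hy h (P := fun _ => True) (by simp)
  refine ht.card_clone (x := y) _ (fun v hv => (h1 v).2.1 (Finset.mem_filter.1 hv).2) fun v hv => ?_
  have hv' : σ v ≠ 1 := fun h => hv (Finset.mem_filter.2 ⟨Finset.mem_univ _, h⟩)
  have : σ v = 0 ∨ σ v = 2 := by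
    generalize σ v = j at hv' ⊢
    fin_cases j <;> simp_all
  rcases this with h | h
  · rw [(h1 v).1 h]; exact hxy.symm
  · exact ((h1 v).2.2 h).2

omit [DecidableEq V] in
/-- Exchanging the roles of the two atoms does not change the weight. -/
theorem pairWeight_swap (hG : MeasurableAdj G) (hxy : G.Adj x y) (hx : ∀ᵐ v ∂ρ, G.Adj x v)
    (hy : ∀ᵐ v ∂ρ, G.Adj y v) (σ : V → Fin 3) :
    pairWeight r p G x y ρ (fun v => Equiv.swap 0 1 (σ v)) = pairWeight r p G x y ρ σ := by
  classical
  have hsw : Measurable (Equiv.swap x y) := by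
    have : (Equiv.swap x y : Ω → Ω) = fun z => if z = x then y else if z = y then x else z := by
      ext z; rw [Equiv.swap_apply_def]
    rw [this]
    exact Measurable.ite (measurableSet_singleton x) measurable_const
      (Measurable.ite (measurableSet_singleton y) measurable_const measurable_id)
  -- `ρ` lives on common neighbours of `x` and `y`, which the transposition fixes.
  have hρ : ρ.map (Equiv.swap x y) = ρ := by
    conv_rhs => rw [← Measure.map_id (μ := ρ)]
    refine Measure.map_congr ?_
    filter_upwards [hx, hy] with z h1 h2
    exact Equiv.swap_apply_of_ne_of_ne h1.ne' h2.ne'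
  have hb : ∀ j, (pairMeasures x y ρ j).map (Equiv.swap x y) =
      pairMeasures x y ρ (Equiv.swap 0 1 j) := by
    intro j
    fin_cases j
    · show (Measure.dirac x).map _ = Measure.dirac y
      rw [Measure.map_dirac' hsw, Equiv.swap_apply_left]
    · show (Measure.dirac y).map _ = Measure.dirac x
      rw [Measure.map_dirac' hsw, Equiv.swap_apply_right]
    · exact hρ
  have hfin : ∀ v, IsFiniteMeasure ((pairMeasures x y ρ (σ v)).map (Equiv.swap x y)) :=
    fun v => by rw [hb]; infer_instance
  have hmap := Measure.pi_map_pi (μ := fun v => pairMeasures x y ρ (σ v))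
    (f := fun _ : V => Equiv.swap x y) (fun v => hsw.aemeasurable)
  simp only [hb] at hmap
  rw [pairWeight, ← hmap, measureReal_def, Measure.map_apply (by fun_prop)
    (hG.measurableSet_balancedTuples r p), pairWeight, measureReal_def]
  congr 1
  refine measure_congr ?_
  filter_upwards [ae_pairMeasures hx hy σ] with t ht
  have hadj : ∀ v, t v = x ∨ t v = y ∨ (G.Adj x (t v) ∧ G.Adj y (t v)) := by
    intro v
    have := ht v
    generalize σ v = j at this
    fin_cases j
    · exact Or.inl (this.1 rfl)
    · exact Or.inr (Or.inl (this.2.1 rfl))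
    · exact Or.inr (Or.inr (this.2.2 rfl))
  -- On the values that occur, exchanging `x` and `y` preserves adjacency, because both are joined
  -- to all other values and to each other.
  have hc : G.comap (fun v => Equiv.swap x y (t v)) = G.comap t := by
    ext u v
    simp only [SimpleGraph.comap_adj]
    have hsw' : ∀ z, G.Adj x z ∧ G.Adj y z → Equiv.swap x y z = z := fun z h =>
      Equiv.swap_apply_of_ne_of_ne h.1.ne' h.2.ne'
    have hx' : ∀ z, G.Adj x z ∧ G.Adj y z → G.Adj z x ∧ G.Adj z y :=
      fun z h => ⟨h.1.symm, h.2.symm⟩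
    rcases hadj u with h1 | h1 | h1 <;> rcases hadj v with h2 | h2 | h2 <;>
      simp [h1, h2, hsw', hx', hxy, hxy.symm]
  exact propext (by
    change IsBalanced r p _ ↔ IsBalanced r p _
    rw [← hc])

theorem exists_pairWeight_update_ne_zero (hG : MeasurableAdj G) (hp : 1 ≤ p)
    (hV : r < Fintype.card V) (hxy : G.Adj x y) (hx : ∀ᵐ v ∂ρ, G.Adj x v)
    (hy : ∀ᵐ v ∂ρ, G.Adj y v) {σ : V → Fin 3} (h : pairWeight r p G x y ρ σ ≠ 0) {a b : V}
    (ha : σ a = 0) (hb : σ b ≠ 0) :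
    ∃ v, v ≠ a ∧ v ≠ b ∧ pairWeight r p G x y ρ (Function.update σ v 0) ≠ 0 := by
  by_contra hne
  push Not at hne
  have hnull : ∀ᵐ t ∂(Measure.pi fun v => pairMeasures x y ρ (σ v)), ∀ v, v ≠ a → v ≠ b →
      ¬ IsBalanced r p (G.comap (Function.update t v x)) := by
    refine eventually_all.2 fun v => ?_
    by_cases hva : v = a
    · exact Eventually.of_forall fun _ h => absurd hva h
    by_cases hvb : v = b
    · exact Eventually.of_forall fun _ _ h => absurd hvb h
    have h1 := hne v hva hvb
    rw [pairWeight, measureReal_eq_zero_iff] at h1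
    have h2 := pi_map_update (fun v => pairMeasures x y ρ (σ v)) v x
    have h3 : Function.update (fun v => pairMeasures x y ρ (σ v)) v (Measure.dirac x) =
        fun u => pairMeasures x y ρ (Function.update σ v 0 u) := by
      funext u
      by_cases hu : u = v
      · subst hu; simp [pairMeasures]
      · simp [Function.update_of_ne hu]
    have hm : Measurable (fun t : V → Ω => Function.update t v x) := by
      refine measurable_pi_lambda _ fun u => ?_
      by_cases h : u = v
      · subst h; simp
      · simp only [Function.update_of_ne h]; exact measurable_pi_apply u
    have h4 : (Measure.pi fun v => pairMeasures x y ρ (σ v)).map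
        (fun t => Function.update t v x) (balancedTuples V r p G) = 0 := by
      rw [h2, h3, Measure.smul_apply, h1, smul_zero]
    rw [Measure.map_apply hm (hG.measurableSet_balancedTuples r p)] at h4
    have h5 : ∀ᵐ t ∂(Measure.pi fun v => pairMeasures x y ρ (σ v)),
        t ∉ (fun t => Function.update t v x) ⁻¹' balancedTuples V r p G :=
      measure_eq_zero_iff_ae_notMem.1 h4
    filter_upwards [h5] with t ht _ _
    exact ht
  obtain ⟨t, ht, h1, h2⟩ := exists_of_pairWeight_ne_zero hx hy h hnull
  have hta : t a = x := (h2 a).1 ha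
  obtain ⟨v, hva, hvb, hv⟩ := ht.exists_update hp hV (a := a) (b := b) (by
    rw [hta]
    have hb' : σ b = 1 ∨ σ b = 2 := by
      generalize σ b = j at hb ⊢
      fin_cases j <;> simp_all
    rcases hb' with h | h
    · rw [(h2 b).2.1 h]; exact hxy
    · exact ((h2 b).2.2 h).1)
  rw [hta] at hv
  exact h1 v hva hvb hv

omit [DecidableEq V] in
theorem typeCount_sum (σ : V → Fin 3) :
    typeCount σ 0 + typeCount σ 1 + typeCount σ 2 = Fintype.card V := by
  have := Finset.card_eq_sum_card_fiberwise (s := Finset.univ) (t := Finset.univ) (f := σ)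
    (fun _ _ => by simp)
  rw [Fin.sum_univ_three, Finset.card_univ] at this
  exact this.symm

omit [DecidableEq V] in
theorem prod_weights (σ : V → Fin 3) (w : Fin 3 → ℝ) :
    ∏ v, w (σ v) = w 0 ^ typeCount σ 0 * w 1 ^ typeCount σ 1 * w 2 ^ typeCount σ 2 := by
  rw [← Finset.prod_fiberwise (s := Finset.univ) (g := σ), Fin.prod_univ_three]
  have : ∀ j, ∏ v with σ v = j, w (σ v) = w j ^ typeCount σ j := by
    intro j
    rw [Finset.prod_congr rfl (g := fun _ => w j) (fun i hi => by rw [(Finset.mem_filter.1 hi).2]),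
      Finset.prod_const, typeCount]
  rw [this, this, this]

omit [DecidableEq V] in
theorem typeCount_swap (σ : V → Fin 3) (j : Fin 3) :
    typeCount (fun v => Equiv.swap 0 1 (σ v)) j = typeCount σ (Equiv.swap 0 1 j) := by
  rw [typeCount, typeCount]
  congr 1
  ext v
  simp [Equiv.swap_apply_eq_iff]

/-- The total weight of the assignments with `i` coordinates at `x` and `j` coordinates at `y`. -/
noncomputable def pairCoeff (V : Type*) [Fintype V] [DecidableEq V] (r p : ℕ) (G : SimpleGraph Ω)
    (x y : Ω) (ρ : Measure Ω) (i j : ℕ) : ℝ :=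
  ∑ σ : V → Fin 3 with typeCount σ 0 = i ∧ typeCount σ 1 = j, pairWeight r p G x y ρ σ

omit [DecidableEq V] [MeasurableSingletonClass Ω] [IsFiniteMeasure ρ] in
theorem pairWeight_nonneg (σ : V → Fin 3) : 0 ≤ pairWeight r p G x y ρ σ := measureReal_nonneg

omit [MeasurableSingletonClass Ω] [IsFiniteMeasure ρ] in
theorem pairCoeff_nonneg (i j : ℕ) : 0 ≤ pairCoeff V r p G x y ρ i j :=
  Finset.sum_nonneg fun _ _ => pairWeight_nonneg _

theorem pairCoeff_comm (hG : MeasurableAdj G) (hxy : G.Adj x y) (hx : ∀ᵐ v ∂ρ, G.Adj x v)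
    (hy : ∀ᵐ v ∂ρ, G.Adj y v) (i j : ℕ) :
    pairCoeff V r p G x y ρ i j = pairCoeff V r p G x y ρ j i := by
  refine Finset.sum_bij' (fun σ _ v => Equiv.swap 0 1 (σ v)) (fun σ _ v => Equiv.swap 0 1 (σ v))
    ?_ ?_ ?_ ?_ ?_
  · intro σ hσ
    simp only [Finset.mem_filter, Finset.mem_univ, true_and, typeCount_swap,
      Equiv.swap_apply_left, Equiv.swap_apply_right] at hσ ⊢
    exact hσ.symm
  · intro σ hσ
    simp only [Finset.mem_filter, Finset.mem_univ, true_and, typeCount_swap,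
      Equiv.swap_apply_left, Equiv.swap_apply_right] at hσ ⊢
    exact hσ.symm
  · intro σ _; simp
  · intro σ _; simp
  · intro σ _
    exact (pairWeight_swap hG hxy hx hy σ).symm

/-- The density of balanced graphs as a function of the masses `a`, `b` of two adjacent atoms and
of the scale `κ` of the remaining measure. -/
def pairPolynomial (s p : ℕ) (c : Fin 6 → ℝ) (a b κ : ℝ) : ℝ :=
  c 0 * κ ^ s + c 1 * κ ^ (s - p) * (a ^ p + b ^ p) +
    c 2 * κ ^ (s - (p + 1)) * (a ^ (p + 1) + b ^ (p + 1)) + c 3 * κ ^ (s - 2 * p) * (a * b) ^ p +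
    c 4 * κ ^ (s - (2 * p + 1)) * (a * b) ^ p * (a + b) +
    c 5 * κ ^ (s - (2 * p + 2)) * (a * b) ^ (p + 1)

/-- The coordinates at an atom are absent or a whole part, so their number is `0`, `p` or `p + 1`;
symmetry in `x` and `y` leaves six coefficients. The last clause expresses cloning for `p = 1`: a
balanced tuple with a single coordinate at `x` yields one with two, without touching the coordinates
at `y`. -/
theorem exists_pairPolynomial {s : ℕ} (hG : MeasurableAdj G) (hp : 1 ≤ p)
    (hs : Fintype.card V = s) (hrs : r < s) (hs2 : 2 ≤ s) (hxy : G.Adj x y)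
    (hx : ∀ᵐ v ∂ρ, G.Adj x v) (hy : ∀ᵐ v ∂ρ, G.Adj y v) :
    ∃ c : Fin 6 → ℝ, (∀ i, 0 ≤ c i) ∧
      (∀ a b κ : ℝ≥0, blowupDensity V r p G (a • Measure.dirac x + b • Measure.dirac y + κ • ρ) =
        pairPolynomial s p c a b κ) ∧
      (p = 1 → (c 4 = 0 → c 3 = 0) ∧ (c 2 = 0 → c 1 = 0)) := by
  classical
  set c := pairCoeff V r p G x y ρ with hc
  have hc0 : ∀ i j, 0 ≤ c i j := fun i j => pairCoeff_nonneg i j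
  have hcs : ∀ i j, c i j = c j i := fun i j => pairCoeff_comm hG hxy hx hy i j
  refine ⟨![c 0 0, c p 0, c (p + 1) 0, c p p, c (p + 1) p, c (p + 1) (p + 1)], fun i => ?_,
    fun a b κ => ?_, ?_⟩
  · fin_cases i <;> exact hc0 _ _
  · have e1 : (a • Measure.dirac x + b • Measure.dirac y + κ • ρ) =
        ∑ j, (![a, b, κ] : Fin 3 → ℝ≥0) j • pairMeasures x y ρ j := by
      simp [Fin.sum_univ_three, pairMeasures]
    rw [blowupDensity, e1, pi_real_sum_smul]
    let I : Finset ℕ := {0, p, p + 1}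
    have h1 : ∀ σ : V → Fin 3, (∏ v, ((![a, b, κ] : Fin 3 → ℝ≥0) (σ v) : ℝ)) *
        pairWeight r p G x y ρ σ = ∑ i ∈ I, ∑ j ∈ I,
          if typeCount σ 0 = i ∧ typeCount σ 1 = j then
            (a : ℝ) ^ i * b ^ j * κ ^ (s - (i + j)) * pairWeight r p G x y ρ σ else 0 := by
      intro σ
      by_cases h : pairWeight r p G x y ρ σ = 0
      · simp [h]
      have h0 := typeCount_zero_of_pairWeight_ne_zero hxy hx hy h
      have h1 := typeCount_one_of_pairWeight_ne_zero hxy hx hy h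
      rw [Finset.sum_eq_single (typeCount σ 0), Finset.sum_eq_single (typeCount σ 1)]
      · have h2 := typeCount_sum σ
        rw [prod_weights σ (fun j => ((![a, b, κ] : Fin 3 → ℝ≥0) j : ℝ)), if_pos ⟨rfl, rfl⟩]
        have : typeCount σ 2 = s - (typeCount σ 0 + typeCount σ 1) := by omega
        rw [this]
        simp
      · intro j _ hj
        rw [if_neg fun h => hj h.2.symm]
      · intro hj
        exact absurd (by simpa [I] using h1) hj
      · intro i _ hi
        refine Finset.sum_eq_zero fun j _ => ?_
        rw [if_neg fun h => hi h.1.symm]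
      · intro hi
        exact absurd (by simpa [I] using h0) hi
    change ∑ σ : V → Fin 3, (∏ v, ((![a, b, κ] : Fin 3 → ℝ≥0) (σ v) : ℝ)) *
        pairWeight r p G x y ρ σ = _
    rw [Finset.sum_congr rfl fun σ _ => h1 σ, Finset.sum_comm]
    have h2 : ∀ i, ∑ σ : V → Fin 3, ∑ j ∈ I, (if typeCount σ 0 = i ∧ typeCount σ 1 = j then
            (a : ℝ) ^ i * b ^ j * κ ^ (s - (i + j)) * pairWeight r p G x y ρ σ else 0) =
        ∑ j ∈ I, (a : ℝ) ^ i * b ^ j * κ ^ (s - (i + j)) * c i j := by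
      intro i
      rw [Finset.sum_comm]
      refine Finset.sum_congr rfl fun j _ => ?_
      rw [hc, pairCoeff, Finset.mul_sum, Finset.sum_filter]
    rw [Finset.sum_congr rfl fun i _ => h2 i]
    have hI : ∀ F : ℕ → ℝ, ∑ i ∈ I, F i = F 0 + F p + F (p + 1) := by
      intro F
      rw [Finset.sum_insert (by simp; omega), Finset.sum_insert (by simp), Finset.sum_singleton]
      ring
    simp only [hI]
    rw [hcs 0 p, hcs 0 (p + 1), hcs p (p + 1), show p + (p + 1) = 2 * p + 1 by ring,
      show p + 1 + p = 2 * p + 1 by ring, show p + 1 + (p + 1) = 2 * p + 2 by ring,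
      show p + p = 2 * p by ring]
    simp only [zero_add, add_zero, Nat.sub_zero, pow_zero, pairPolynomial, Matrix.cons_val_zero,
      Matrix.cons_val_one, Matrix.cons_val]
    ring
  · rintro rfl
    have key : ∀ j, j ≤ 1 → c 2 j = 0 → c 1 j = 0 := by
      intro j hj h
      have h1 : ∀ σ : V → Fin 3, typeCount σ 0 = 2 → typeCount σ 1 = j →
          pairWeight r 1 G x y ρ σ = 0 := by
        intro σ h0 h1
        exact (Finset.sum_eq_zero_iff_of_nonneg (fun σ _ => pairWeight_nonneg σ)).1 h σ
          (by simp [h0, h1])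
      refine Finset.sum_eq_zero fun σ hσ => ?_
      simp only [Finset.mem_filter, Finset.mem_univ, true_and] at hσ
      by_contra hne
      obtain ⟨a, ha⟩ := Finset.card_eq_one.1 hσ.1
      have ha' : ∀ v, σ v = 0 ↔ v = a := fun v => by
        have := Finset.ext_iff.1 ha v
        simpa using this
      have haa : σ a = 0 := (ha' a).2 rfl
      -- The protected coordinate `b` is the one at `y` if `j = 1` and arbitrary if `j = 0`; every
      -- coordinate available for overwriting then has type `2`.
      obtain ⟨b, hb, hb2⟩ : ∃ b, σ b ≠ 0 ∧ ∀ v, v ≠ a → v ≠ b → σ v = 2 := by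
        rcases Nat.le_one_iff_eq_zero_or_eq_one.1 hj with rfl | rfl
        · obtain ⟨b, hb⟩ := Fintype.exists_ne_of_one_lt_card (by omega : 1 < Fintype.card V) a
          refine ⟨b, fun h => hb ((ha' b).1 h), fun v hva _ => ?_⟩
          have h3 := hσ.2
          rw [typeCount, Finset.card_eq_zero] at h3
          have h4 : σ v ≠ 1 := fun h => by
            have := Finset.ext_iff.1 h3 v
            simp [h] at this
          have h5 : σ v ≠ 0 := fun h => hva ((ha' v).1 h)
          generalize σ v = j at h4 h5 ⊢
          fin_cases j <;> simp_all
        · obtain ⟨b, hb⟩ := Finset.card_eq_one.1 hσ.2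
          have hb' : ∀ v, σ v = 1 ↔ v = b := fun v => by
            have := Finset.ext_iff.1 hb v
            simpa using this
          refine ⟨b, by rw [(hb' b).2 rfl]; decide, fun v hva hvb => ?_⟩
          have h4 : σ v ≠ 1 := fun h => hvb ((hb' v).1 h)
          have h5 : σ v ≠ 0 := fun h => hva ((ha' v).1 h)
          generalize σ v = j at h4 h5 ⊢
          fin_cases j <;> simp_all
      obtain ⟨v, hva, hvb, hv⟩ := exists_pairWeight_update_ne_zero hG le_rfl (by omega) hxy hx hy
        hne haa hb
      have hv2 := hb2 v hva hvb
      refine hv (h1 _ ?_ ?_)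
      · have : Finset.univ.filter (fun u => Function.update σ v 0 u = 0) =
            insert v (Finset.univ.filter fun u => σ u = 0) := by
          ext u
          by_cases hu : u = v
          · subst hu; simp
          · simp [hu]
        rw [typeCount, this, Finset.card_insert_of_notMem (by simp [hv2])]
        have := hσ.1
        rw [typeCount] at this
        omega
      · have : Finset.univ.filter (fun u => Function.update σ v 0 u = 1) =
            (Finset.univ.filter fun u => σ u = 1) := by
          ext u
          by_cases hu : u = v
          · subst hu; simp [hv2]
          · simp [hu]
        rw [typeCount, this]
        exact hσ.2
    exact ⟨key 1 le_rfl, key 0 (by omega)⟩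

end PairPolynomial

end Inducibility

namespace Inducibility

open scoped NNReal ENNReal

/-! ### The chord inequality -/

section Chord

/-- The excess of the chord over the pair polynomial. -/
noncomputable def chordSlack (p : ℕ) (c : Fin 6 → ℝ) (a u : ℝ) : ℝ :=
  (c 3 + c 4 * a) * (4 * u * (a ^ 2 / 4) ^ p - a ^ 2 * u ^ p) +
    c 5 * (4 * u * (a ^ 2 / 4) ^ (p + 1) - a ^ 2 * u ^ (p + 1))

/-- For fixed `x + y` the power sum is a convex function of `xy`; the inequality is its chord
between `xy = 0` and `xy = ((x + y)/2)^2`. -/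
theorem power_chord {m : ℕ} (h1 : 1 ≤ m) (h4 : m ≤ 4) {x y : ℝ} (hx : 0 ≤ x) (hy : 0 ≤ y) :
    (x + y) ^ 2 * (x ^ m + y ^ m) ≤
      (x - y) ^ 2 * (x + y) ^ m + 4 * (x * y) * (2 * ((x + y) / 2) ^ m) := by
  have hxy : 0 ≤ x * y := mul_nonneg hx hy
  interval_cases m
  · nlinarith
  · nlinarith
  · nlinarith
  · have : (x - y) ^ 2 * (x + y) ^ 4 + 4 * (x * y) * (2 * ((x + y) / 2) ^ 4) -
        (x + y) ^ 2 * (x ^ 4 + y ^ 4) = (x + y) ^ 2 * (x * y) * (x - y) ^ 2 / 2 := by ring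
    have h2 : 0 ≤ (x + y) ^ 2 * (x * y) * (x - y) ^ 2 / 2 := by positivity
    linarith

/-- The weights `(x - y)^2` and `4xy` add up to `(x + y)^2`. Power sums are bounded by
`power_chord`, while the terms containing `xy` account exactly for `chordSlack`. -/
theorem pairPolynomial_chord {s p : ℕ} (hp1 : 1 ≤ p) (hp3 : p ≤ 3) {c : Fin 6 → ℝ}
    (hc : ∀ i, 0 ≤ c i) {x y : ℝ} (hx : 0 ≤ x) (hy : 0 ≤ y) :
    (x + y) ^ 2 * pairPolynomial s p c x y 1 + chordSlack p c (x + y) (x * y) ≤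
      (x - y) ^ 2 * pairPolynomial s p c (x + y) 0 1 +
        4 * (x * y) * pairPolynomial s p c ((x + y) / 2) ((x + y) / 2) 1 := by
  have h1 := mul_le_mul_of_nonneg_left (power_chord hp1 (by omega) hx hy) (hc 1)
  have h2 := mul_le_mul_of_nonneg_left (power_chord (m := p + 1) (by omega) (by omega) hx hy) (hc 2)
  have e1 : (x + y) / 2 * ((x + y) / 2) = (x + y) ^ 2 / 4 := by ring
  have hp0 : p ≠ 0 := by omega
  simp only [pairPolynomial, chordSlack, one_pow, mul_one, mul_zero, e1, zero_pow hp0,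
    zero_pow (Nat.succ_ne_zero p), add_zero]
  have e2 : (x - y) ^ 2 = (x + y) ^ 2 - 4 * (x * y) := by ring
  rw [e2] at h1 h2 ⊢
  linarith

theorem chord_term_pos {m : ℕ} (hm : 2 ≤ m) {a u : ℝ} (hu : 0 < u) (hua : u < a ^ 2 / 4) :
    0 < 4 * u * (a ^ 2 / 4) ^ m - a ^ 2 * u ^ m := by
  obtain ⟨k, rfl⟩ : ∃ k, m = k + 1 := ⟨m - 1, by omega⟩
  have h1 : u ^ k < (a ^ 2 / 4) ^ k := pow_lt_pow_left₀ hua hu.le (by omega)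
  have e : 4 * u * (a ^ 2 / 4) ^ (k + 1) - a ^ 2 * u ^ (k + 1) =
      a ^ 2 * u * ((a ^ 2 / 4) ^ k - u ^ k) := by ring
  rw [e]
  have : 0 < a ^ 2 := by linarith
  have h2 := sub_pos.2 h1
  positivity

theorem chord_term_nonneg {m : ℕ} (hm : 1 ≤ m) {a u : ℝ} (hu : 0 ≤ u) (hua : u ≤ a ^ 2 / 4) :
    0 ≤ 4 * u * (a ^ 2 / 4) ^ m - a ^ 2 * u ^ m := by
  obtain ⟨k, rfl⟩ : ∃ k, m = k + 1 := ⟨m - 1, by omega⟩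
  have h1 : u ^ k ≤ (a ^ 2 / 4) ^ k := pow_le_pow_left₀ hu hua _
  have e : 4 * u * (a ^ 2 / 4) ^ (k + 1) - a ^ 2 * u ^ (k + 1) =
      a ^ 2 * u * ((a ^ 2 / 4) ^ k - u ^ k) := by ring
  rw [e]
  have h2 := sub_nonneg.2 h1
  positivity

theorem chordSlack_nonneg {p : ℕ} (hp : 1 ≤ p) {c : Fin 6 → ℝ} (hc : ∀ i, 0 ≤ c i) {a u : ℝ}
    (ha : 0 ≤ a) (hu : 0 ≤ u) (hua : u ≤ a ^ 2 / 4) : 0 ≤ chordSlack p c a u :=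
  add_nonneg (mul_nonneg (add_nonneg (hc 3) (mul_nonneg (hc 4) ha)) (chord_term_nonneg hp hu hua))
    (mul_nonneg (hc 5) (chord_term_nonneg (by omega) hu hua))

end Chord

/-! ### Finite weighted graphs: reduction to cliques of equal weights -/

section WeightedDensity

variable {V M : Type*} [Fintype V] [DecidableEq V] [Fintype M]

open Classical in
/-- The density of balanced graphs in the blow-up of `G` with vertex weights `w`. -/
noncomputable def weightedDensity (V : Type*) [Fintype V] [DecidableEq V] (r p : ℕ)
    (G : SimpleGraph M) (w : M → ℝ) : ℝ :=
  ∑ σ : V → M, (∏ v, w (σ v)) * if IsBalanced r p (G.comap σ) then 1 else 0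

theorem continuous_weightedDensity (r p : ℕ) (G : SimpleGraph M) :
    Continuous (weightedDensity V r p G) := by
  classical
  unfold weightedDensity
  fun_prop

theorem blowupDensity_sum_dirac [MeasurableSpace M] [MeasurableSingletonClass M] (r p : ℕ)
    (G : SimpleGraph M) (w : M → ℝ≥0) :
    blowupDensity V r p G (∑ i, w i • Measure.dirac i) =
      weightedDensity V r p G fun i => (w i : ℝ) := by
  classical
  rw [blowupDensity, pi_real_sum_smul, weightedDensity]
  refine Finset.sum_congr rfl fun σ _ => ?_
  congr 1
  have h1 : Measure.pi (fun v => Measure.dirac (σ v)) = Measure.dirac σ := by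
    refine Measure.pi_eq fun B hB => ?_
    rw [Measure.dirac_apply' _ (MeasurableSet.univ_pi hB)]
    simp only [Measure.dirac_apply' _ (hB _)]
    by_cases h : σ ∈ Set.univ.pi B
    · rw [Set.indicator_of_mem h, Finset.prod_eq_one]
      · rfl
      · intro v _
        rw [Set.indicator_of_mem (h v (Set.mem_univ v))]
        rfl
    · rw [Set.indicator_of_notMem h]
      simp only [Set.mem_univ_pi, not_forall] at h
      obtain ⟨v, hv⟩ := h
      rw [Finset.prod_eq_zero (Finset.mem_univ v)]
      rw [Set.indicator_of_notMem hv]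
  rw [h1, measureReal_def, Measure.dirac_apply]
  by_cases h : IsBalanced r p (G.comap σ)
  · rw [if_pos h, Set.indicator_of_mem (show σ ∈ balancedTuples V r p G from h)]
    simp
  · rw [if_neg h, Set.indicator_of_notMem (show σ ∉ balancedTuples V r p G from h)]
    simp

/-- Merging two nonadjacent vertices: the density is at most a weighted average of the densities
obtained by moving all the weight to one of the two vertices. -/
theorem weightedDensity_merge [DecidableEq M] {r p : ℕ} {G : SimpleGraph M} {w : M → ℝ} (hw : ∀ i, 0 ≤ w i)
    {x z : M} (hxz : x ≠ z) (hadj : ¬ G.Adj x z) :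
    (w x + w z) * weightedDensity V r p G w ≤
      w x * weightedDensity V r p G (Function.update (Function.update w x (w x + w z)) z 0) +
      w z * weightedDensity V r p G (Function.update (Function.update w z (w x + w z)) x 0) := by
  classical
  set wx := Function.update (Function.update w x (w x + w z)) z 0 with hwx
  set wz := Function.update (Function.update w z (w x + w z)) x 0 with hwz
  let I : (V → M) → ℝ := fun σ => if IsBalanced r p (G.comap σ) then 1 else 0
  have hI0 : ∀ σ, 0 ≤ I σ := fun σ => by simp only [I]; split_ifs <;> simp
  have hwx0 : ∀ i, 0 ≤ wx i := by
    intro i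
    rw [hwx]
    by_cases h1 : i = z
    · subst h1; simp
    rw [Function.update_of_ne h1]
    by_cases h2 : i = x
    · subst h2; simp; exact add_nonneg (hw _) (hw _)
    rw [Function.update_of_ne h2]; exact hw i
  -- Tuples are grouped by their image under `c`, which sends `z` to `x`; the inequality is proved
  -- for each group.
  let c : M → M := fun m => if m = z then x else m
  let sw : M ≃ M := Equiv.swap x z
  have hwzx : ∀ i, wz (sw i) = wx i := by
    intro i
    by_cases h1 : i = z
    · subst h1; simp [sw, hwz, hwx]
    by_cases h2 : i = x
    · subst h2; simp [sw, hwz, hwx, hxz, hxz.symm]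
    · rw [show sw i = i from Equiv.swap_apply_of_ne_of_ne h2 h1]
      simp [hwz, hwx, h1, h2]
  have e1 : weightedDensity V r p G w =
      ∑ τ : V → M, ∑ σ : V → M with c ∘ σ = τ, (∏ v, w (σ v)) * I σ :=
    (Finset.sum_fiberwise _ _ _).symm
  have e2 : weightedDensity V r p G wx = ∑ τ : V → M, (∏ v, wx (τ v)) * I τ := rfl
  have e3 : weightedDensity V r p G wz = ∑ τ : V → M, (∏ v, wx (τ v)) * I (sw ∘ τ) := by
    rw [weightedDensity, ← Equiv.sum_comp (Equiv.arrowCongr (Equiv.refl V) sw)]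
    refine Finset.sum_congr rfl fun τ _ => ?_
    congr 1
    exact Finset.prod_congr rfl fun v _ => hwzx _
  rw [e1, e2, e3, Finset.mul_sum, Finset.mul_sum, Finset.mul_sum, ← Finset.sum_add_distrib]
  refine Finset.sum_le_sum fun τ _ => ?_
  by_cases hτz : ∃ v, τ v = z
  · obtain ⟨v, hv⟩ := hτz
    rw [Finset.sum_eq_zero]
    · rw [mul_zero]
      have := Finset.prod_nonneg fun v (_ : v ∈ Finset.univ) => hwx0 (τ v)
      have h1 := hI0 τ
      have h2 := hI0 (sw ∘ τ)
      have h3 := hw x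
      have h4 := hw z
      positivity
    · intro σ hσ
      have := congrFun (Finset.mem_filter.1 hσ).2 v
      simp only [Function.comp_apply, hv, c] at this
      split_ifs at this with h
      · exact absurd this hxz
      · exact absurd this h
  push Not at hτz
  by_cases hτx : ∃ v, τ v = x
  · obtain ⟨t₀, ht₀⟩ := hτx
    have hfib : ∀ σ : V → M, c ∘ σ = τ → ∀ v, (τ v = x ∧ (σ v = x ∨ σ v = z)) ∨
        (τ v ≠ x ∧ σ v = τ v) := by
      intro σ hσ v
      have := congrFun hσ v
      simp only [Function.comp_apply, c] at this
      split_ifs at this with h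
      · exact Or.inl ⟨this.symm, Or.inr h⟩
      · by_cases h2 : τ v = x
        · exact Or.inl ⟨h2, Or.inl (this.trans h2)⟩
        · exact Or.inr ⟨h2, this⟩
    -- A balanced tuple stays balanced when all coordinates at `x` or `z` are moved to the value at
    -- `t₀`, since `x` and `z` are non-adjacent.
    have hle : ∀ σ : V → M, c ∘ σ = τ →
        I σ ≤ (if σ t₀ = x then I τ else 0) + (if σ t₀ = z then I (sw ∘ τ) else 0) := by
      intro σ hσ
      by_cases hb : IsBalanced r p (G.comap σ)
      · rcases hfib σ hσ t₀ with ⟨_, h | h⟩ | ⟨h, _⟩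
        · have : τ = σ ∘ fun v => if σ v = z then t₀ else v := by
            funext v
            simp only [Function.comp_apply]
            split_ifs with h1
            · rcases hfib σ hσ v with ⟨h2, _⟩ | ⟨h2, h3⟩
              · rw [h2, h]
              · exact absurd (h3.symm.trans h1) (hτz v)
            · rcases hfib σ hσ v with ⟨h2, h3⟩ | ⟨h2, h3⟩
              · rw [h2, h3.resolve_right h1]
              · exact h3.symm
          have hb' : IsBalanced r p (G.comap τ) := by
            rw [this]
            refine hb.comp_of_not_adj _ fun v => ?_
            split_ifs with h1
            · rw [h, h1]; exact hadj
            · exact G.loopless.irrefl _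
          rw [if_pos h, if_neg (by rw [h]; exact hxz)]
          simp [I, hb, hb']
        · have : sw ∘ τ = σ ∘ fun v => if σ v = x then t₀ else v := by
            funext v
            simp only [Function.comp_apply]
            split_ifs with h1
            · rcases hfib σ hσ v with ⟨h2, _⟩ | ⟨h2, h3⟩
              · rw [h2, h]; simp [sw]
              · exact absurd (h3.symm.trans h1) h2
            · rcases hfib σ hσ v with ⟨h2, h3⟩ | ⟨h2, h3⟩
              · rw [h2, h3.resolve_left h1]; simp [sw]
              · rw [h3]; exact Equiv.swap_apply_of_ne_of_ne h2 (hτz v)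
          have hb' : IsBalanced r p (G.comap (sw ∘ τ)) := by
            rw [this]
            refine hb.comp_of_not_adj _ fun v => ?_
            split_ifs with h1
            · rw [h, h1]; exact fun h => hadj h.symm
            · exact G.loopless.irrefl _
          rw [if_neg (by rw [h]; exact hxz.symm), if_pos h]
          simp [I, hb, hb']
        · exact absurd ht₀ h
      · have : I σ = 0 := by simp [I, hb]
        rw [this]
        refine add_nonneg ?_ ?_ <;> split_ifs <;> first | exact hI0 _ | exact le_rfl
    -- Once `σ t₀ = y` is fixed, the other coordinates over `x` vary freely in `{x, z}`, each
    -- contributing `w x + w z`. So `t₀` selects `x` or `z` in proportion to its weight.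
    have hsum : ∀ y, y = x ∨ y = z →
        (w x + w z) * ∑ σ : V → M with c ∘ σ = τ ∧ σ t₀ = y, ∏ v, w (σ v) =
          w y * ∏ v, wx (τ v) := by
      intro y hy
      have hset : (Finset.univ.filter fun σ : V → M => c ∘ σ = τ ∧ σ t₀ = y) =
          Fintype.piFinset fun v => if v = t₀ then {y} else if τ v = x then {x, z} else {τ v} := by
        ext σ
        simp only [Finset.mem_filter, Finset.mem_univ, true_and, Fintype.mem_piFinset]
        constructor
        · rintro ⟨h1, h2⟩ v
          split_ifs with h3 h4
          · subst h3; simpa using h2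
          · rcases hfib σ h1 v with ⟨_, h5⟩ | ⟨h5, _⟩
            · simpa using h5
            · exact absurd h4 h5
          · rcases hfib σ h1 v with ⟨h5, _⟩ | ⟨_, h5⟩
            · exact absurd h5 h4
            · simpa using h5
        · intro h
          have h1 : σ t₀ = y := by simpa using h t₀
          refine ⟨funext fun v => ?_, h1⟩
          have h2 := h v
          simp only [Function.comp_apply, c]
          split_ifs at h2 with h3 h4
          · subst h3
            rw [Finset.mem_singleton] at h2
            rw [h2, ht₀]
            rcases hy with rfl | rfl <;> simp
          · rw [h4]
            simp only [Finset.mem_insert, Finset.mem_singleton] at h2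
            rcases h2 with h2 | h2 <;> simp [h2]
          · rw [Finset.mem_singleton] at h2
            rw [h2, if_neg (hτz v)]
      rw [hset, ← Finset.prod_univ_sum, ← Finset.mul_prod_erase _ _ (Finset.mem_univ t₀),
        ← Finset.mul_prod_erase _ (fun v => wx (τ v)) (Finset.mem_univ t₀)]
      have h1 : wx (τ t₀) = w x + w z := by
        rw [ht₀, hwx, Function.update_of_ne hxz, Function.update_self]
      rw [h1, if_pos rfl, Finset.sum_singleton]
      have h2 : ∏ v ∈ Finset.univ.erase t₀, ∑ j ∈ (if v = t₀ then {y} else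
          if τ v = x then {x, z} else {τ v}), w j = ∏ v ∈ Finset.univ.erase t₀, wx (τ v) := by
        refine Finset.prod_congr rfl fun v hv => ?_
        rw [if_neg (Finset.ne_of_mem_erase hv)]
        split_ifs with h3
        · rw [Finset.sum_pair hxz, h3, hwx, Function.update_of_ne hxz, Function.update_self]
        · rw [Finset.sum_singleton, hwx, Function.update_of_ne (hτz v), Function.update_of_ne h3]
      rw [h2]
      ring
    calc (w x + w z) * ∑ σ : V → M with c ∘ σ = τ, (∏ v, w (σ v)) * I σ
        ≤ (w x + w z) * ∑ σ : V → M with c ∘ σ = τ, (∏ v, w (σ v)) *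
          ((if σ t₀ = x then I τ else 0) + (if σ t₀ = z then I (sw ∘ τ) else 0)) := by
          refine mul_le_mul_of_nonneg_left (Finset.sum_le_sum fun σ hσ => ?_)
            (add_nonneg (hw _) (hw _))
          exact mul_le_mul_of_nonneg_left (hle σ (Finset.mem_filter.1 hσ).2)
            (Finset.prod_nonneg fun v _ => hw _)
      _ = (w x + w z) * (∑ σ : V → M with c ∘ σ = τ ∧ σ t₀ = x, ∏ v, w (σ v)) * I τ +
          (w x + w z) * (∑ σ : V → M with c ∘ σ = τ ∧ σ t₀ = z, ∏ v, w (σ v)) * I (sw ∘ τ) := by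
          simp only [mul_add, Finset.sum_add_distrib, mul_ite, mul_zero]
          rw [← Finset.sum_filter, ← Finset.sum_filter, Finset.filter_filter,
            Finset.filter_filter, ← Finset.sum_mul, ← Finset.sum_mul]
          ring
      _ = _ := by
          rw [hsum x (Or.inl rfl), hsum z (Or.inr rfl)]
          ring
  · push Not at hτx
    have hfil : (Finset.univ.filter fun σ : V → M => c ∘ σ = τ) = {τ} := by
      ext σ
      simp only [Finset.mem_filter, Finset.mem_univ, true_and, Finset.mem_singleton]
      constructor
      · intro h
        funext v
        have := congrFun h v
        simp only [Function.comp_apply, c] at this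
        split_ifs at this with h1
        · exact absurd this.symm (hτx v)
        · exact this
      · rintro rfl
        funext v
        simp [c, hτz v]
    have hsw : sw ∘ τ = τ := by
      funext v
      exact Equiv.swap_apply_of_ne_of_ne (hτx v) (hτz v)
    rw [hfil, Finset.sum_singleton, hsw]
    have : ∏ v, wx (τ v) = ∏ v, w (τ v) := Finset.prod_congr rfl fun v _ => by
      rw [hwx, Function.update_of_ne (hτz v), Function.update_of_ne (hτx v)]
    rw [this]
    exact le_of_eq (by ring)

/-- The remaining vertices become a discrete measure `ρ`. Vertices of weight zero are null for it,
so adjacency to `x` and `y` is required only on the support. -/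
theorem exists_pairPolynomial_weightedDensity [DecidableEq M] {s r p : ℕ} {G : SimpleGraph M}
    (hp : 1 ≤ p) (hs : Fintype.card V = s) (hrs : r < s) (hs2 : 2 ≤ s) {w : M → ℝ}
    (hw : ∀ i, 0 ≤ w i) {x y : M} (hxy : G.Adj x y)
    (hx : ∀ v, w v ≠ 0 → v ≠ x → v ≠ y → G.Adj x v) (hy : ∀ v, w v ≠ 0 → v ≠ x → v ≠ y → G.Adj y v) :
    ∃ c : Fin 6 → ℝ, (∀ i, 0 ≤ c i) ∧ ∀ a b : ℝ, 0 ≤ a → 0 ≤ b →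
      weightedDensity V r p G (Function.update (Function.update w x a) y b) =
        pairPolynomial s p c a b 1 := by
  let _ : MeasurableSpace M := ⊤
  have _ : MeasurableSingletonClass M := ⟨fun _ => trivial⟩
  let u : M → ℝ≥0 := fun i => if i = x ∨ i = y then 0 else (w i).toNNReal
  set ρ : Measure M := ∑ i, u i • Measure.dirac i with hρ
  have hρx : ∀ P : M → Prop, (∀ v, w v ≠ 0 → v ≠ x → v ≠ y → P v) → ∀ᵐ v ∂ρ, P v := by
    intro P hP
    rw [ae_iff, hρ, Measure.finsetSum_apply]
    refine Finset.sum_eq_zero fun i _ => ?_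
    rw [Measure.smul_apply]
    by_cases h : i = x ∨ i = y
    · simp [u, h]
    · by_cases h0 : w i = 0
      · simp [u, h0]
      · push Not at h
        rw [Measure.dirac_apply, Set.indicator_of_notMem, smul_zero]
        simpa using hP i h0 h.1 h.2
  have hG : MeasurableAdj G := (Set.toFinite _).measurableSet
  obtain ⟨c, hc, h1, -⟩ := exists_pairPolynomial (V := V) (r := r) (ρ := ρ) hG hp hs hrs hs2 hxy
    (hρx _ hx) (hρx _ hy)
  refine ⟨c, hc, fun a b ha hb => ?_⟩
  have h2 := h1 a.toNNReal b.toNNReal 1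
  rw [Real.coe_toNNReal a ha, Real.coe_toNNReal b hb, NNReal.coe_one] at h2
  rw [← h2, one_smul]
  have e : a.toNNReal • Measure.dirac x + b.toNNReal • Measure.dirac y + ρ =
      ∑ i, (Function.update (Function.update u x a.toNNReal) y b.toNNReal) i •
        Measure.dirac i := by
    rw [hρ, ← Finset.sum_erase_add _ _ (Finset.mem_univ y),
      ← Finset.sum_erase_add _ _ (Finset.mem_erase.2 ⟨hxy.ne, Finset.mem_univ x⟩),
      ← Finset.sum_erase_add _ _ (Finset.mem_univ y),
      ← Finset.sum_erase_add _ _ (Finset.mem_erase.2 ⟨hxy.ne, Finset.mem_univ x⟩)]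
    have : ∀ i ∈ (Finset.univ.erase y).erase x,
        (Function.update (Function.update u x a.toNNReal) y b.toNNReal) i • Measure.dirac i =
        u i • Measure.dirac i := by
      intro i hi
      rw [Function.update_of_ne (by simp at hi; exact hi.2),
        Function.update_of_ne (by simp at hi; exact hi.1)]
    rw [Finset.sum_congr rfl this]
    simp only [Function.update_self, Function.update_of_ne hxy.ne]
    have hux : u x = 0 := by simp [u]
    have huy : u y = 0 := by simp [u]
    rw [hux, huy, zero_smul, zero_smul, add_zero, add_zero]
    abel
  rw [e, blowupDensity_sum_dirac]
  congr 1
  funext i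
  by_cases hiy : i = y
  · subst hiy; simp [hb]
  by_cases hix : i = x
  · subst hix; simp [ha, hiy]
  simp [hiy, hix, u, hw i]

theorem weightedDensity_of_equal_weights {s r p : ℕ} {G : SimpleGraph M} {w : M → ℝ}
    (T : Finset M) (hT : ∀ v ∈ T, w v = 1 / T.card) (hT' : ∀ v, v ∉ T → w v = 0)
    (hadj : ∀ v ∈ T, ∀ u ∈ T, v ≠ u → G.Adj v u) :
    weightedDensity (Fin s) r p G w = equipartiteDensity s r p T.card := by
  classical
  let e : Fin T.card ↪ M := T.equivFin.symm.toEmbedding.trans (Function.Embedding.subtype _)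
  have he : ∀ i, e i ∈ T := fun i => (T.equivFin.symm i).2
  have he' : ∀ v ∈ T, ∃ i, e i = v := fun v hv =>
    ⟨T.equivFin ⟨v, hv⟩, by simp [e]⟩
  have hcomap : ∀ τ : Fin s → Fin T.card,
      G.comap (e ∘ τ) = (⊤ : SimpleGraph (Fin T.card)).comap τ := by
    intro τ
    ext u v
    simp only [SimpleGraph.comap_adj, SimpleGraph.top_adj, Function.comp_apply]
    constructor
    · exact fun h h' => h.ne (by rw [h'])
    · exact fun h => hadj _ (he _) _ (he _) (e.injective.ne h)
  rw [weightedDensity, ← Finset.sum_of_injOn (s := (Finset.univ : Finset (Fin s → Fin T.card)))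
    (f := fun τ => (1 / (T.card : ℝ)) ^ s *
      if IsBalanced r p ((⊤ : SimpleGraph (Fin T.card)).comap τ) then 1 else 0)
    (fun τ => e ∘ τ)]
  · rw [← Finset.mul_sum, Finset.sum_boole, equipartiteDensity, balancedMaps,
      Nat.card_eq_fintype_card, Fintype.card_subtype, one_div, inv_pow]
    field_simp
  · intro τ _ τ' _ h
    funext v
    exact e.injective (congrFun h v)
  · simp [Set.MapsTo]
  · intro σ _ hσ
    have : ∃ v, σ v ∉ T := by
      by_contra h
      push Not at h
      choose τ hτ using fun v => he' _ (h v)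
      exact hσ ⟨τ, by simp, funext hτ⟩
    obtain ⟨v, hv⟩ := this
    rw [Finset.prod_eq_zero (Finset.mem_univ v) (hT' _ hv), zero_mul]
  · intro τ _
    rw [hcomap]
    congr 1
    rw [Finset.prod_congr rfl fun v _ => show w ((e ∘ τ) v) = _ from hT _ (he _)]
    simp

/-- The density of balanced graphs in a weighted graph is at most the density in an equipartite
blow-up of one of its cliques. -/
theorem exists_weightedDensity_le {s r p : ℕ} (hp : 1 ≤ p) (hp3 : p ≤ 3) (hrs : r < s)
    (hs2 : 2 ≤ s) (G : SimpleGraph M) {w : M → ℝ} (hw : w ∈ stdSimplex ℝ M) :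
    ∃ n, 1 ≤ n ∧ ¬ G.CliqueFree n ∧
      weightedDensity (Fin s) r p G w ≤ equipartiteDensity s r p n := by
  classical
  set L := weightedDensity (Fin s) r p G with hL
  obtain ⟨w₁, hw₁, hmax⟩ := (isCompact_stdSimplex ℝ M).exists_isMaxOn ⟨w, hw⟩
    (continuous_weightedDensity (V := Fin s) r p G).continuousOn
  -- Among all maximisers, one with the smallest support is chosen.
  let S := {u : M → ℝ | u ∈ stdSimplex ℝ M ∧ L u = L w₁}
  let supp : (M → ℝ) → Finset M := fun u => Finset.univ.filter fun i => u i ≠ 0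
  obtain ⟨u, ⟨hu, huL⟩, hmin⟩ := WellFounded.has_min
    (measure fun u : M → ℝ => (supp u).card).wf S ⟨w₁, hw₁, rfl⟩
  have hmaxu : ∀ v ∈ stdSimplex ℝ M, L v ≤ L u := fun v hv => by rw [huL]; exact hmax hv
  have hmin' : ∀ v ∈ stdSimplex ℝ M, L v = L u → (supp u).card ≤ (supp v).card := by
    intro v hv h
    by_contra hlt
    exact hmin v ⟨hv, h.trans huL⟩ (not_le.1 hlt)
  have hu0 : ∀ i, 0 ≤ u i := hu.1
  have hmove : ∀ (x y : M) (a b : ℝ), x ≠ y → 0 ≤ a → 0 ≤ b → a + b = u x + u y →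
      Function.update (Function.update u x a) y b ∈ stdSimplex ℝ M := by
    intro x y a b hxy ha hb hab
    refine ⟨fun i => ?_, ?_⟩
    · by_cases hiy : i = y
      · subst hiy; simpa using hb
      by_cases hix : i = x
      · subst hix; simpa [hiy] using ha
      simpa [hiy, hix] using hu0 i
    · rw [← hu.2, ← Finset.sum_erase_add _ _ (Finset.mem_univ y),
        ← Finset.sum_erase_add _ _ (Finset.mem_erase.2 ⟨hxy, Finset.mem_univ x⟩),
        ← Finset.sum_erase_add (a := y) _ u (Finset.mem_univ y),
        ← Finset.sum_erase_add _ u (Finset.mem_erase.2 ⟨hxy, Finset.mem_univ x⟩)]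
      have : ∀ i ∈ (Finset.univ.erase y).erase x,
          (Function.update (Function.update u x a) y b) i = u i := by
        intro i hi
        rw [Function.update_of_ne (by simp at hi; exact hi.2),
          Function.update_of_ne (by simp at hi; exact hi.1)]
      rw [Finset.sum_congr rfl this]
      simp only [Function.update_self, Function.update_of_ne hxy]
      linarith
  -- Emptying a vertex of the support cannot preserve the maximum, because it would give a maximiser
  -- with smaller support.
  have hsmall : ∀ x y : M, x ≠ y → u x ≠ 0 → u y ≠ 0 →
      L (Function.update (Function.update u x (u x + u y)) y 0) < L u := by
    intro x y hxy hx hy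
    refine lt_of_le_of_ne (hmaxu _ (hmove x y _ _ hxy (add_nonneg (hu0 _) (hu0 _)) le_rfl
      (add_zero _))) fun h => ?_
    have h1 := hmin' _ (hmove x y _ _ hxy (add_nonneg (hu0 _) (hu0 _)) le_rfl (add_zero _)) h
    refine absurd h1 (not_le.2 (Finset.card_lt_card ⟨fun i hi => ?_, fun hsub => ?_⟩))
    · simp only [supp, Finset.mem_filter, Finset.mem_univ, true_and] at hi ⊢
      by_cases hiy : i = y
      · subst hiy; exact hy
      by_cases hix : i = x
      · subst hix; exact hx
      simpa [hiy, hix] using hi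
    · have := hsub (show y ∈ supp u by simp [supp, hy])
      simp [supp] at this
  -- Both merged densities are strictly below the maximum, so their weighted average cannot dominate
  -- it.
  have hclique : ∀ x ∈ supp u, ∀ y ∈ supp u, x ≠ y → G.Adj x y := by
    intro x hx y hy hxy
    by_contra hadj
    have hx' : u x ≠ 0 := (Finset.mem_filter.1 hx).2
    have hy' : u y ≠ 0 := (Finset.mem_filter.1 hy).2
    have h1 := weightedDensity_merge (V := Fin s) (r := r) (p := p) hu0 hxy hadj
    have h2 := hsmall x y hxy hx' hy'
    have h3 := hsmall y x hxy.symm hy' hx'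
    have hxp := lt_of_le_of_ne (hu0 x) hx'.symm
    have hyp := lt_of_le_of_ne (hu0 y) hy'.symm
    rw [add_comm (u y)] at h3
    have h4 := mul_lt_mul_of_pos_left h2 hxp
    have h5 := mul_lt_mul_of_pos_left h3 hyp
    rw [← hL] at h1
    linarith
  have hequal : ∀ x ∈ supp u, ∀ y ∈ supp u, u x = u y := by
    intro x hx y hy
    by_contra hne
    have hxy : x ≠ y := fun h => hne (by rw [h])
    have hx' : u x ≠ 0 := (Finset.mem_filter.1 hx).2
    have hy' : u y ≠ 0 := (Finset.mem_filter.1 hy).2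
    have hxp := lt_of_le_of_ne (hu0 x) hx'.symm
    have hyp := lt_of_le_of_ne (hu0 y) hy'.symm
    obtain ⟨c, hc, hpoly⟩ := exists_pairPolynomial_weightedDensity (V := Fin s) (r := r) (s := s) hp
      (by simp) hrs hs2 hu0 (hclique x hx y hy hxy)
      (fun v hv hvx _ => hclique x hx v (by simpa [supp] using hv) hvx.symm)
      (fun v hv _ hvy => hclique y hy v (by simpa [supp] using hv) hvy.symm)
    -- The merged end of the chord is strictly below the maximum and has positive weight `(u x - u
    -- y)^2`; the equal end is at most the maximum. The value between them is then too small.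
    have h1 := pairPolynomial_chord (s := s) hp hp3 hc (hu0 x) (hu0 y)
    have h2 : pairPolynomial s p c (u x) (u y) 1 = L u := by
      rw [← hpoly _ _ (hu0 x) (hu0 y)]
      simp [hL]
    have h3 : pairPolynomial s p c (u x + u y) 0 1 < L u := by
      rw [← hpoly _ _ (by linarith) le_rfl]
      exact hsmall x y hxy hx' hy'
    have h4 : pairPolynomial s p c ((u x + u y) / 2) ((u x + u y) / 2) 1 ≤ L u := by
      rw [← hpoly _ _ (by linarith) (by linarith)]
      exact hmaxu _ (hmove x y _ _ hxy (by linarith) (by linarith) (by ring))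
    have h5 : 0 ≤ chordSlack p c (u x + u y) (u x * u y) :=
      chordSlack_nonneg hp hc (by linarith) (by positivity) (by nlinarith [sq_nonneg (u x - u y)])
    have h6 : 0 < (u x - u y) ^ 2 := by
      have := sub_ne_zero.2 hne
      positivity
    have h7 := mul_lt_mul_of_pos_left h3 h6
    have h8 := mul_le_mul_of_nonneg_left h4 (show 0 ≤ 4 * (u x * u y) by positivity)
    rw [h2] at h1
    nlinarith
  have hne : (supp u).Nonempty := by
    by_contra h
    rw [Finset.not_nonempty_iff_eq_empty] at h
    have h1 := hu.2
    rw [Finset.sum_eq_zero] at h1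
    · norm_num at h1
    · intro i _
      by_contra hi
      have : i ∈ supp u := by simp [supp, hi]
      rw [h] at this
      simp at this
  have hsum : ∑ i ∈ supp u, u i = 1 := by
    rw [← hu.2]
    refine Finset.sum_subset (Finset.subset_univ _) fun i _ hi => ?_
    simpa [supp] using hi
  have hw : ∀ v ∈ supp u, u v = 1 / (supp u).card := by
    intro v hv
    rw [Finset.sum_congr rfl fun i hi => hequal i hi v hv, Finset.sum_const, nsmul_eq_mul] at hsum
    rw [eq_div_iff (by simpa using hne.ne_empty), mul_comm]
    exact hsum
  refine ⟨(supp u).card, hne.card_pos, fun hfree => ?_, ?_⟩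
  · exact hfree (supp u) ⟨fun a ha b hb hab => hclique a ha b hb hab, rfl⟩
  · rw [← weightedDensity_of_equal_weights (supp u) hw
      (fun v hv => by simpa [supp] using hv) hclique, ← hL]
    exact hmaxu w ‹_›

end WeightedDensity

end Inducibility

namespace Inducibility

open scoped NNReal ENNReal Nat

/-! ### Random samples: from finite graphs to measures -/

section Sampling

variable {Ω : Type*} [MeasurableSpace Ω]

theorem measurePreserving_comp_of_injective {I J : Type*} [Fintype I] [Fintype J] (ν : Measure Ω)
    [IsProbabilityMeasure ν] {ι : J → I} (hι : Function.Injective ι) :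
    MeasurePreserving (fun t : I → Ω => t ∘ ι) (Measure.pi fun _ => ν) (Measure.pi fun _ => ν) := by
  classical
  have hm : Measurable (fun t : I → Ω => t ∘ ι) :=
    measurable_pi_lambda _ fun j => measurable_pi_apply (ι j)
  refine ⟨hm, (Measure.pi_eq fun B hB => ?_).symm⟩
  rw [Measure.map_apply hm (MeasurableSet.univ_pi hB)]
  have : (fun t : I → Ω => t ∘ ι) ⁻¹' Set.univ.pi B =
      Set.univ.pi (Function.extend ι B fun _ => Set.univ) := by
    ext t
    simp only [Set.mem_preimage, Set.mem_univ_pi, Function.comp_apply]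
    constructor
    · intro h i
      by_cases hi : ∃ j, ι j = i
      · obtain ⟨j, rfl⟩ := hi
        rw [hι.extend_apply]
        exact h j
      · rw [Function.extend_apply' _ _ _ hi]
        trivial
    · intro h j
      have := h (ι j)
      rwa [hι.extend_apply] at this
  rw [this, Measure.pi_pi]
  symm
  refine Finset.prod_of_injOn ι hι.injOn (by simp [Set.MapsTo]) ?_ ?_
  · intro i _ hi
    rw [Function.extend_apply' _ _ _ (by simpa using hi)]
    exact measure_univ
  · intro j _
    rw [hι.extend_apply]

/-- The measure `ν` sees no `j`-cliques of `G`. -/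
def AECliqueFree (G : SimpleGraph Ω) (ν : Measure Ω) (j : ℕ) : Prop :=
  ∀ᵐ t ∂(Measure.pi fun _ : Fin j => ν), G.comap t ≠ ⊤

theorem AECliqueFree.ae_cliqueFree {G : SimpleGraph Ω} {ν : Measure Ω} [IsProbabilityMeasure ν]
    {j : ℕ} (h : AECliqueFree G ν j) (I : Type*) [Fintype I] :
    ∀ᵐ t ∂(Measure.pi fun _ : I => ν), (G.comap t).CliqueFree j := by
  have h1 : ∀ᵐ t ∂(Measure.pi fun _ : I => ν), ∀ e : Fin j ↪ I, G.comap (t ∘ e) ≠ ⊤ := by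
    rw [ae_all_iff]
    intro e
    exact (measurePreserving_comp_of_injective ν e.injective).quasiMeasurePreserving.ae h
  filter_upwards [h1] with t ht
  by_contra hne
  rw [SimpleGraph.not_cliqueFree_iff_top_isContained] at hne
  obtain ⟨f⟩ := hne
  refine ht ⟨f, f.injective⟩ ?_
  ext u v
  constructor
  · exact fun h h' => h.ne (by rw [h'])
  · exact fun h => f.toHom.map_adj h

variable {s r p q : ℕ}

-- Increasing enumeration pairs each `s`-subset with exactly one order embedding.
open Classical in
theorem inducedCopies_eq_sum (hpq : s = p * r + q) (hq : q < r) {n : ℕ} (G : SimpleGraph (Fin n)) :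
    inducedCopies (SimpleGraph.turanGraph s r) G =
      ∑ e : Fin s ↪o Fin n, if IsBalanced r p (G.comap e) then 1 else 0 := by
  rw [inducedCopies, Finset.sum_boole, Nat.cast_id, ← Fintype.card_subtype,
    ← Nat.card_eq_fintype_card]
  have hiso : ∀ S : Finset (Fin n), ∀ h : S.card = s,
      Nonempty (G.induce (S : Set (Fin n)) ≃g SimpleGraph.turanGraph s r) ↔
        IsBalanced r p (G.comap (S.orderEmbOfFin h)) := by
    intro S h
    rw [← nonempty_iso_turanGraph_iff hpq hq (by simp)]
    let e : G.comap (S.orderEmbOfFin h) ≃g G.induce (S : Set (Fin n)) :=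
      ⟨(S.orderIsoOfFin h).toEquiv, by
        intro a b
        simp only [SimpleGraph.comap_adj, Function.Embedding.subtype_apply]
        rfl⟩
    exact ⟨fun ⟨f⟩ => ⟨e.trans f⟩, fun ⟨f⟩ => ⟨e.symm.trans f⟩⟩
  have hcard : ∀ S : {S : Finset (Fin n) // Nonempty (G.induce (S : Set (Fin n)) ≃g
      SimpleGraph.turanGraph s r)}, S.1.card = s := by
    rintro ⟨S, ⟨f⟩⟩
    have := Fintype.card_congr f.toEquiv
    simpa using this
  refine Nat.card_eq_of_bijective (fun S => ⟨S.1.orderEmbOfFin (hcard S),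
    (hiso S.1 (hcard S)).1 S.2⟩) ⟨?_, ?_⟩
  · rintro S T h
    refine Subtype.ext ?_
    have h1 : S.1.orderEmbOfFin (hcard S) = T.1.orderEmbOfFin (hcard T) :=
      congrArg Subtype.val h
    have h2 := Finset.range_orderEmbOfFin S.1 (hcard S)
    rw [h1, Finset.range_orderEmbOfFin] at h2
    exact_mod_cast h2.symm
  · rintro ⟨e, he⟩
    let S : Finset (Fin n) := Finset.univ.map e.toEmbedding
    have hS : S.card = s := by simp [S]
    have heS : S.orderEmbOfFin hS = e := by
      have := Finset.orderEmbOfFin_unique' hS (f := e) (fun x => by simp [S])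
      exact this.symm
    refine ⟨⟨S, (hiso S hS).2 (by rw [heS]; exact he)⟩, Subtype.ext heS⟩

theorem card_orderEmb (s n : ℕ) : Fintype.card (Fin s ↪o Fin n) = n.choose s := by
  have h1 : Fintype.card (Fin s ↪o Fin n) = (Finset.powersetCard s (Finset.univ : Finset (Fin n))).card := by
    rw [← Finset.card_univ]
    refine Finset.card_bij (fun e _ => Finset.univ.map e.toEmbedding) ?_ ?_ ?_
    · intro e _
      simp [Finset.mem_powersetCard]
    · intro e _ f _ h
      have h1 := Finset.orderEmbOfFin_unique' (s := Finset.univ.map e.toEmbedding) (k := s)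
        (by simp) (f := e) (fun x => by simp)
      have h2 := Finset.orderEmbOfFin_unique' (s := Finset.univ.map e.toEmbedding) (k := s)
        (by simp) (f := f) (fun x => by rw [h]; simp)
      rw [h1, h2]
    · intro S hS
      rw [Finset.mem_powersetCard] at hS
      refine ⟨S.orderEmbOfFin hS.2, Finset.mem_univ _, ?_⟩
      rw [← Finset.coe_inj, Finset.coe_map]
      simp
  rw [h1, Finset.card_powersetCard, Finset.card_univ, Fintype.card_fin]

/-- The expected number of copies of the Turán graph in a random sample. -/
theorem integral_inducedCopies (hpq : s = p * r + q) (hq : q < r) {G : SimpleGraph Ω}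
    (hG : MeasurableAdj G) (ν : Measure Ω) [IsProbabilityMeasure ν] (n : ℕ) :
    Integrable (fun t : Fin n → Ω => (inducedCopies (SimpleGraph.turanGraph s r) (G.comap t) : ℝ))
      (Measure.pi fun _ => ν) ∧
    ∫ t : Fin n → Ω, (inducedCopies (SimpleGraph.turanGraph s r) (G.comap t) : ℝ)
      ∂(Measure.pi fun _ => ν) = n.choose s * blowupDensity (Fin s) r p G ν := by
  classical
  have h1 : ∀ t : Fin n → Ω, (inducedCopies (SimpleGraph.turanGraph s r) (G.comap t) : ℝ) =
      ∑ e : Fin s ↪o Fin n,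
        Set.indicator ((fun t : Fin n → Ω => t ∘ e) ⁻¹' balancedTuples (Fin s) r p G) 1 t := by
    intro t
    rw [inducedCopies_eq_sum hpq hq]
    push_cast
    refine Finset.sum_congr rfl fun e _ => ?_
    rw [Set.indicator_apply]
    rfl
  have hmp := fun e : Fin s ↪o Fin n => measurePreserving_comp_of_injective ν e.injective
  have hms := fun e : Fin s ↪o Fin n =>
    (hmp e).measurable (hG.measurableSet_balancedTuples (V := Fin s) r p)
  have hint : ∀ e : Fin s ↪o Fin n, Integrable (Set.indicator
      ((fun t : Fin n → Ω => t ∘ e) ⁻¹' balancedTuples (Fin s) r p G) (1 : (Fin n → Ω) → ℝ))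
      (Measure.pi fun _ => ν) := fun e => (integrable_const (1 : ℝ)).indicator (hms e)
  simp_rw [h1]
  refine ⟨integrable_finsetSum _ fun e _ => hint e, ?_⟩
  rw [integral_finsetSum _ fun e _ => hint e]
  have h2 : ∀ e : Fin s ↪o Fin n, ∫ t, Set.indicator
      ((fun t : Fin n → Ω => t ∘ e) ⁻¹' balancedTuples (Fin s) r p G) (1 : (Fin n → Ω) → ℝ) t
      ∂(Measure.pi fun _ => ν) = blowupDensity (Fin s) r p G ν := by
    intro e
    rw [integral_indicator_one (hms e), blowupDensity, measureReal_def, measureReal_def,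
      (hmp e).measure_preimage (hG.measurableSet_balancedTuples r p).nullMeasurableSet]
  rw [Finset.sum_congr rfl fun e _ => h2 e, Finset.sum_const, Finset.card_univ, card_orderEmb,
    nsmul_eq_mul]

/-- Each copy gives `s!` distinct balanced maps. Non-injective maps may be balanced as well, hence
only an inequality. -/
theorem factorial_mul_inducedCopies_le (hpq : s = p * r + q) (hq : q < r) {n : ℕ} (hn : 1 ≤ n)
    (G : SimpleGraph (Fin n)) :
    (s ! : ℝ) * inducedCopies (SimpleGraph.turanGraph s r) G ≤
      (n : ℝ) ^ s * weightedDensity (Fin s) r p G fun _ => 1 / n := by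
  classical
  have h1 : (n : ℝ) ^ s * weightedDensity (Fin s) r p G (fun _ => 1 / n) =
      (Finset.univ.filter fun σ : Fin s → Fin n => IsBalanced r p (G.comap σ)).card := by
    rw [weightedDensity]
    simp only [Finset.prod_const, Finset.card_univ, Fintype.card_fin]
    rw [← Finset.mul_sum, ← mul_assoc, ← mul_pow, mul_one_div_cancel (by positivity), one_pow,
      one_mul, Finset.sum_boole]
  rw [h1, inducedCopies_eq_sum hpq hq, Finset.sum_boole]
  norm_cast
  have h2 : s ! * (Finset.univ.filter fun e : Fin s ↪o Fin n => IsBalanced r p (G.comap e)).card =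
      ((Finset.univ : Finset (Equiv.Perm (Fin s))) ×ˢ
        (Finset.univ.filter fun e : Fin s ↪o Fin n => IsBalanced r p (G.comap e))).card := by
    rw [Finset.card_product, Finset.card_univ, Fintype.card_perm, Fintype.card_fin]
  rw [h2]
  refine Finset.card_le_card_of_injOn (fun x => x.2 ∘ x.1) ?_ ?_
  · rintro ⟨π, e⟩ h
    simp only [Finset.coe_product, Set.mem_prod, Finset.mem_coe, Finset.mem_filter,
      Finset.mem_univ, true_and] at h ⊢
    let i : G.comap (e ∘ π) ≃g G.comap e := ⟨π, by intro a b; rfl⟩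
    exact isBalanced_iff_of_iso i h
  · rintro ⟨π, e⟩ _ ⟨π', e'⟩ _ h
    simp only at h
    have hr : Set.range e = Set.range e' := by
      rw [← EquivLike.range_comp e π, ← EquivLike.range_comp e' π', h]
    have hee : e = e' := by
      have h1 := Finset.orderEmbOfFin_unique' (s := Finset.univ.map e.toEmbedding) (k := s)
        (by simp) (f := e) (fun x => by simp)
      have h2 := Finset.orderEmbOfFin_unique' (s := Finset.univ.map e.toEmbedding) (k := s)
        (by simp) (f := e') (fun x => by
          have : e' x ∈ Set.range e := by rw [hr]; exact ⟨x, rfl⟩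
          simpa using this)
      rw [h1, h2]
    subst hee
    have : π = π' := Equiv.ext fun a => e.injective (congrFun h a)
    rw [this]

/-- `c` bounds the densities in the equipartite blow-ups of the cliques with no size in `K`
forbidden. -/
def IsCliqueBound (s r p : ℕ) (K : Set ℕ) (c : ℝ) : Prop :=
  ∀ n, (∀ j ∈ K, n < j) → equipartiteDensity s r p n ≤ c

theorem factorial_mul_inducedCopies_le_of_isCliqueBound (hpq : s = p * r + q) (hq : q < r)
    (hp : 1 ≤ p) (hp3 : p ≤ 3) (hrs : r < s) (hs2 : 2 ≤ s) {K : Set ℕ} {c : ℝ}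
    (hc : IsCliqueBound s r p K c) {n : ℕ} (hn : 1 ≤ n)
    (G : SimpleGraph (Fin n)) (hG : ∀ j ∈ K, G.CliqueFree j) :
    (s ! : ℝ) * inducedCopies (SimpleGraph.turanGraph s r) G ≤ (n : ℝ) ^ s * c := by
  refine (factorial_mul_inducedCopies_le hpq hq hn G).trans ?_
  have hw : (fun _ => 1 / (n : ℝ)) ∈ stdSimplex ℝ (Fin n) := by
    refine ⟨fun _ => by positivity, ?_⟩
    have : (n : ℝ) ≠ 0 := by positivity
    simp [this]
  obtain ⟨m, hm1, hm, hle⟩ := exists_weightedDensity_le (s := s) hp hp3 hrs hs2 G hw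
  refine mul_le_mul_of_nonneg_left (hle.trans (hc m fun j hj => ?_)) (by positivity)
  by_contra hjm
  exact hm ((hG j hj).mono (not_lt.1 hjm))

theorem tendsto_pow_div_choose (s : ℕ) :
    Tendsto (fun n : ℕ => (n : ℝ) ^ s / (s ! * n.choose s)) atTop (𝓝 1) := by
  have h := (isEquivalent_choose s).symm
  have h2 := (Asymptotics.isEquivalent_iff_tendsto_one (by
    filter_upwards [eventually_ge_atTop s] with n hn
    have : 0 < n.choose s := Nat.choose_pos hn
    positivity)).1 h
  refine h2.congr fun n => ?_
  simp only [Pi.div_apply]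
  rw [div_div]

/-- The density is the mean induced density of an `n`-point sample. The finite bound applies to
almost every sample, and its excess factor `n^s / (s! * n.choose s)` tends to `1`. -/
theorem blowupDensity_le_of_isProbabilityMeasure (hpq : s = p * r + q) (hq : q < r)
    (hp : 1 ≤ p) (hp3 : p ≤ 3) (hrs : r < s) (hs2 : 2 ≤ s) {K : Set ℕ} {c : ℝ}
    (hc : IsCliqueBound s r p K c) {G : SimpleGraph Ω} (hG : MeasurableAdj G) (ν : Measure Ω)
    [IsProbabilityMeasure ν] (hν : ∀ j ∈ K, AECliqueFree G ν j) :
    blowupDensity (Fin s) r p G ν ≤ c := by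
  have h1 : ∀ᶠ n : ℕ in atTop,
      blowupDensity (Fin s) r p G ν ≤ (n : ℝ) ^ s / (s ! * n.choose s) * c := by
    filter_upwards [eventually_ge_atTop (max s 1)] with n hn
    have hns : s ≤ n := (le_max_left _ _).trans hn
    have hn1 : 1 ≤ n := (le_max_right _ _).trans hn
    obtain ⟨hint, hval⟩ := integral_inducedCopies hpq hq hG ν n
    have hfree : ∀ᵐ t ∂(Measure.pi fun _ : Fin n => ν), ∀ j ∈ K, (G.comap t).CliqueFree j := by
      rw [ae_ball_iff K.to_countable]
      exact fun j hj => (hν j hj).ae_cliqueFree (Fin n)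
    have hle : ∫ t : Fin n → Ω, (inducedCopies (SimpleGraph.turanGraph s r) (G.comap t) : ℝ)
        ∂(Measure.pi fun _ => ν) ≤ (n : ℝ) ^ s * c / s ! := by
      have : ∫ t : Fin n → Ω, (inducedCopies (SimpleGraph.turanGraph s r) (G.comap t) : ℝ)
        ∂(Measure.pi fun _ => ν) ≤ ∫ _ : Fin n → Ω, (n : ℝ) ^ s * c / s !
          ∂(Measure.pi fun _ => ν) := by
        refine integral_mono_ae hint (integrable_const _) ?_
        filter_upwards [hfree] with t ht
        rw [le_div_iff₀ (by positivity), mul_comm]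
        exact factorial_mul_inducedCopies_le_of_isCliqueBound hpq hq hp hp3 hrs hs2 hc hn1 _ ht
      simpa using this
    rw [hval] at hle
    have : (0 : ℝ) < n.choose s := by exact_mod_cast Nat.choose_pos hns
    rw [div_mul_eq_mul_div, le_div_iff₀ (by positivity)]
    rw [le_div_iff₀ (by positivity)] at hle
    linarith
  refine ge_of_tendsto ?_ h1
  simpa using (tendsto_pow_div_choose s).mul_const c

theorem blowupDensity_smul (V : Type*) [Fintype V] (G : SimpleGraph Ω) (ν : Measure Ω)
    [IsFiniteMeasure ν] (a : ℝ≥0) :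
    blowupDensity V r p G (a • ν) = a ^ Fintype.card V * blowupDensity V r p G ν := by
  classical
  have := pi_real_sum_smul (V := V) (J := Unit) (fun _ => a) (fun _ => ν) (balancedTuples V r p G)
  simpa [blowupDensity] using this

theorem AECliqueFree.of_absolutelyContinuous {G : SimpleGraph Ω} {ν : Measure Ω} {j : ℕ}
    (h : AECliqueFree G ν j) {ν' : Measure Ω}
    (hν : Measure.pi (fun _ : Fin j => ν') ≪ Measure.pi (fun _ : Fin j => ν)) :
    AECliqueFree G ν' j := hν.ae_le h

/-- The density is homogeneous of degree `s` in the measure, so normalising reduces to probability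
measures. -/
theorem blowupDensity_le (hpq : s = p * r + q) (hq : q < r)
    (hp : 1 ≤ p) (hp3 : p ≤ 3) (hrs : r < s) (hs2 : 2 ≤ s) {K : Set ℕ} {c : ℝ}
    (hc : IsCliqueBound s r p K c) {G : SimpleGraph Ω} (hG : MeasurableAdj G) (ν : Measure Ω)
    [IsFiniteMeasure ν] (hν : ∀ j ∈ K, AECliqueFree G ν j) :
    blowupDensity (Fin s) r p G ν ≤ c * ν.real Set.univ ^ s := by
  rcases eq_or_ne ν 0 with rfl | h0
  · have : (Measure.pi fun _ : Fin s => (0 : Measure Ω)) = 0 := by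
      rw [← Measure.measure_univ_eq_zero, Measure.pi_univ]
      exact Finset.prod_eq_zero (Finset.mem_univ ⟨0, by omega⟩) (by simp)
    rw [blowupDensity, this]
    simp [show s ≠ 0 by omega]
  · set m : ℝ≥0 := (ν Set.univ).toNNReal with hm
    have hm' : (m : ℝ≥0∞) = ν Set.univ := ENNReal.coe_toNNReal (measure_ne_top _ _)
    have hm0 : m ≠ 0 := by
      intro h
      rw [h] at hm'
      exact h0 (Measure.measure_univ_eq_zero.1 (by simpa using hm'.symm))
    have hprob : IsProbabilityMeasure (m⁻¹ • ν) := ⟨by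
      rw [Measure.smul_apply, ← hm', ENNReal.smul_def, smul_eq_mul, ← ENNReal.coe_mul,
        inv_mul_cancel₀ hm0, ENNReal.coe_one]⟩
    have hac : ∀ j : ℕ, Measure.pi (fun _ : Fin j => m⁻¹ • ν) ≪ Measure.pi (fun _ : Fin j => ν) := by
      intro j
      have := pi_sum_smul (V := Fin j) (J := Unit) (fun _ => m⁻¹) (fun _ => ν)
      simp only [Finset.univ_unique, Finset.sum_singleton] at this
      rw [this]
      exact Measure.smul_absolutelyContinuous
    have h1 := blowupDensity_le_of_isProbabilityMeasure hpq hq hp hp3 hrs hs2 hc hG (m⁻¹ • ν)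
      fun j hj => (hν j hj).of_absolutelyContinuous (hac j)
    have h2 : ν = m • (m⁻¹ • ν) := by rw [smul_smul, mul_inv_cancel₀ hm0, one_smul]
    have h3 : ν.real Set.univ = m := by rw [measureReal_def, ← hm']; rfl
    rw [h3]
    conv_lhs => rw [h2]
    rw [blowupDensity_smul, Fintype.card_fin, mul_comm]
    exact mul_le_mul_of_nonneg_right h1 (by positivity)

end Sampling

end Inducibility

namespace Inducibility

open scoped NNReal ENNReal

/-! ### Second-order expansion of the density -/

section Expansion

variable {V Ω : Type*} [Fintype V] [DecidableEq V] [MeasurableSpace Ω]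

/-- A binomial expansion, with `T` the set of coordinates drawn from the perturbation `ν`. -/
theorem pi_add_smul (μ ν : Measure Ω) [IsFiniteMeasure μ] [IsFiniteMeasure ν] (ε : ℝ≥0) :
    Measure.pi (fun _ : V => μ + ε • ν) = ∑ T : Finset V, ε ^ T.card •
      Measure.pi (fun v => if v ∈ T then ν else μ) := by
  have inst : ∀ T : Finset V, ∀ v, IsFiniteMeasure (if v ∈ T then ν else μ) := by
    intro T v
    split_ifs <;> infer_instance
  refine Measure.pi_eq fun B _ => ?_
  rw [Measure.finsetSum_apply]
  simp only [Measure.smul_apply, Measure.pi_pi, Measure.add_apply]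
  simp_rw [add_comm (μ _)]
  rw [Finset.prod_add, Finset.powerset_univ]
  refine Finset.sum_congr rfl fun T _ => ?_
  rw [← Finset.prod_sdiff (Finset.subset_univ T), mul_comm]
  rw [Finset.prod_congr rfl (fun v (hv : v ∈ T) => by rw [if_pos hv]),
    Finset.prod_congr rfl (fun v (hv : v ∈ Finset.univ \ T) => by
      rw [if_neg (Finset.mem_sdiff.1 hv).2])]
  simp only [ENNReal.smul_def, smul_eq_mul, Finset.prod_mul_distrib, Finset.prod_const]
  push_cast
  ring

theorem pi_le_of_le {μ ν : Measure Ω} [IsFiniteMeasure μ] (h : ν ≤ μ) :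
    Measure.pi (fun _ : V => ν) ≤ Measure.pi (fun _ : V => μ) := by
  have hν : IsFiniteMeasure ν := isFiniteMeasure_of_le μ h
  have e : μ = ν + (1 : ℝ≥0) • (μ - ν) := by
    rw [one_smul, add_comm, Measure.sub_add_cancel_of_le h]
  rw [e, pi_add_smul]
  refine Measure.le_intro fun B _ _ => ?_
  rw [Measure.finsetSum_apply]
  refine le_trans ?_ (Finset.single_le_sum (fun T _ => zero_le) (Finset.mem_univ ∅))
  simp

omit [DecidableEq V] in
theorem prod_real_apply {Ω' : Type*} [MeasurableSpace Ω'] (ν : Measure Ω) (ρ : Measure Ω')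
    [IsFiniteMeasure ν] [IsFiniteMeasure ρ] {S : Set (Ω × Ω')} (hS : MeasurableSet S) :
    (ν.prod ρ).real S = ∫ x, ρ.real (Prod.mk x ⁻¹' S) ∂ν := by
  rw [measureReal_def, Measure.prod_apply hS]
  simp only [measureReal_def]
  rw [integral_toReal (measurable_measure_prodMk_left hS).aemeasurable]
  exact Eventually.of_forall fun _ => measure_lt_top _ _

omit [Fintype V] in
theorem measurable_update_prod (u : V) :
    Measurable fun z : Ω × (V → Ω) => Function.update z.2 u z.1 := by
  refine measurable_pi_lambda _ fun w => ?_
  by_cases h : w = u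
  · subst h; simpa using measurable_fst
  · simp only [Function.update_of_ne h]
    exact (measurable_pi_apply w).comp measurable_snd

/-- The overwritten coordinate carries a probability measure, so discarding it costs no factor. -/
theorem pi_update_eq_map (m : V → Measure Ω) (u : V) (ν : Measure Ω) [∀ v, IsFiniteMeasure (m v)]
    [IsFiniteMeasure ν] [IsProbabilityMeasure (m u)] :
    Measure.pi (Function.update m u ν) =
      (ν.prod (Measure.pi m)).map fun z => Function.update z.2 u z.1 := by
  have inst : ∀ v, IsFiniteMeasure (Function.update m u ν v) := by
    intro v
    by_cases h : v = u
    · subst h; rw [Function.update_self]; infer_instance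
    · rw [Function.update_of_ne h]; infer_instance
  refine Measure.pi_eq (μ := Function.update m u ν) fun B hB => ?_
  rw [Measure.map_apply (measurable_update_prod u) (MeasurableSet.univ_pi hB)]
  have : (fun z : Ω × (V → Ω) => Function.update z.2 u z.1) ⁻¹' Set.univ.pi B =
      B u ×ˢ Set.univ.pi (Function.update B u Set.univ) := by
    ext ⟨x, t⟩
    simp only [Set.mem_preimage, Set.mem_univ_pi, Set.mem_prod]
    constructor
    · intro h
      refine ⟨by simpa using h u, fun v => ?_⟩
      by_cases hv : v = u
      · subst hv; simp
      · simpa [hv] using h v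
    · rintro ⟨h1, h2⟩ v
      by_cases hv : v = u
      · subst hv; simpa using h1
      · simpa [hv] using h2 v
  rw [this, Measure.prod_prod, Measure.pi_pi, ← Finset.mul_prod_erase _ _ (Finset.mem_univ u),
    ← Finset.mul_prod_erase _ (fun i => Function.update m u ν i (B i)) (Finset.mem_univ u)]
  simp only [Function.update_self, measure_univ, one_mul]
  congr 1
  refine Finset.prod_congr rfl fun v hv => ?_
  rw [Function.update_of_ne (Finset.ne_of_mem_erase hv),
    Function.update_of_ne (Finset.ne_of_mem_erase hv)]

variable (V) in
/-- The total measure of the balanced tuples with one coordinate at `x`. -/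
noncomputable def pointDensity (r p : ℕ) (G : SimpleGraph Ω) (μ : Measure Ω) (x : Ω) : ℝ :=
  ∑ u : V, (Measure.pi fun _ : V => μ).real {t | Function.update t u x ∈ balancedTuples V r p G}

variable (V) in
/-- The total measure of the balanced tuples with one coordinate at `x` and another one at `z`. -/
noncomputable def pairDensity (r p : ℕ) (G : SimpleGraph Ω) (μ : Measure Ω) (x z : Ω) : ℝ :=
  ∑ u : V, ∑ v ∈ Finset.univ.erase u, (Measure.pi fun _ : V => μ).real
    {t | Function.update (Function.update t u x) v z ∈ balancedTuples V r p G}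

variable {r p : ℕ} {G : SimpleGraph Ω} {μ : Measure Ω} [IsProbabilityMeasure μ]

omit [IsProbabilityMeasure μ] in
theorem pointDensity_nonneg (x : Ω) : 0 ≤ pointDensity V r p G μ x :=
  Finset.sum_nonneg fun _ _ => measureReal_nonneg

omit [IsProbabilityMeasure μ] in
theorem pairDensity_nonneg (x z : Ω) : 0 ≤ pairDensity V r p G μ x z :=
  Finset.sum_nonneg fun _ _ => Finset.sum_nonneg fun _ _ => measureReal_nonneg

omit [IsProbabilityMeasure μ] in
theorem pairDensity_comm (x z : Ω) : pairDensity V r p G μ x z = pairDensity V r p G μ z x := by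
  rw [pairDensity, pairDensity, Finset.sum_comm' (t' := Finset.univ)
    (s' := fun v => Finset.univ.erase v) (by intro u v; simp [ne_comm])]
  refine Finset.sum_congr rfl fun v _ => Finset.sum_congr rfl fun u hu => ?_
  congr 1
  ext t
  rw [Set.mem_ofPred_eq, Set.mem_ofPred_eq,
    Function.update_comm (Finset.ne_of_mem_erase hu)]

theorem measurableSet_update (hG : MeasurableAdj G) (u : V) :
    MeasurableSet {z : Ω × (V → Ω) | Function.update z.2 u z.1 ∈ balancedTuples V r p G} :=
  measurable_update_prod u (hG.measurableSet_balancedTuples r p)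

theorem measurableSet_update_update (hG : MeasurableAdj G) (u v : V) :
    MeasurableSet {z : (Ω × Ω) × (V → Ω) |
      Function.update (Function.update z.2 u z.1.1) v z.1.2 ∈ balancedTuples V r p G} := by
  have h1 : Measurable fun z : (Ω × Ω) × (V → Ω) => Function.update z.2 u z.1.1 :=
    (measurable_update_prod u).comp ((measurable_fst.comp measurable_fst).prodMk measurable_snd)
  have h2 : Measurable fun z : (Ω × Ω) × (V → Ω) =>
      Function.update (Function.update z.2 u z.1.1) v z.1.2 :=
    (measurable_update_prod v).comp ((measurable_snd.comp measurable_fst).prodMk h1)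
  exact h2 (hG.measurableSet_balancedTuples r p)

theorem measurable_pointDensity (hG : MeasurableAdj G) :
    Measurable (pointDensity V r p G μ) := by
  refine Finset.measurable_fun_sum _ fun u _ => ?_
  exact (measurable_measure_prodMk_left (measurableSet_update hG u)).ennreal_toReal

theorem measurable_pairDensity (hG : MeasurableAdj G) :
    Measurable fun z : Ω × Ω => pairDensity V r p G μ z.1 z.2 := by
  refine Finset.measurable_fun_sum _ fun u _ => Finset.measurable_fun_sum _ fun v _ => ?_
  exact (measurable_measure_prodMk_left (measurableSet_update_update hG u v)).ennreal_toReal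

theorem pointDensity_le (x : Ω) : pointDensity V r p G μ x ≤ Fintype.card V := by
  refine (Finset.sum_le_sum fun u _ => measureReal_le_one).trans ?_
  simp

theorem pairDensity_le (x z : Ω) :
    pairDensity V r p G μ x z ≤ Fintype.card V * Fintype.card V := by
  have : ∀ u : V, ∑ v ∈ Finset.univ.erase u, (Measure.pi fun _ : V => μ).real
      {t | Function.update (Function.update t u x) v z ∈ balancedTuples V r p G} ≤
      Fintype.card V := by
    intro u
    refine (Finset.sum_le_sum fun v _ => measureReal_le_one).trans ?_
    simp
  refine (Finset.sum_le_sum fun u _ => this u).trans ?_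
  simp

theorem integrable_pointDensity (hG : MeasurableAdj G) (ν : Measure Ω) [IsFiniteMeasure ν] :
    Integrable (pointDensity V r p G μ) ν :=
  Integrable.of_bound (measurable_pointDensity hG).aestronglyMeasurable (Fintype.card V)
    (Eventually.of_forall fun x => by
      rw [Real.norm_of_nonneg (pointDensity_nonneg x)]
      exact pointDensity_le x)

theorem pi_update_real (hG : MeasurableAdj G) (u : V) (ν : Measure Ω) [IsFiniteMeasure ν] :
    (Measure.pi (Function.update (fun _ : V => μ) u ν)).real (balancedTuples V r p G) =
      ∫ x, (Measure.pi fun _ : V => μ).real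
        {t | Function.update t u x ∈ balancedTuples V r p G} ∂ν := by
  rw [pi_update_eq_map, measureReal_def, Measure.map_apply (measurable_update_prod u)
    (hG.measurableSet_balancedTuples r p), ← measureReal_def]
  exact prod_real_apply _ _ (measurableSet_update hG u)

theorem sum_pi_update_real (hG : MeasurableAdj G) (ν : Measure Ω) [IsFiniteMeasure ν] :
    ∑ u : V, (Measure.pi (Function.update (fun _ : V => μ) u ν)).real (balancedTuples V r p G) =
      ∫ x, pointDensity V r p G μ x ∂ν := by
  simp only [pointDensity]
  rw [integral_finsetSum]
  · exact Finset.sum_congr rfl fun u _ => pi_update_real hG u ν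
  · intro u _
    exact Integrable.of_bound (measurable_measure_prodMk_left
      (measurableSet_update hG u)).ennreal_toReal.aestronglyMeasurable 1
      (Eventually.of_forall fun x => by
        rw [Real.norm_of_nonneg measureReal_nonneg]
        exact measureReal_le_one)

theorem pi_update_update_real (hG : MeasurableAdj G) {u v : V} (huv : u ≠ v) (ν ν' : Measure Ω)
    [IsFiniteMeasure ν] [IsFiniteMeasure ν'] :
    (Measure.pi (Function.update (Function.update (fun _ : V => μ) u ν) v ν')).real
      (balancedTuples V r p G) = ∫ z, (Measure.pi fun _ : V => μ).real
        {t | Function.update (Function.update t u z.1) v z.2 ∈ balancedTuples V r p G}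
        ∂(ν.prod ν') := by
  have inst : ∀ w, IsFiniteMeasure (Function.update (fun _ : V => μ) v ν' w) := by
    intro w
    by_cases h : w = v
    · subst h; rw [Function.update_self]; infer_instance
    · rw [Function.update_of_ne h]; infer_instance
  have inst' : IsProbabilityMeasure (Function.update (fun _ : V => μ) v ν' u) := by
    rw [Function.update_of_ne huv]; infer_instance
  rw [Function.update_comm huv, pi_update_eq_map, pi_update_eq_map (fun _ : V => μ) v ν']
  have hm : Measurable fun z : Ω × Ω × (V → Ω) =>
      Function.update (Function.update z.2.2 u z.1) v z.2.1 := by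
    have h1 : Measurable fun z : Ω × Ω × (V → Ω) => Function.update z.2.2 u z.1 :=
      (measurable_update_prod u).comp (measurable_fst.prodMk (measurable_snd.comp measurable_snd))
    exact (measurable_update_prod v).comp ((measurable_fst.comp measurable_snd).prodMk h1)
  have h1 : ((ν.prod ((ν'.prod (Measure.pi fun _ : V => μ)).map
      fun z => Function.update z.2 v z.1)).map fun z => Function.update z.2 u z.1) =
      (ν.prod (ν'.prod (Measure.pi fun _ : V => μ))).map
        fun z => Function.update (Function.update z.2.2 u z.1) v z.2.1 := by
    have h2 : ν.prod ((ν'.prod (Measure.pi fun _ : V => μ)).map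
        fun z => Function.update z.2 v z.1) = (ν.prod (ν'.prod (Measure.pi fun _ : V => μ))).map
        (Prod.map id fun z => Function.update z.2 v z.1) := by
      rw [← Measure.map_prod_map _ _ measurable_id (measurable_update_prod v), Measure.map_id]
    rw [h2, Measure.map_map (measurable_update_prod u)
      (measurable_id.prodMap (measurable_update_prod v))]
    congr 1
    funext z
    simp only [Function.comp_apply, Prod.map_fst, Prod.map_snd, id_eq]
    exact Function.update_comm huv.symm _ _ _
  rw [h1, ← Measure.prodAssoc_prod, Measure.map_map hm MeasurableEquiv.prodAssoc.measurable,
    measureReal_def, Measure.map_apply (hm.comp MeasurableEquiv.prodAssoc.measurable)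
    (hG.measurableSet_balancedTuples r p), ← measureReal_def]
  exact prod_real_apply _ _ (measurableSet_update_update hG u v)

theorem sum_pi_update_update_real (hG : MeasurableAdj G) (ν : Measure Ω) [IsFiniteMeasure ν] :
    ∑ u : V, ∑ v ∈ Finset.univ.erase u,
      (Measure.pi (Function.update (Function.update (fun _ : V => μ) u ν) v ν)).real
        (balancedTuples V r p G) = ∫ z, pairDensity V r p G μ z.1 z.2 ∂(ν.prod ν) := by
  have hint : ∀ u v : V, Integrable (fun z : Ω × Ω => (Measure.pi fun _ : V => μ).real
      {t | Function.update (Function.update t u z.1) v z.2 ∈ balancedTuples V r p G})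
      (ν.prod ν) := fun u v =>
    Integrable.of_bound (measurable_measure_prodMk_left
      (measurableSet_update_update hG u v)).ennreal_toReal.aestronglyMeasurable 1
      (Eventually.of_forall fun x => by
        rw [Real.norm_of_nonneg measureReal_nonneg]
        exact measureReal_le_one)
  simp only [pairDensity]
  rw [integral_finsetSum _ fun u _ => integrable_finsetSum _ fun v _ => hint u v]
  refine Finset.sum_congr rfl fun u _ => ?_
  rw [integral_finsetSum _ fun v _ => hint u v]
  exact Finset.sum_congr rfl fun v hv =>
    pi_update_update_real hG (Finset.ne_of_mem_erase hv).symm ν ν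

/-- Each two-element set comes from two ordered pairs, which explains the `1/2` in the second-order
term. -/
theorem sum_erase_pair (F : Finset V → ℝ) :
    ∑ u : V, ∑ v ∈ Finset.univ.erase u, F {u, v} =
      2 * ∑ T ∈ Finset.powersetCard 2 Finset.univ, F T := by
  rw [Finset.sum_sigma']
  rw [← Finset.sum_fiberwise_of_maps_to (t := Finset.powersetCard 2 Finset.univ)
    (g := fun x : (_ : V) × V => ({x.1, x.2} : Finset V))]
  · rw [Finset.mul_sum]
    refine Finset.sum_congr rfl fun T hT => ?_
    rw [Finset.mem_powersetCard] at hT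
    obtain ⟨a, b, hab, rfl⟩ := Finset.card_eq_two.1 hT.2
    have : (Finset.filter (fun x : (_ : V) × V => ({x.1, x.2} : Finset V) = {a, b})
        (Finset.univ.sigma fun u => Finset.univ.erase u)) = {⟨a, b⟩, ⟨b, a⟩} := by
      ext ⟨u, v⟩
      simp only [Finset.mem_filter, Finset.mem_sigma, Finset.mem_univ, Finset.mem_erase,
        true_and, and_true, Finset.mem_insert, Finset.mem_singleton, Sigma.mk.injEq, heq_eq_eq]
      constructor
      · rintro ⟨h1, h2⟩
        have hu : u ∈ ({a, b} : Finset V) := by rw [← h2]; simp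
        have hv : v ∈ ({a, b} : Finset V) := by rw [← h2]; simp
        simp only [Finset.mem_insert, Finset.mem_singleton] at hu hv
        rcases hu with rfl | rfl <;> rcases hv with rfl | rfl <;> simp_all
      · rintro (⟨rfl, rfl⟩ | ⟨rfl, rfl⟩)
        · exact ⟨hab.symm, rfl⟩
        · exact ⟨hab, Finset.pair_comm _ _⟩
    rw [this, Finset.sum_pair (by simp [hab])]
    simp only
    rw [Finset.pair_comm b a]
    ring
  · rintro ⟨u, v⟩ h
    simp only [Finset.mem_sigma, Finset.mem_univ, Finset.mem_erase, true_and, and_true] at h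
    rw [Finset.mem_powersetCard]
    exact ⟨Finset.subset_univ _, Finset.card_pair h.symm⟩

/-- The second order expansion of the density bounds the density of a perturbed measure from
below. -/
theorem le_blowupDensity_add_smul (hG : MeasurableAdj G) (ν : Measure Ω) [IsFiniteMeasure ν]
    (ε : ℝ≥0) :
    blowupDensity V r p G μ + ε * ∫ x, pointDensity V r p G μ x ∂ν +
      ε ^ 2 * ((∫ z, pairDensity V r p G μ z.1 z.2 ∂(ν.prod ν)) / 2) ≤
      blowupDensity V r p G (μ + ε • ν) := by
  have inst : ∀ T : Finset V, ∀ v, IsFiniteMeasure (if v ∈ T then ν else μ) := by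
    intro T v
    split_ifs <;> infer_instance
  let E : Finset V → ℝ := fun T =>
    (Measure.pi fun v => if v ∈ T then ν else μ).real (balancedTuples V r p G)
  have hE : blowupDensity V r p G (μ + ε • ν) = ∑ T : Finset V, (ε : ℝ) ^ T.card * E T := by
    rw [blowupDensity, pi_add_smul, measureReal_def, Measure.finsetSum_apply, ENNReal.toReal_sum]
    · refine Finset.sum_congr rfl fun σ _ => ?_
      rw [Measure.smul_apply, ENNReal.smul_def, smul_eq_mul, ENNReal.toReal_mul]
      simp [E, measureReal_def]
    · intro σ _
      exact measure_ne_top _ _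
  have hE0 : ∀ T, 0 ≤ (ε : ℝ) ^ T.card * E T := fun T => mul_nonneg (by positivity)
    measureReal_nonneg
  have h0 : E ∅ = blowupDensity V r p G μ := by simp [E, blowupDensity]
  have h1 : ∑ u : V, E {u} = ∫ x, pointDensity V r p G μ x ∂ν := by
    rw [← sum_pi_update_real hG ν]
    refine Finset.sum_congr rfl fun u _ => ?_
    simp only [E]
    congr 2
    funext v
    by_cases h : v = u
    · subst h; simp
    · simp [h]
  have h2 : ∑ u : V, ∑ v ∈ Finset.univ.erase u, E {u, v} =
      ∫ z, pairDensity V r p G μ z.1 z.2 ∂(ν.prod ν) := by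
    rw [← sum_pi_update_update_real hG ν]
    refine Finset.sum_congr rfl fun u _ => Finset.sum_congr rfl fun v _ => ?_
    simp only [E]
    congr 2
    funext w
    by_cases h : w = v
    · subst h; simp
    by_cases h' : w = u
    · subst h'; simp [h]
    · simp [h, h']
  rw [sum_erase_pair] at h2
  rw [hE, ← h0, ← h1, ← h2]
  have e1 : ε * ∑ u : V, E {u} = ∑ T ∈ Finset.powersetCard 1 Finset.univ,
      (ε : ℝ) ^ T.card * E T := by
    rw [Finset.powersetCard_one, Finset.sum_map, Finset.mul_sum]
    simp
  have e2 : (ε : ℝ) ^ 2 * (2 * (∑ T ∈ Finset.powersetCard 2 Finset.univ, E T) / 2) =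
      ∑ T ∈ Finset.powersetCard 2 Finset.univ, (ε : ℝ) ^ T.card * E T := by
    rw [mul_div_cancel_left₀ _ (two_ne_zero), Finset.mul_sum]
    exact Finset.sum_congr rfl fun T hT => by rw [(Finset.mem_powersetCard.1 hT).2]
  have e0 : E ∅ = ∑ T ∈ Finset.powersetCard 0 (Finset.univ : Finset V),
      (ε : ℝ) ^ T.card * E T := by simp
  -- Sets of at most two coordinates reproduce the left side exactly; all larger sets contribute
  -- non-negative terms.
  rw [e0, e1, e2, ← Finset.sum_union, ← Finset.sum_union]
  · exact Finset.sum_le_sum_of_subset_of_nonneg (Finset.subset_univ _) fun T _ _ => hE0 T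
  · rw [Finset.disjoint_union_left]
    constructor <;> exact Finset.pairwise_disjoint_powersetCard _ (by simp)
  · exact Finset.pairwise_disjoint_powersetCard _ (by simp)

end Expansion

end Inducibility

namespace Inducibility

open scoped NNReal ENNReal

/-! ### Concentrating the mass of a set at a point -/

section Kernel

variable {Ω : Type*} [MeasurableSpace Ω] {μ : Measure Ω} [IsProbabilityMeasure μ]

/-- Any measurable set is approximated from `𝒜`, with an error in the integral of at most `C` times
the symmetric difference. A countable `𝒜` then permits a null set of exceptional points independent
of the test set. -/
theorem ae_nonneg_of_measureDense {f : Ω → ℝ} {C : ℝ} (hf : Measurable f) (hC : ∀ x, |f x| ≤ C)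
    {𝒜 : Set (Set Ω)} (h𝒜 : μ.MeasureDense 𝒜) (h : ∀ A ∈ 𝒜, 0 ≤ ∫ x in A, f x ∂μ) :
    0 ≤ᵐ[μ] f := by
  have hint : Integrable f μ := Integrable.of_bound hf.aestronglyMeasurable C
    (Eventually.of_forall hC)
  refine ae_nonneg_of_forall_setIntegral_nonneg hint fun B hB hB' => ?_
  by_contra hneg
  rw [not_le] at hneg
  have hC0 : 0 ≤ C := by
    by_contra h
    have : IsEmpty Ω := ⟨fun x => h ((abs_nonneg _).trans (hC x))⟩
    simp [Measure.eq_zero_of_isEmpty] at hneg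
  obtain ⟨A, hA, hAB⟩ := h𝒜.approx B hB hB'.ne ((-∫ x in B, f x ∂μ) / (C + 1))
    (div_pos (by linarith) (by linarith))
  have hAm := h𝒜.measurable A hA
  have h1 : ∫ x in A, f x ∂μ - ∫ x in B, f x ∂μ ≤ C * μ.real (symmDiff B A) := by
    rw [← integral_indicator hAm, ← integral_indicator hB,
      ← integral_sub (hint.indicator hAm) (hint.indicator hB)]
    have h2 : C * μ.real (symmDiff B A) = ∫ x, (symmDiff B A).indicator (fun _ => C) x ∂μ := by
      rw [integral_indicator (hB.symmDiff hAm)]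
      simp [mul_comm]
    rw [h2]
    refine integral_mono ((hint.indicator hAm).sub (hint.indicator hB))
      ((integrable_const C).indicator (hB.symmDiff hAm)) fun x => ?_
    have := abs_le.1 (hC x)
    by_cases hxA : x ∈ A <;> by_cases hxB : x ∈ B <;>
      simp [Set.indicator, Set.mem_symmDiff, hxA, hxB] <;> linarith
  have h3 : μ.real (symmDiff B A) < (-∫ x in B, f x ∂μ) / (C + 1) := by
    rw [measureReal_def]
    exact (ENNReal.lt_ofReal_iff_toReal_lt (measure_ne_top _ _)).1 hAB
  rw [lt_div_iff₀ (by linarith)] at h3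
  have := h A hA
  have h4 : 0 ≤ μ.real (symmDiff B A) := measureReal_nonneg
  nlinarith

variable {k : Ω → Ω → ℝ} {C M : ℝ}

/-- The energy of the measure obtained from `μ` by moving the mass of `A` to the point `x`. -/
theorem integral_prod_concentrate [MeasurableSingletonClass Ω]
    (hk : Measurable (Function.uncurry k)) (hC : ∀ x z, |k x z| ≤ C)
    (hsymm : ∀ x z, k x z = k z x) (hM : ∀ᵐ x ∂μ, ∫ z, k x z ∂μ = M) {A : Set Ω}
    (hA : MeasurableSet A) {x : Ω} (hx : ∫ z, k x z ∂μ = M) {a : ℝ≥0} (ha : (a : ℝ) = μ.real A)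
    {ν : Measure Ω} [IsFiniteMeasure ν] (hν : ν = a • Measure.dirac x + μ.restrict Aᶜ) :
    ∫ z, k z.1 z.2 ∂(ν.prod ν) = μ.real A ^ 2 * k x x - 2 * μ.real A * ∫ z in A, k x z ∂μ +
      ∫ y in A, ∫ z in A, k y z ∂μ ∂μ + M := by
  have hkx : ∀ x, Measurable (k x) := fun x => hk.comp (measurable_const.prodMk measurable_id)
  have hi1 : ∀ x (ν : Measure Ω) [IsFiniteMeasure ν], Integrable (k x) ν := fun x ν _ =>
    Integrable.of_bound (hkx x).aestronglyMeasurable C (Eventually.of_forall (hC x))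
  have hi2 : ∀ (ν : Measure (Ω × Ω)) [IsFiniteMeasure ν],
      Integrable (fun z : Ω × Ω => k z.1 z.2) ν := fun ν _ =>
    Integrable.of_bound hk.aestronglyMeasurable C (Eventually.of_forall fun z => hC _ _)
  have hi3 : ∀ (ν ν' : Measure Ω) [IsFiniteMeasure ν] [IsFiniteMeasure ν'],
      Integrable (fun y => ∫ z, k y z ∂ν') ν := fun ν ν' _ _ =>
    (hi2 (ν.prod ν')).integral_prod_left
  have hdirac : ∀ f : Ω → ℝ, Integrable f (a • Measure.dirac x) := by
    intro f
    refine Integrable.smul_measure_nnreal ?_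
    exact integrable_dirac (by simp)
  have e1 : ∀ f : Ω → ℝ, Integrable f μ → ∫ z, f z ∂ν = μ.real A * f x + ∫ z in Aᶜ, f z ∂μ := by
    intro f hf
    rw [hν, integral_add_measure (hdirac f) hf.integrableOn, integral_smul_nnreal_measure,
      integral_dirac, NNReal.smul_def, ha, smul_eq_mul]
  have e2 : ∀ y, ∫ z in Aᶜ, k y z ∂μ = ∫ z, k y z ∂μ - ∫ z in A, k y z ∂μ := by
    intro y
    rw [← integral_add_compl hA (hi1 y μ)]
    ring
  have hMint : ∫ y, ∫ z, k y z ∂μ ∂μ = M := by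
    rw [integral_congr_ae hM]; simp
  have e3 : ∫ y in A, ∫ z, k y z ∂μ ∂μ = μ.real A * M := by
    rw [integral_congr_ae (ae_restrict_of_ae hM)]; simp
  have e4 : ∫ y in Aᶜ, ∫ z, k y z ∂μ ∂μ = M - μ.real A * M := by
    have := integral_add_compl hA (hi3 μ μ)
    rw [hMint, e3] at this
    linarith
  have e5 : ∫ y in Aᶜ, ∫ z in A, k y z ∂μ ∂μ =
      μ.real A * M - ∫ y in A, ∫ z in A, k y z ∂μ ∂μ := by
    have h1 := integral_add_compl hA (hi3 μ (μ.restrict A))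
    have h2 : ∫ y, ∫ z in A, k y z ∂μ ∂μ = μ.real A * M := by
      rw [integral_integral_swap (hi2 (μ.prod (μ.restrict A)))]
      simp_rw [fun y z => hsymm y z]
      exact e3
    rw [h2] at h1
    linarith
  have e6 : ∫ y in Aᶜ, k y x ∂μ = M - ∫ z in A, k x z ∂μ := by
    simp_rw [fun y => hsymm y x]
    rw [e2, hx]
  rw [integral_prod _ (hi2 _)]
  have e7 : ∀ y, ∫ z, k y z ∂ν = μ.real A * k y x + ∫ z in Aᶜ, k y z ∂μ := fun y =>
    e1 _ (hi1 y μ)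
  simp only [e7]
  have hi4 : Integrable (fun y => k y x) μ := by
    simp_rw [fun y => hsymm y x]; exact hi1 x μ
  rw [e1 (fun y => μ.real A * k y x + ∫ z in Aᶜ, k y z ∂μ)
    ((hi4.const_mul _).add (hi3 μ (μ.restrict Aᶜ))),
    integral_add ((hi4.const_mul _).integrableOn) ((hi3 μ (μ.restrict Aᶜ)).integrableOn),
    integral_const_mul, e6, e2, hx]
  have e8 : ∫ y in Aᶜ, ∫ z in Aᶜ, k y z ∂μ ∂μ =
      M - 2 * μ.real A * M + ∫ y in A, ∫ z in A, k y z ∂μ ∂μ := by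
    simp only [e2]
    rw [integral_sub (hi3 μ μ).integrableOn (hi3 μ (μ.restrict A)).integrableOn, e4, e5]
    ring
  rw [e8]
  ring

/-- If concentrating the mass of a set at one of its points never increases the energy of `μ`, then
the kernel is negative semidefinite on differences of points. -/
theorem ae_add_le_two_mul_of_concentrate [MeasurableSpace.CountablyGenerated Ω]
    (hk : Measurable (Function.uncurry k)) (hC : ∀ x z, |k x z| ≤ C)
    (h : ∀ A, MeasurableSet A → ∀ᵐ x ∂μ, μ.real A ^ 2 * k x x - 2 * μ.real A * ∫ z in A, k x z ∂μ +
      ∫ y in A, ∫ z in A, k y z ∂μ ∂μ ≤ 0) :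
    ∀ᵐ x ∂μ, ∀ᵐ z ∂μ, k x x + k z z ≤ 2 * k x z := by
  have hkx : ∀ x, Measurable (k x) := fun x => hk.comp (measurable_const.prodMk measurable_id)
  have hdiag : Measurable fun x => k x x := hk.comp (measurable_id.prodMk measurable_id)
  have hi1 : ∀ x (ν : Measure Ω) [IsFiniteMeasure ν], Integrable (k x) ν := fun x ν _ =>
    Integrable.of_bound (hkx x).aestronglyMeasurable C (Eventually.of_forall (hC x))
  have hi2 : ∀ (ν : Measure Ω) [IsFiniteMeasure ν], Integrable (fun x => k x x) ν := fun ν _ =>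
    Integrable.of_bound hdiag.aestronglyMeasurable C (Eventually.of_forall fun x => hC x x)
  have hi3 : ∀ (ν ν' : Measure Ω) [IsFiniteMeasure ν] [IsFiniteMeasure ν'],
      Integrable (fun y => ∫ z, k y z ∂ν') ν := fun ν ν' _ _ =>
    Integrable.integral_prod_left (f := fun z : Ω × Ω => k z.1 z.2)
    (Integrable.of_bound hk.aestronglyMeasurable C (Eventually.of_forall fun z => hC _ _) :
      Integrable _ (ν.prod ν'))
  have key : ∀ A, MeasurableSet A → ∀ᵐ x ∂μ,
      0 ≤ ∫ z in A, (2 * k x z - k x x - k z z) ∂μ := by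
    intro A hA
    rcases eq_or_ne (μ A) 0 with h0 | h0
    · refine Eventually.of_forall fun x => ?_
      rw [setIntegral_measure_zero _ h0]
    have hpos : 0 < μ.real A := ENNReal.toReal_pos h0 (measure_ne_top _ _)
    -- Averaging the hypothesis over `x` in `A` bounds the double integral below by the diagonal
    -- term.
    have hA1 : μ.real A * ∫ x in A, k x x ∂μ ≤ ∫ y in A, ∫ z in A, k y z ∂μ ∂μ := by
      have h1 : ∫ x in A, (μ.real A ^ 2 * k x x) ∂μ ≤ ∫ x in A,
          (2 * μ.real A * (∫ z in A, k x z ∂μ) - ∫ y in A, ∫ z in A, k y z ∂μ ∂μ) ∂μ := by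
        refine integral_mono_ae ((hi2 _).const_mul _)
          (((hi3 _ _).const_mul _).sub (integrable_const _)) (ae_restrict_of_ae ?_)
        filter_upwards [h A hA] with x hx
        linarith
      rw [integral_const_mul, integral_sub ((hi3 _ _).const_mul _) (integrable_const _),
        integral_const_mul, setIntegral_const, smul_eq_mul] at h1
      have h2 : μ.real A * (μ.real A * ∫ x in A, k x x ∂μ) ≤
          μ.real A * ∫ y in A, ∫ z in A, k y z ∂μ ∂μ := by linarith
      exact le_of_mul_le_mul_left h2 hpos
    filter_upwards [h A hA] with x hx
    rw [integral_sub (f := fun z => 2 * k x z - k x x) (g := fun z => k z z)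
      (((hi1 x _).const_mul _).sub (integrable_const _)) (hi2 _),
      integral_sub ((hi1 x _).const_mul _) (integrable_const _), integral_const_mul,
      setIntegral_const, smul_eq_mul]
    have h3 : 0 ≤ μ.real A * (2 * (∫ z in A, k x z ∂μ) - μ.real A * k x x -
        ∫ z in A, k z z ∂μ) := by linarith
    exact nonneg_of_mul_nonneg_right h3 hpos
  -- Countably many test sets allow "for each `A`, almost every `x`" to become "for almost every
  -- `x`, each `A`".
  obtain ⟨𝒜, hcount, hdense⟩ := exists_countable_measureDense μ
  have hall : ∀ᵐ x ∂μ, ∀ A ∈ 𝒜, 0 ≤ ∫ z in A, (2 * k x z - k x x - k z z) ∂μ :=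
    (ae_ball_iff hcount).2 fun A hA => key A (hdense.measurable A hA)
  filter_upwards [hall] with x hx
  have := ae_nonneg_of_measureDense (C := 4 * C)
    (((hkx x).const_mul 2 |>.sub measurable_const).sub hdiag) (fun z => ?_) hdense hx
  · filter_upwards [this] with z hz
    simp only [Pi.zero_apply, Pi.sub_apply] at hz
    linarith
  · have h1 := abs_le.1 (hC x z)
    have h2 := abs_le.1 (hC x x)
    have h3 := abs_le.1 (hC z z)
    simp only [Pi.sub_apply]
    rw [abs_le]
    constructor <;> linarith

end Kernel

/-! ### Estimates for small perturbations -/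

section Perturbation

theorem nonpos_of_forall_le_mul {a K : ℝ} (h : ∀ ε : ℝ, 0 < ε → ε ≤ 1 → a ≤ ε * K) : a ≤ 0 := by
  by_contra ha
  rw [not_le] at ha
  have h1 := h 1 one_pos le_rfl
  have hK : 0 < K := by linarith
  have h2 := h (a / (2 * K)) (by positivity) (by rw [div_le_one (by positivity)]; linarith)
  have : a / (2 * K) * K = a / 2 := by field_simp
  linarith

/-- The coefficients up to order two are exact, as required for comparing second-order terms; the
size of `C` is immaterial. -/
theorem exists_one_add_pow_le (s : ℕ) : ∃ C : ℝ, 0 ≤ C ∧ ∀ y : ℝ, 0 ≤ y → y ≤ 1 →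
    (1 + y) ^ s ≤ 1 + s * y + s * (s - 1) / 2 * y ^ 2 + C * y ^ 3 := by
  induction s with
  | zero => exact ⟨0, le_rfl, fun y _ _ => by simp⟩
  | succ n ih =>
    obtain ⟨C, hC, h⟩ := ih
    refine ⟨2 * C + n ^ 2, by positivity, fun y h0 h1 => ?_⟩
    rw [pow_succ]
    refine (mul_le_mul_of_nonneg_right (h y h0 h1) (by linarith)).trans ?_
    push_cast
    have h3 : C * y ^ 4 ≤ C * y ^ 3 :=
      mul_le_mul_of_nonneg_left (pow_le_pow_of_le_one h0 h1 (by norm_num)) hC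
    have h4 : 0 ≤ (n : ℝ) ^ 2 * y ^ 3 := by positivity
    have h5 : 0 ≤ (n : ℝ) * y ^ 3 := by positivity
    nlinarith

variable {V Ω : Type*} [Fintype V] [DecidableEq V] [MeasurableSpace Ω] {r p : ℕ}
  {G : SimpleGraph Ω} {μ : Measure Ω} [IsProbabilityMeasure μ]

theorem integral_pointDensity (hG : MeasurableAdj G) :
    ∫ x, pointDensity V r p G μ x ∂μ = Fintype.card V * blowupDensity V r p G μ := by
  have h := sum_pi_update_real (V := V) (r := r) (p := p) (μ := μ) hG μ
  simp only [Function.update_eq_self] at h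
  rw [← h]
  simp [blowupDensity]

/-- Integrating out the second prescribed coordinate leaves the first, and that second coordinate
has one position fewer to choose from. -/
theorem integral_pairDensity (hG : MeasurableAdj G) (x : Ω) :
    ∫ z, pairDensity V r p G μ x z ∂μ = (Fintype.card V - 1) * pointDensity V r p G μ x := by
  have hm : ∀ u v : V, MeasurableSet {y : Ω × (V → Ω) |
      Function.update (Function.update y.2 u x) v y.1 ∈ balancedTuples V r p G} := by
    intro u v
    have : Measurable fun y : Ω × (V → Ω) => ((x, y.1), y.2) := by fun_prop
    exact this (measurableSet_update_update hG u v)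
  have h1 : ∀ u v : V, v ≠ u → ∫ z, (Measure.pi fun _ : V => μ).real
      {t | Function.update (Function.update t u x) v z ∈ balancedTuples V r p G} ∂μ =
      (Measure.pi fun _ : V => μ).real {t | Function.update t u x ∈ balancedTuples V r p G} := by
    intro u v hvu
    have h2 := prod_real_apply μ (Measure.pi fun _ : V => μ) (hm u v)
    have h3 := pi_update_eq_map (fun _ : V => μ) v μ
    rw [Function.update_eq_self] at h3
    have h4 : MeasurableSet {t : V → Ω | Function.update t u x ∈ balancedTuples V r p G} := by
      have : Measurable fun t : V → Ω => (x, t) := by fun_prop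
      exact this (measurableSet_update hG u)
    conv_rhs => rw [h3, measureReal_def, Measure.map_apply (measurable_update_prod v) h4]
    rw [← measureReal_def]
    refine h2.symm.trans ?_
    congr 1
    ext y
    simp only [Set.mem_preimage, Set.mem_ofPred_eq]
    rw [Function.update_comm hvu]
  have hint : ∀ u v : V, Integrable (fun z : Ω => (Measure.pi fun _ : V => μ).real
      {t | Function.update (Function.update t u x) v z ∈ balancedTuples V r p G}) μ := fun u v =>
    Integrable.of_bound (measurable_measure_prodMk_left
      (hm u v)).ennreal_toReal.aestronglyMeasurable 1
      (Eventually.of_forall fun x => by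
        rw [Real.norm_of_nonneg measureReal_nonneg]
        exact measureReal_le_one)
  simp only [pairDensity, pointDensity]
  rw [integral_finsetSum _ fun u _ => integrable_finsetSum _ fun v _ => hint u v, Finset.mul_sum]
  refine Finset.sum_congr rfl fun u _ => ?_
  rw [integral_finsetSum _ fun v _ => hint u v,
    Finset.sum_congr rfl fun v hv => h1 u v (Finset.ne_of_mem_erase hv), Finset.sum_const,
    Finset.card_erase_of_mem (Finset.mem_univ u), Finset.card_univ, nsmul_eq_mul,
    Nat.cast_sub (Fintype.card_pos_iff.2 ⟨u⟩), Nat.cast_one]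

end Perturbation

section CliqueFree

variable {Ω : Type*} [MeasurableSpace Ω] {G : SimpleGraph Ω} {ν : Measure Ω} {j : ℕ}

theorem AECliqueFree.mono [IsFiniteMeasure ν] (h : AECliqueFree G ν j) {ν' : Measure Ω}
    (hν : ν' ≤ ν) : AECliqueFree G ν' j :=
  h.of_absolutelyContinuous (pi_le_of_le hν).absolutelyContinuous

theorem AECliqueFree.smul [IsFiniteMeasure ν] (h : AECliqueFree G ν j) (a : ℝ≥0) :
    AECliqueFree G (a • ν) j := by
  refine h.of_absolutelyContinuous ?_
  have := pi_sum_smul (V := Fin j) (J := Unit) (fun _ => a) (fun _ => ν)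
  simp only [Finset.univ_unique, Finset.sum_singleton] at this
  rw [this]
  exact Measure.smul_absolutelyContinuous

/-- Adding an atom at a generic point creates no cliques. -/
theorem AECliqueFree.ae_add_dirac [MeasurableSingletonClass Ω] [IsFiniteMeasure ν]
    (hG : MeasurableAdj G) (h : AECliqueFree G ν j) :
    ∀ᵐ x ∂ν, AECliqueFree G (ν + Measure.dirac x) j := by
  have h1 : ∀ᵐ x ∂ν, ∀ u : Fin j, ∀ᵐ t ∂Measure.pi
      (Function.update (fun _ : Fin j => ν) u (Measure.dirac x)), G.comap t ≠ ⊤ := by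
    rw [ae_all_iff]
    intro u
    rcases isEmpty_or_nonempty Ω with hΩ | ⟨⟨x₀⟩⟩
    · exact Eventually.of_forall fun x => hΩ.elim x
    have hms : MeasurableSet {t : Fin j → Ω | G.comap t ≠ ⊤} :=
      hG.measurableSet_comap fun H => H ≠ ⊤
    set m : Fin j → Measure Ω := Function.update (fun _ => ν) u (Measure.dirac x₀) with hm
    have inst : ∀ v, IsFiniteMeasure (m v) := by
      intro v
      by_cases hv : v = u
      · subst hv; rw [hm, Function.update_self]; infer_instance
      · rw [hm, Function.update_of_ne hv]; infer_instance
    have inst' : IsProbabilityMeasure (m u) := by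
      rw [hm, Function.update_self]; infer_instance
    have h2 := pi_update_eq_map m u ν
    rw [hm, Function.update_idem, Function.update_eq_self, ← hm] at h2
    rw [AECliqueFree, h2, ae_map_iff (measurable_update_prod u).aemeasurable hms] at h
    filter_upwards [Measure.ae_ae_of_ae_prod h] with x hx
    have h3 := pi_map_update m u x
    rw [measure_univ, one_smul, hm, Function.update_idem, ← hm] at h3
    have hmeas : Measurable fun t : Fin j → Ω => Function.update t u x :=
      (measurable_update_prod u).comp (measurable_const.prodMk measurable_id)
    rw [← h3, ae_map_iff hmeas.aemeasurable hms]
    exact hx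
  filter_upwards [h1] with x hx
  have h4 := pi_add_smul (V := Fin j) ν (Measure.dirac x) 1
  simp only [one_smul, one_pow] at h4
  rw [AECliqueFree, h4]
  have inst : ∀ T : Finset (Fin j), ∀ v, IsFiniteMeasure (if v ∈ T then Measure.dirac x else ν) := by
    intro T v
    split_ifs <;> infer_instance
  rw [ae_finsetSum_measure_iff]
  intro T _
  rcases Nat.lt_or_ge 1 T.card with hT | hT
  -- Two coordinates at the same point are non-adjacent, so at most one coordinate of a clique can
  -- use the new atom.
  · obtain ⟨a, ha, b, hb, hab⟩ := Finset.one_lt_card.1 hT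
    have h5 : ∀ᵐ t ∂Measure.pi fun v => (if v ∈ T then Measure.dirac x else ν),
        ∀ v, v ∈ T → t v = x := by
      refine ae_pi_forall (P := fun v y => v ∈ T → y = x) fun v => ?_
      by_cases hv : v ∈ T
      · simp only [hv, if_true, forall_const]
        rw [ae_dirac_eq]
        simp
      · simp [hv]
    filter_upwards [h5] with t ht htop
    have : (G.comap t).Adj a b := by rw [htop]; exact hab
    rw [SimpleGraph.comap_adj, ht a ha, ht b hb] at this
    exact G.irrefl this
  · rcases Nat.le_one_iff_eq_zero_or_eq_one.1 hT with h0 | h0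
    · rw [Finset.card_eq_zero] at h0
      simpa [h0, AECliqueFree] using h
    · obtain ⟨u, rfl⟩ := Finset.card_eq_one.1 h0
      convert hx u using 3
      funext v
      by_cases hv : v = u
      · subst hv; simp
      · simp [hv]

end CliqueFree

/-! ### First- and second-order conditions at an extremal measure -/

section Extremal

variable {Ω : Type*} [MeasurableSpace Ω] {s r p : ℕ} {K : Set ℕ} {c : ℝ} {G : SimpleGraph Ω}
  {μ : Measure Ω} [IsProbabilityMeasure μ]

/-- The measure `μ` sees no cliques of `G` with size in `K`, and it has the greatest density `c`
among all these measures. -/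
structure IsExtremal (s r p : ℕ) (K : Set ℕ) (c : ℝ) (G : SimpleGraph Ω) (μ : Measure Ω) :
    Prop where
  measurableAdj : MeasurableAdj G
  cliqueFree : ∀ j ∈ K, AECliqueFree G μ j
  eq : blowupDensity (Fin s) r p G μ = c
  le : ∀ ν : Measure Ω, IsFiniteMeasure ν → (∀ j ∈ K, AECliqueFree G ν j) →
    blowupDensity (Fin s) r p G ν ≤ c * ν.real Set.univ ^ s
  pos : 0 < c

namespace IsExtremal

/-- The expansion from below meets the homogeneous upper bound at `μ + ε • ν`. Clique-freeness is
needed only at `ε = 1`, because smaller perturbations are dominated. -/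
theorem expansion_le (h : IsExtremal s r p K c G μ) {ν : Measure Ω} [IsFiniteMeasure ν]
    (hν : ∀ j ∈ K, AECliqueFree G (μ + ν) j) {ε : ℝ} (h0 : 0 ≤ ε) (h1 : ε ≤ 1) :
    c + ε * ∫ x, pointDensity (Fin s) r p G μ x ∂ν +
      ε ^ 2 * ((∫ z, pairDensity (Fin s) r p G μ z.1 z.2 ∂(ν.prod ν)) / 2) ≤
      c * (1 + ε * ν.real Set.univ) ^ s := by
  lift ε to ℝ≥0 using h0
  have h2 := le_blowupDensity_add_smul (V := Fin s) (r := r) (p := p) (μ := μ) h.measurableAdj ν ε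
  rw [h.eq] at h2
  refine h2.trans ((h.le _ inferInstance fun j hj => (hν j hj).mono ?_).trans_eq ?_)
  · refine add_le_add le_rfl ?_
    refine Measure.le_iff.2 fun A _ => ?_
    rw [Measure.smul_apply, ENNReal.smul_def, smul_eq_mul]
    exact mul_le_of_le_one_left zero_le (by exact_mod_cast h1)
  · rw [measureReal_add_apply, measureReal_nnreal_smul_apply, probReal_univ]

/-- Comparison of the terms of order `ε`. -/
theorem integral_pointDensity_le (h : IsExtremal s r p K c G μ) {ν : Measure Ω}
    [IsFiniteMeasure ν] (hν1 : ν.real Set.univ ≤ 1) (hν : ∀ j ∈ K, AECliqueFree G (μ + ν) j) :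
    ∫ x, pointDensity (Fin s) r p G μ x ∂ν ≤ s * c * ν.real Set.univ := by
  obtain ⟨C, hC, hle⟩ := exists_one_add_pow_le s
  set N := ν.real Set.univ with hN
  have hN0 : 0 ≤ N := measureReal_nonneg
  rw [← sub_nonpos]
  refine nonpos_of_forall_le_mul (K := c * (s ^ 2 + C)) fun ε h0 h1 => ?_
  have h2 := h.expansion_le hν h0.le h1
  have h3 := hle (ε * N) (by positivity) (by nlinarith)
  have h4 : 0 ≤ ∫ z, pairDensity (Fin s) r p G μ z.1 z.2 ∂(ν.prod ν) :=
    integral_nonneg fun z => pairDensity_nonneg _ _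
  have h5 : (1 + ε * N) ^ s ≤ 1 + s * (ε * N) + (s ^ 2 + C) * ε ^ 2 := by
    refine h3.trans ?_
    have h6 : (ε * N) ^ 2 ≤ ε ^ 2 := pow_le_pow_left₀ (by positivity) (by nlinarith) 2
    have h7 : (ε * N) ^ 3 ≤ ε ^ 2 := by
      refine le_trans ?_ h6
      exact pow_le_pow_of_le_one (by positivity) (by nlinarith) (by norm_num)
    have h8 : (s : ℝ) * (s - 1) / 2 * (ε * N) ^ 2 ≤ s ^ 2 * ε ^ 2 := by
      have h9 : (s : ℝ) * (s - 1) / 2 ≤ s ^ 2 := by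
        have : (0 : ℝ) ≤ s := by positivity
        nlinarith
      refine (mul_le_mul_of_nonneg_right h9 (by positivity)).trans ?_
      exact mul_le_mul_of_nonneg_left h6 (by positivity)
    nlinarith
  have h6 := mul_le_mul_of_nonneg_left h5 h.pos.le
  have h7 : ε * (∫ x, pointDensity (Fin s) r p G μ x ∂ν - s * c * N) ≤
      ε * (ε * (c * (s ^ 2 + C))) := by
    have : 0 ≤ ε ^ 2 * ((∫ z, pairDensity (Fin s) r p G μ z.1 z.2 ∂(ν.prod ν)) / 2) := by positivity
    nlinarith
  exact le_of_mul_le_mul_left h7 h0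

/-- When the terms of order `ε` agree, those of order `ε^2` can be compared. -/
theorem integral_pairDensity_le (h : IsExtremal s r p K c G μ) {ν : Measure Ω}
    [IsProbabilityMeasure ν] (hν : ∀ j ∈ K, AECliqueFree G (μ + ν) j)
    (hν1 : ∫ x, pointDensity (Fin s) r p G μ x ∂ν = s * c) :
    ∫ z, pairDensity (Fin s) r p G μ z.1 z.2 ∂(ν.prod ν) ≤ s * (s - 1) * c := by
  obtain ⟨C, hC, hle⟩ := exists_one_add_pow_le s
  rw [← sub_nonpos]
  refine nonpos_of_forall_le_mul (K := 2 * c * C) fun ε h0 h1 => ?_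
  have h2 := h.expansion_le hν h0.le h1
  rw [hν1, probReal_univ, mul_one] at h2
  have h6 := mul_le_mul_of_nonneg_left (hle ε h0.le h1) h.pos.le
  have h7 : ε ^ 2 * (∫ z, pairDensity (Fin s) r p G μ z.1 z.2 ∂(ν.prod ν) - s * (s - 1) * c) ≤
      ε ^ 2 * (ε * (2 * c * C)) := by
    linarith
  exact le_of_mul_le_mul_left h7 (by positivity)

theorem ae_add_dirac [MeasurableSingletonClass Ω] (h : IsExtremal s r p K c G μ) :
    ∀ᵐ x ∂μ, ∀ j ∈ K, AECliqueFree G (μ + Measure.dirac x) j :=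
  (ae_ball_iff K.to_countable).2 fun j hj => (h.cliqueFree j hj).ae_add_dirac h.measurableAdj

theorem ae_add_dirac_add_dirac [MeasurableSingletonClass Ω] (h : IsExtremal s r p K c G μ) :
    ∀ᵐ x ∂μ, ∀ᵐ y ∂μ, ∀ j ∈ K, AECliqueFree G (μ + Measure.dirac x + Measure.dirac y) j := by
  filter_upwards [h.ae_add_dirac] with x hx
  rw [ae_ball_iff K.to_countable]
  intro j hj
  exact ae_mono (Measure.le_add_right le_rfl) ((hx j hj).ae_add_dirac h.measurableAdj)

theorem cliqueFree_of_le_smul (h : IsExtremal s r p K c G μ) {ν : Measure Ω} {a : ℝ≥0}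
    (hν : ν ≤ a • μ) : ∀ j ∈ K, AECliqueFree G ν j := fun j hj =>
  ((h.cliqueFree j hj).smul a).mono hν

/-- Testing with restrictions of `μ` gives `≤` almost everywhere. The mean of the point density is
already `s * c`, so equality holds. -/
theorem ae_pointDensity_eq (h : IsExtremal s r p K c G μ) :
    ∀ᵐ x ∂μ, pointDensity (Fin s) r p G μ x = s * c := by
  have hint := integrable_pointDensity (V := Fin s) (r := r) (p := p) (μ := μ) h.measurableAdj μ
  have hle : ∀ᵐ x ∂μ, pointDensity (Fin s) r p G μ x ≤ s * c := by
    refine ae_le_of_forall_setIntegral_le hint (integrable_const _) fun A hA _ => ?_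
    have h1 := h.integral_pointDensity_le (ν := μ.restrict A) (by
      rw [measureReal_restrict_apply_univ]
      exact measureReal_le_one) (h.cliqueFree_of_le_smul (a := 2) (by
        rw [two_smul]
        exact add_le_add le_rfl Measure.restrict_le_self))
    refine h1.trans_eq ?_
    rw [measureReal_restrict_apply_univ, setIntegral_const, smul_eq_mul, mul_comm]
  have h0 : ∫ x, (s * c - pointDensity (Fin s) r p G μ x) ∂μ = 0 := by
    rw [integral_sub (integrable_const _) hint, integral_pointDensity h.measurableAdj, h.eq]
    simp
  have h1 := (integral_eq_zero_iff_of_nonneg_ae (by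
    filter_upwards [hle] with x hx
    simpa using hx) ((integrable_const _).sub hint)).1 h0
  filter_upwards [h1] with x hx
  simp only [Pi.sub_apply, Pi.zero_apply] at hx
  linarith

/-- The second order condition at an extremal measure. -/
theorem ae_pairDensity_add_le [MeasurableSingletonClass Ω] [MeasurableSpace.CountablyGenerated Ω]
    (h : IsExtremal s r p K c G μ) : ∀ᵐ x ∂μ, ∀ᵐ z ∂μ,
      pairDensity (Fin s) r p G μ x x + pairDensity (Fin s) r p G μ z z ≤
        2 * pairDensity (Fin s) r p G μ x z := by
  have hC : ∀ x z, |pairDensity (Fin s) r p G μ x z| ≤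
      Fintype.card (Fin s) * Fintype.card (Fin s) := fun x z => by
    rw [abs_of_nonneg (pairDensity_nonneg _ _)]
    exact pairDensity_le _ _
  refine ae_add_le_two_mul_of_concentrate (measurable_pairDensity h.measurableAdj) hC
    fun A hA => ?_
  -- The pair kernel has constant row integrals, so in the energy of the concentrated measure this
  -- constant cancels the second-order bound.
  have hM : ∀ᵐ x ∂μ, ∫ z, pairDensity (Fin s) r p G μ x z ∂μ = s * (s - 1) * c := by
    filter_upwards [h.ae_pointDensity_eq] with x hx
    rw [integral_pairDensity h.measurableAdj, hx, Fintype.card_fin]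
    ring
  filter_upwards [h.ae_pointDensity_eq, hM, h.ae_add_dirac] with x hx1 hxM hx2
  set a : ℝ≥0 := (μ A).toNNReal with ha
  have ha' : (a : ℝ≥0∞) = μ A := ENNReal.coe_toNNReal (measure_ne_top _ _)
  have ha1 : a ≤ 1 := by
    rw [← ENNReal.coe_le_coe, ha']
    exact prob_le_one
  set ν := a • Measure.dirac x + μ.restrict Aᶜ with hν
  have inst : IsProbabilityMeasure ν := ⟨by
    rw [hν, Measure.add_apply, Measure.smul_apply, Measure.restrict_apply_univ, measure_univ,
      ENNReal.smul_def, smul_eq_mul, mul_one, ha', measure_add_measure_compl hA, measure_univ]⟩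
  have h1 : ∫ x, pointDensity (Fin s) r p G μ x ∂ν = s * c := by
    have hd : ∀ᵐ y ∂(Measure.dirac x), pointDensity (Fin s) r p G μ y = s * c := by
      rw [ae_dirac_eq]; exact hx1
    have : ∀ᵐ y ∂ν, pointDensity (Fin s) r p G μ y = s * c := by
      rw [hν, ae_add_measure_iff]
      exact ⟨Measure.smul_absolutelyContinuous.ae_le hd, ae_restrict_of_ae h.ae_pointDensity_eq⟩
    rw [integral_congr_ae this]
    simp
  have hfree : ∀ j ∈ K, AECliqueFree G (μ + ν) j := by
    intro j hj
    -- The sum `μ + ν` is dominated by `2 • (μ + Measure.dirac x)`, which creates no forbidden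
    -- clique for generic `x`.
    refine ((hx2 j hj).smul 2).mono ?_
    rw [two_smul, hν, add_comm (a • _)]
    refine add_le_add (Measure.le_add_right le_rfl) (add_le_add Measure.restrict_le_self ?_)
    refine Measure.le_iff.2 fun B _ => ?_
    rw [Measure.smul_apply, ENNReal.smul_def, smul_eq_mul]
    exact mul_le_of_le_one_left zero_le (by exact_mod_cast ha1)
  have h2 := h.integral_pairDensity_le hfree h1
  rw [integral_prod_concentrate (measurable_pairDensity h.measurableAdj) hC
    (fun x z => pairDensity_comm x z) hM hA hxM (a := a) rfl hν] at h2
  linarith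

end IsExtremal

end Extremal

end Inducibility

/-! ### Transitivity of non-adjacency at generic triples -/

namespace Inducibility

open scoped NNReal ENNReal

theorem IsBalanced.exists_adj {V : Type*} [Fintype V] {r p : ℕ} {H : SimpleGraph V}
    (h : IsBalanced r p H) (hp : 1 ≤ p) (hr : 2 ≤ r) (u : V) : ∃ v, H.Adj u v := by
  obtain ⟨f, hf, hcard⟩ := h
  have : Nontrivial (Fin r) := Fin.nontrivial_iff_two_le.2 hr
  obtain ⟨i, hi⟩ := exists_ne (f u)
  have hpos : 0 < Nat.card {v // f v = i} := by
    rcases hcard i with h | h <;> omega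
  obtain ⟨⟨v, hv⟩⟩ := (Nat.card_pos_iff.1 hpos).1
  exact ⟨v, (hf u v).2 (by rw [hv]; exact hi.symm)⟩

theorem IsBalanced.not_adj_trans {V : Type*} [Fintype V] {r p : ℕ} {H : SimpleGraph V}
    (h : IsBalanced r p H) {u v w : V} (h1 : ¬H.Adj u v) (h2 : ¬H.Adj v w) : ¬H.Adj u w := by
  obtain ⟨f, hf, -⟩ := h
  rw [hf, not_not] at *
  exact h1.trans h2

section

variable {V Ω : Type*} [Fintype V] [DecidableEq V] [MeasurableSpace Ω] {μ : Measure Ω}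
  [IsProbabilityMeasure μ]

theorem ae_ae_update {P : (V → Ω) → Prop} (h : ∀ᵐ t ∂Measure.pi fun _ : V => μ, P t) (v : V) :
    ∀ᵐ y ∂μ, ∀ᵐ t ∂Measure.pi fun _ : V => μ, P (Function.update t v y) := by
  have h1 := pi_update_eq_map (fun _ : V => μ) v μ
  rw [Function.update_eq_self] at h1
  rw [h1] at h
  exact Measure.ae_ae_of_ae_prod (ae_of_ae_map (measurable_update_prod v).aemeasurable h)

/-- By Fubini, a measurable relation at almost all triples may be used in several orders of its
points at once. -/
theorem ae_ae_ae_perm {R : Ω → Ω → Ω → Prop}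
    (hR : MeasurableSet {q : Ω × Ω × Ω | R q.1 q.2.1 q.2.2})
    (h : ∀ᵐ x ∂μ, ∀ᵐ y ∂μ, ∀ᵐ z ∂μ, R x y z) :
    ∀ᵐ x ∂μ, ∀ᵐ y ∂μ, ∀ᵐ z ∂μ, R x y z ∧ R x z y ∧ R y x z := by
  have hx : ∀ x, MeasurableSet {q : Ω × Ω | R x q.1 q.2} := fun x => measurable_prodMk_left hR
  have h1 : ∀ᵐ q ∂μ.prod (μ.prod μ), R q.1 q.2.1 q.2.2 := by
    refine (Measure.ae_prod_iff_ae_ae hR).2 ?_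
    filter_upwards [h] with x h
    exact (Measure.ae_prod_iff_ae_ae (hx x)).2 h
  rw [← Measure.prodAssoc_prod] at h1
  have h2 : ∀ᵐ q ∂μ.prod μ, ∀ᵐ z ∂μ, R q.1 q.2 z := Measure.ae_ae_of_ae_prod
    (ae_of_ae_map MeasurableEquiv.prodAssoc.measurable.aemeasurable h1)
  have h3 : ∀ᵐ q ∂μ.prod μ, ∀ᵐ z ∂μ, R q.2 q.1 z :=
    Measure.measurePreserving_swap.quasiMeasurePreserving.ae h2
  filter_upwards [h, Measure.ae_ae_of_ae_prod h3] with x hx1 hx3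
  filter_upwards [hx1, (Measure.ae_ae_comm (hx x)).1 hx1, hx3] with y hy1 hy2 hy3
  filter_upwards [hy1, hy2, hy3] with z hz1 hz2 hz3
  exact ⟨hz1, hz2, hz3⟩

end

namespace IsExtremal

variable {Ω : Type*} [MeasurableSpace Ω] [MeasurableSingletonClass Ω]
  [MeasurableSpace.CountablyGenerated Ω] {s r p : ℕ} {K : Set ℕ} {c : ℝ} {G : SimpleGraph Ω}
  {μ : Measure Ω} [IsProbabilityMeasure μ]

-- Overwriting `z` by its non-neighbour `x` produces a twin. Hence `pairDensity` at `(x, z)` is at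
-- most its value at `(x, x)`.
omit [MeasurableSpace Ω] [MeasurableSingletonClass Ω] [MeasurableSpace.CountablyGenerated Ω] in
theorem update_subset {x z : Ω} (hxz : ¬G.Adj x z) {u v : Fin s} (huv : v ≠ u) :
    {t | Function.update (Function.update t u x) v z ∈ balancedTuples (Fin s) r p G} ⊆
    {t | Function.update (Function.update t u x) v x ∈ balancedTuples (Fin s) r p G} := by
  intro t ht
  simp only [balancedTuples, Set.mem_ofPred_eq] at ht ⊢
  have := ht.update_of_not_adj (v := u) (w := v) (by
    rw [Function.update_self, Function.update_of_ne huv.symm, Function.update_self]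
    exact hxz)
  rwa [Function.update_idem, Function.update_of_ne huv.symm, Function.update_self] at this

/-- At a generic non-adjacent pair, exchanging one of two equal coordinates for the other point of
the pair keeps a tuple balanced. -/
theorem ae_update_of_not_adj (h : IsExtremal s r p K c G μ) : ∀ᵐ x ∂μ, ∀ᵐ z ∂μ, ¬G.Adj x z →
    ∀ u v : Fin s, v ≠ u → ∀ᵐ t ∂Measure.pi fun _ : Fin s => μ,
      Function.update (Function.update t u x) v x ∈ balancedTuples (Fin s) r p G →
      Function.update (Function.update t u x) v z ∈ balancedTuples (Fin s) r p G := by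
  filter_upwards [h.ae_pairDensity_add_le] with x hx
  filter_upwards [hx] with z hz hxz u v huv
  have hle : ∀ x z : Ω, ¬G.Adj x z → pairDensity (Fin s) r p G μ x z ≤
      pairDensity (Fin s) r p G μ x x := fun x z hxz =>
    Finset.sum_le_sum fun u _ => Finset.sum_le_sum fun v hv =>
      measureReal_mono (update_subset hxz (Finset.ne_of_mem_erase hv)) (measure_ne_top _ _)
  have h1 := hle x z hxz
  have h2 := hle z x fun h => hxz h.symm
  rw [pairDensity_comm z x] at h2
  -- Cloning bounds `k(x,z)` by both `k(x,x)` and `k(z,z)`, so the second-order condition makes all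
  -- three equal, and then equality holds term by term.
  have h3 : pairDensity (Fin s) r p G μ x z = pairDensity (Fin s) r p G μ x x := by linarith
  have hle' : ∀ u' : Fin s, ∀ v' ∈ Finset.univ.erase u', (Measure.pi fun _ : Fin s => μ).real
      {t | Function.update (Function.update t u' x) v' z ∈ balancedTuples (Fin s) r p G} ≤
      (Measure.pi fun _ : Fin s => μ).real
      {t | Function.update (Function.update t u' x) v' x ∈ balancedTuples (Fin s) r p G} :=
    fun u' v' hv => measureReal_mono (update_subset hxz (Finset.ne_of_mem_erase hv))
      (measure_ne_top _ _)
  have h4 := (Finset.sum_eq_sum_iff_of_le fun u' _ => Finset.sum_le_sum (hle' u')).1 h3 u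
    (Finset.mem_univ u)
  have h5 := (Finset.sum_eq_sum_iff_of_le (hle' u)).1 h4 v
    (Finset.mem_erase.2 ⟨huv, Finset.mem_univ v⟩)
  have hms : MeasurableSet
      {t : Fin s → Ω | Function.update (Function.update t u x) v z ∈
        balancedTuples (Fin s) r p G} := by
    have : Measurable fun t : Fin s → Ω => ((x, z), t) := by fun_prop
    exact this (measurableSet_update_update h.measurableAdj u v)
  have h6 := measureReal_sdiff (μ := Measure.pi fun _ : Fin s => μ)
    (update_subset (r := r) (p := p) hxz huv) hms
  rw [h5, sub_self, measureReal_eq_zero_iff] at h6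
  rw [ae_iff]
  refine (congrArg _ ?_).trans h6
  ext t
  simp

-- The point density at `x` is positive, so there are balanced tuples through `x`; cloning `x` in
-- them gives balanced tuples with `x` twice.
omit [MeasurableSingletonClass Ω] [MeasurableSpace.CountablyGenerated Ω] in
theorem ae_pairDensity_self_pos (h : IsExtremal s r p K c G μ) (hp : 1 ≤ p) (hr : 2 ≤ r)
    (hrs : r < s) : ∀ᵐ x ∂μ, 0 < pairDensity (Fin s) r p G μ x x := by
  filter_upwards [h.ae_pointDensity_eq] with x hx
  refine lt_of_le_of_ne (pairDensity_nonneg _ _) fun h0 => ?_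
  have hs : 0 < s := by omega
  have hne : pointDensity (Fin s) r p G μ x ≠ 0 := by
    rw [hx]
    have := h.pos
    positivity
  refine hne (Finset.sum_eq_zero fun u _ => ?_)
  have h1 : ∀ u v : Fin s, v ≠ u → ∀ᵐ t ∂Measure.pi fun _ : Fin s => μ,
      Function.update (Function.update t u x) v x ∉ balancedTuples (Fin s) r p G := by
    intro u v huv
    have h2 := (Finset.sum_eq_zero_iff_of_nonneg fun u' _ => Finset.sum_nonneg fun v' _ =>
      measureReal_nonneg).1 h0.symm u (Finset.mem_univ u)
    have h3 := (Finset.sum_eq_zero_iff_of_nonneg fun v' _ => measureReal_nonneg).1 h2 v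
      (Finset.mem_erase.2 ⟨huv, Finset.mem_univ v⟩)
    rw [measureReal_eq_zero_iff] at h3
    simpa [ae_iff] using h3
  rw [measureReal_eq_zero_iff]
  have h4 : ∀ᵐ t ∂Measure.pi fun _ : Fin s => μ,
      Function.update t u x ∉ balancedTuples (Fin s) r p G := by
    have h5 : ∀ᵐ t ∂Measure.pi fun _ : Fin s => μ, ∀ v, v ≠ u →
        Function.update (Function.update t u x) v x ∉ balancedTuples (Fin s) r p G := by
      rw [ae_all_iff]
      exact fun v => eventually_imp_distrib_left.2 (h1 u v)
    filter_upwards [h5] with t ht hbal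
    obtain ⟨b, hb⟩ := IsBalanced.exists_adj hbal hp hr u
    obtain ⟨v, hvu, -, hv⟩ := IsBalanced.exists_update hbal hp (by simpa using hrs) hb
    rw [Function.update_self] at hv
    exact ht v hvu hv
  simpa [ae_iff] using h4

/-- Non-adjacency is transitive at generic triples. -/
theorem ae_not_adj_trans (h : IsExtremal s r p K c G μ) (hp : 1 ≤ p) (hr : 2 ≤ r)
    (hrs : r < s) : ∀ᵐ x ∂μ, ∀ᵐ z ∂μ, ∀ᵐ y ∂μ, ¬G.Adj x z → ¬G.Adj z y → ¬G.Adj x y := by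
  filter_upwards [h.ae_update_of_not_adj, h.ae_pairDensity_self_pos hp hr hrs,
    h.ae_pairDensity_add_le] with x hx1 hx2 hx3
  filter_upwards [hx1] with z hz
  by_cases hxz : G.Adj x z
  · exact Eventually.of_forall fun y h' => absurd hxz h'
  have h1 : ∀ᵐ y ∂μ, ∀ u w : Fin s, w ≠ u → ∀ v : Fin s,
      ∀ᵐ t ∂Measure.pi fun _ : Fin s => μ,
      Function.update (Function.update (Function.update t v y) u x) w x ∈
        balancedTuples (Fin s) r p G →
      Function.update (Function.update (Function.update t v y) u x) w z ∈
        balancedTuples (Fin s) r p G := by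
    rw [ae_all_iff]
    intro u
    rw [ae_all_iff]
    intro w
    rw [eventually_imp_distrib_left]
    intro hwu
    rw [ae_all_iff]
    intro v
    exact ae_ae_update (hz hxz u w hwu) v
  filter_upwards [hx3, h1] with y hy3 hy1 _ hzy hxy
  -- In a balanced tuple through adjacent `x` and `y`, clone `x` at a third coordinate `w`, then
  -- exchange the clone for `z`. The result would be balanced with `x`, `z` and `z`, `y`
  -- non-adjacent but `x`, `y` adjacent. So `k(x,y) = 0`, against `0 < k(x,x) ≤ 2k(x,y)`.
  have h0 : pairDensity (Fin s) r p G μ x y = 0 := by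
    refine Finset.sum_eq_zero fun u _ => Finset.sum_eq_zero fun v hv => ?_
    have hvu := Finset.ne_of_mem_erase hv
    rw [measureReal_eq_zero_iff]
    have h2 : ∀ᵐ t ∂Measure.pi fun _ : Fin s => μ, ∀ w, w ≠ u →
        (Function.update (Function.update (Function.update t v y) u x) w x ∈
          balancedTuples (Fin s) r p G →
        Function.update (Function.update (Function.update t v y) u x) w z ∈
          balancedTuples (Fin s) r p G) := by
      rw [ae_all_iff]
      exact fun w => eventually_imp_distrib_left.2 fun hwu => hy1 u w hwu v
    have h4 : ∀ᵐ t ∂Measure.pi fun _ : Fin s => μ,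
        Function.update (Function.update t u x) v y ∉ balancedTuples (Fin s) r p G := by
      filter_upwards [h2] with t ht hbal
      rw [Function.update_comm hvu.symm] at hbal
      have eu : Function.update (Function.update t v y) u x u = x := Function.update_self _ _ _
      have ev : Function.update (Function.update t v y) u x v = y := by
        rw [Function.update_of_ne hvu, Function.update_self]
      obtain ⟨w, hwu, hwv, hw⟩ := IsBalanced.exists_update hbal hp (by simpa using hrs)
        (a := u) (b := v) (by rw [eu, ev]; exact hxy)
      rw [eu] at hw
      have h5 : IsBalanced r p (G.comap
        (Function.update (Function.update (Function.update t v y) u x) w z)) := ht w hwu hw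
      have h6 := h5.not_adj_trans (u := u) (v := w) (w := v) (by
        rw [SimpleGraph.comap_adj, Function.update_self, Function.update_of_ne hwu.symm, eu]
        exact hxz) (by
        rw [SimpleGraph.comap_adj, Function.update_self, Function.update_of_ne hwv.symm, ev]
        exact hzy)
      rw [SimpleGraph.comap_adj, Function.update_of_ne hwv.symm, Function.update_of_ne hwu.symm,
        eu, ev] at h6
      exact h6 hxy
    simpa [ae_iff] using h4
  have h7 := pairDensity_nonneg (V := Fin s) (r := r) (p := p) (G := G) (μ := μ) y y
  linarith

/-- A point at which non-adjacency is transitive, in the strongest sense. -/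
theorem ae_consistent (h : IsExtremal s r p K c G μ) (hp : 1 ≤ p) (hr : 2 ≤ r)
    (hrs : r < s) : ∀ᵐ x ∂μ, ∀ᵐ y ∂μ, ∀ᵐ z ∂μ, (¬G.Adj x y → ¬G.Adj y z → ¬G.Adj x z) ∧
      (¬G.Adj x z → ¬G.Adj z y → ¬G.Adj x y) ∧ (¬G.Adj y x → ¬G.Adj x z → ¬G.Adj y z) := by
  have hG := h.measurableAdj
  have hms : ∀ f g : Ω × Ω × Ω → Ω, Measurable f → Measurable g →
      MeasurableSet {q | ¬G.Adj (f q) (g q)} := fun f g hf hg =>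
    ((hf.prodMk hg) (show MeasurableSet {z : Ω × Ω | G.Adj z.1 z.2} from hG)).compl
  have himp : ∀ A B C : Set (Ω × Ω × Ω), MeasurableSet A → MeasurableSet B → MeasurableSet C →
      MeasurableSet {q | q ∈ A → q ∈ B → q ∈ C} := fun A B C hA hB hC => by
    have : {q | q ∈ A → q ∈ B → q ∈ C} = (A ∩ B)ᶜ ∪ C := by
      ext q
      simp only [Set.mem_ofPred_eq, Set.mem_union, Set.mem_compl_iff, Set.mem_inter_iff]
      tauto
    rw [this]
    exact (hA.inter hB).compl.union hC
  have hS : MeasurableSet {q : Ω × Ω × Ω |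
      ¬G.Adj q.1 q.2.1 → ¬G.Adj q.2.1 q.2.2 → ¬G.Adj q.1 q.2.2} :=
    himp _ _ _ (hms _ _ (by fun_prop) (by fun_prop)) (hms _ _ (by fun_prop) (by fun_prop))
      (hms _ _ (by fun_prop) (by fun_prop))
  exact ae_ae_ae_perm (R := fun x y z => ¬G.Adj x y → ¬G.Adj y z → ¬G.Adj x z) hS
    (h.ae_not_adj_trans hp hr hrs)

end IsExtremal

end Inducibility

namespace Inducibility

open scoped NNReal ENNReal

/-! ### Adjacent atoms of unequal mass are not extremal -/

section PairPolynomial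

variable {s p : ℕ} {c : Fin 6 → ℝ} {C ρ a b : ℝ}

theorem pairPolynomial_comm : pairPolynomial s p c a b ρ = pairPolynomial s p c b a ρ := by
  simp only [pairPolynomial]
  ring

/-- Two adjacent atoms of distinct positive weights are not extremal when parts of an extremal
tuple have at least two elements. -/
theorem pairPolynomial_false_of_two_le (hp2 : 2 ≤ p) (hp3 : p ≤ 3) (hs : s ≠ 0)
    (hc : ∀ i, 0 ≤ c i) (hC : 0 < C) (ha : 0 < a) (hb : 0 < b) (hρ : 0 ≤ ρ)
    (hsum : a + b + ρ = 1) (hab : a ≠ b) (h1 : pairPolynomial s p c a b 1 = C)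
    (h2 : ∀ x y κ : ℝ, 0 ≤ x → 0 ≤ y → 0 ≤ κ →
      pairPolynomial s p c x y κ ≤ C * (x + y + κ * ρ) ^ s) : False := by
  have hu : 0 < a * b := mul_pos ha hb
  have hua : a * b < (a + b) ^ 2 / 4 := by
    have : 0 < (a - b) ^ 2 := by
      have := sub_ne_zero.2 hab
      positivity
    nlinarith
  have h3 := pairPolynomial_chord (s := s) (by omega : 1 ≤ p) hp3 hc ha.le hb.le
  have h4 := h2 (a + b) 0 1 (by positivity) le_rfl zero_le_one
  have h5 := h2 ((a + b) / 2) ((a + b) / 2) 1 (by positivity) (by positivity) zero_le_one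
  have e4 : C * (a + b + 0 + 1 * ρ) ^ s = C := by
    rw [show a + b + 0 + 1 * ρ = 1 by linarith, one_pow, mul_one]
  have e5 : C * ((a + b) / 2 + (a + b) / 2 + 1 * ρ) ^ s = C := by
    rw [show (a + b) / 2 + (a + b) / 2 + 1 * ρ = 1 by linarith, one_pow, mul_one]
  rw [e4] at h4
  rw [e5] at h5
  -- Both ends of the chord are at most `C`, while the value between them is `C`; hence the slack
  -- vanishes and all terms containing `xy` disappear.
  have h6 : chordSlack p c (a + b) (a * b) ≤ 0 := by
    have h7 := mul_le_mul_of_nonneg_left h4 (sq_nonneg (a - b))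
    have h8 := mul_le_mul_of_nonneg_left h5 (show 0 ≤ 4 * (a * b) by positivity)
    rw [h1] at h3
    nlinarith
  have t1 := chord_term_pos hp2 hu hua
  have t2 := chord_term_pos (show 2 ≤ p + 1 by omega) hu hua
  have n1 : 0 ≤ c 3 + c 4 * (a + b) := add_nonneg (hc 3) (mul_nonneg (hc 4) (by positivity))
  rw [chordSlack] at h6
  have z5 : c 5 = 0 := by
    by_contra hne
    have := mul_pos (lt_of_le_of_ne (hc 5) (Ne.symm hne)) t2
    have := mul_nonneg n1 t1.le
    linarith
  have z34 : c 3 + c 4 * (a + b) = 0 := by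
    by_contra hne
    have := mul_pos (lt_of_le_of_ne n1 (Ne.symm hne)) t1
    have := mul_nonneg (hc 5) t2.le
    linarith
  have hpow : ∀ m, 2 ≤ m → a ^ m + b ^ m < (a + b) ^ m := by
    intro m hm
    induction m, hm using Nat.le_induction with
    | base => nlinarith
    | succ m hm ih =>
      have h1 : (a ^ m + b ^ m) * (a + b) < (a + b) ^ (m + 1) := by
        rw [pow_succ]
        exact mul_lt_mul_of_pos_right ih (by positivity)
      refine lt_of_le_of_lt ?_ h1
      have h2 : 0 ≤ a ^ m * b := by positivity
      have h3 : 0 ≤ b ^ m * a := by positivity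
      rw [pow_succ, pow_succ]
      linarith
  have hP : c 0 + c 1 * (a ^ p + b ^ p) + c 2 * (a ^ (p + 1) + b ^ (p + 1)) = C := by
    rw [← h1, pairPolynomial, z5]
    have : c 3 * (a * b) ^ p + c 4 * (a * b) ^ p * (a + b) = 0 := by
      rw [show c 3 * (a * b) ^ p + c 4 * (a * b) ^ p * (a + b) =
        (c 3 + c 4 * (a + b)) * (a * b) ^ p by ring, z34, zero_mul]
    simp only [one_pow, mul_one]
    linarith
  have hP' : c 0 + c 1 * (a + b) ^ p + c 2 * (a + b) ^ (p + 1) ≤ C := by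
    refine le_trans (le_of_eq ?_) h4
    simp [pairPolynomial, show p ≠ 0 by omega]
  have q1 := hpow p hp2
  have q2 := hpow (p + 1) (by omega)
  -- Merging strictly increases power sums of degree at least two, so their coefficients vanish too.
  have z1 : c 1 = 0 := by
    by_contra hne
    have := mul_lt_mul_of_pos_left q1 (lt_of_le_of_ne (hc 1) (Ne.symm hne))
    have := mul_le_mul_of_nonneg_left q2.le (hc 2)
    linarith
  have z2 : c 2 = 0 := by
    by_contra hne
    have := mul_lt_mul_of_pos_left q2 (lt_of_le_of_ne (hc 2) (Ne.symm hne))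
    have := mul_le_mul_of_nonneg_left q1.le (hc 1)
    linarith
  -- Now the atoms contribute nothing; deleting them lowers the total mass below `1` but keeps the
  -- value `C`, a contradiction.
  have hf := h2 0 0 1 le_rfl le_rfl zero_le_one
  rw [z1, z2] at hP
  have hf' : pairPolynomial s p c 0 0 1 = c 0 := by
    simp [pairPolynomial, show p ≠ 0 by omega]
  rw [hf'] at hf
  have : (0 + 0 + 1 * ρ) ^ s < 1 := pow_lt_one₀ (by linarith) (by linarith) hs
  nlinarith

/-- The two sides agree at `ε = 0`, so their slopes there are ordered. -/
theorem mul_add_sq_le_of_tangent {n : ℕ} {A B : ℝ} (hC : 0 < C)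
    (h : ∀ ε : ℝ, 0 ≤ ε → C + A * ε + B * ε ^ 2 ≤ C * (1 + ε) ^ n) : A ≤ n * C := by
  obtain ⟨D, hD, hle⟩ := exists_one_add_pow_le n
  rw [← sub_nonpos]
  refine nonpos_of_forall_le_mul (K := C * (n ^ 2 + D) + |B|) fun ε h0 h1 => ?_
  have h2 := (h ε h0.le).trans (mul_le_mul_of_nonneg_left (hle ε h0.le h1) hC.le)
  have h3 : ε ^ 3 ≤ ε ^ 2 := pow_le_pow_of_le_one h0.le h1 (by norm_num)
  have h4 := mul_le_mul_of_nonneg_left h3 (mul_nonneg hC.le hD)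
  have h5 : -|B| * ε ^ 2 ≤ B * ε ^ 2 :=
    mul_le_mul_of_nonneg_right (neg_abs_le B) (by positivity)
  have h6 : (n : ℝ) * (n - 1) / 2 ≤ n ^ 2 := by
    have : (0 : ℝ) ≤ n := by positivity
    nlinarith
  have h7 := mul_le_mul_of_nonneg_left h6 (show 0 ≤ C * ε ^ 2 by positivity)
  have h8 : ε * (A - n * C) ≤ ε * (ε * (C * (n ^ 2 + D) + |B|)) := by linarith
  exact le_of_mul_le_mul_left h8 h0

/-- Two adjacent atoms of distinct weights are not extremal when the parts of an extremal tuple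
have one or two elements. -/
theorem pairPolynomial_false_of_one (hs : 3 ≤ s)
    (hc : ∀ i, 0 ≤ c i) (hC : 0 < C) (ha : 0 ≤ a) (hb : 0 ≤ b) (hρ : 0 ≤ ρ)
    (hsum : a + b + ρ = 1) (hab : a ≠ b) (h1 : pairPolynomial s 1 c a b 1 = C)
    (h2 : ∀ x y κ : ℝ, 0 ≤ x → 0 ≤ y → 0 ≤ κ →
      pairPolynomial s 1 c x y κ ≤ C * (x + y + κ * ρ) ^ s)
    (h3 : ∀ ε : ℝ, 0 ≤ ε → C + s * C * ε ≤ pairPolynomial s 1 c (a + ε) b 1)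
    (h3' : ∀ ε : ℝ, 0 ≤ ε → C + s * C * ε ≤ pairPolynomial s 1 c a (b + ε) 1)
    (h4 : (c 4 = 0 → c 3 = 0) ∧ (c 2 = 0 → c 1 = 0)) : False := by
  set m := a + b with hm
  have hm0 : 0 < m := by
    rcases ha.lt_or_eq with h | h
    · linarith
    · rcases hb.lt_or_eq with h' | h'
      · linarith
      · exact absurd (h.symm.trans h') hab
  have hP : ∀ x y : ℝ, pairPolynomial s 1 c x y 1 = c 0 + c 1 * (x + y) + c 2 * (x ^ 2 + y ^ 2) +
      c 3 * (x * y) + c 4 * (x * y) * (x + y) + c 5 * (x * y) ^ 2 := by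
    intro x y
    simp [pairPolynomial]
  -- The upper bound and the guaranteed growth at an atom pin its partial derivative to exactly `s *
  -- C`.
  have hder : ∀ x y A B : ℝ, 0 ≤ x → 0 ≤ y → x + y + ρ = 1 → pairPolynomial s 1 c x y 1 = C →
      (∀ ε, pairPolynomial s 1 c (x + ε) y 1 = pairPolynomial s 1 c x y 1 + A * ε + B * ε ^ 2) →
      (∀ ε : ℝ, 0 ≤ ε → C + s * C * ε ≤ pairPolynomial s 1 c (x + ε) y 1) → A = s * C := by
    intro x y A B hx hy hxy hval hA hlow
    refine le_antisymm (mul_add_sq_le_of_tangent (B := B) hC fun ε h0 => ?_) ?_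
    · have := h2 (x + ε) y 1 (by linarith) hy zero_le_one
      rw [hA, hval, show x + ε + y + 1 * ρ = 1 + ε by linarith] at this
      exact this
    · rw [← sub_nonpos]
      refine nonpos_of_forall_le_mul (K := B) fun ε h0 h1 => ?_
      have := hlow ε h0.le
      rw [hA, hval] at this
      have h8 : ε * (s * C - A) ≤ ε * (ε * B) := by nlinarith
      exact le_of_mul_le_mul_left h8 h0
  have d1 := hder a b (c 1 + 2 * c 2 * a + c 3 * b + c 4 * (2 * a * b + b ^ 2) +
    2 * c 5 * a * b ^ 2) (c 2 + c 4 * b + c 5 * b ^ 2) ha hb hsum h1 (fun ε => by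
      rw [hP, hP]; ring) h3
  have d2 := hder b a (c 1 + 2 * c 2 * b + c 3 * a + c 4 * (2 * b * a + a ^ 2) +
    2 * c 5 * b * a ^ 2) (c 2 + c 4 * a + c 5 * a ^ 2) hb ha (by linarith)
    (by rw [pairPolynomial_comm, h1]) (fun ε => by rw [hP, hP]; ring)
    (fun ε h0 => by rw [pairPolynomial_comm]; exact h3' ε h0)
  -- The difference of the two partial derivatives has the factor `b - a`, which is cancelled.
  have hL : c 3 - 2 * c 2 + c 4 * m + 2 * c 5 * (a * b) = 0 := by
    have : (b - a) * (c 3 - 2 * c 2 + c 4 * m + 2 * c 5 * (a * b)) = 0 := by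
      rw [hm]; linarith
    exact (mul_eq_zero.1 this).resolve_left (sub_ne_zero.2 hab.symm)
  -- By `hL`, along the segment `x + y = m` only a square with coefficient `c 5` remains; at the
  -- midpoint it would exceed `C` unless `c 5 = 0`. Then the whole segment consists of maximisers.
  have hval : ∀ x y : ℝ, x + y = m →
      pairPolynomial s 1 c x y 1 = C + c 5 * (x * y - a * b) ^ 2 := by
    intro x y hxy
    have e1 : x ^ 2 + y ^ 2 = m ^ 2 - 2 * (x * y) := by rw [← hxy]; ring
    have e2 : a ^ 2 + b ^ 2 = m ^ 2 - 2 * (a * b) := by rw [hm]; ring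
    rw [← h1, hP, hP, e1, e2, hxy, ← hm]
    have e3 : c 3 = 2 * c 2 - c 4 * m - 2 * c 5 * (a * b) := by linarith
    rw [e3]
    ring
  have z5 : c 5 = 0 := by
    have h5 := h2 (m / 2) (m / 2) 1 (by positivity) (by positivity) zero_le_one
    rw [hval _ _ (by ring), show m / 2 + m / 2 + 1 * ρ = 1 by linarith, one_pow, mul_one] at h5
    have h6 : 0 < (m / 2 * (m / 2) - a * b) ^ 2 := by
      have : m / 2 * (m / 2) - a * b = (a - b) ^ 2 / 4 := by rw [hm]; ring
      rw [this]
      have := sub_ne_zero.2 hab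
      positivity
    by_contra hne
    have := mul_pos (lt_of_le_of_ne (hc 5) (Ne.symm hne)) h6
    linarith
  rw [z5] at hL
  -- Each point of the segment is extremal, so the derivative in the scale `κ` of the remaining
  -- measure is the same all along it.
  have htan : ∀ x y : ℝ, 0 ≤ x → 0 ≤ y → x + y = m →
      s * c 0 + (s - 1 : ℕ) * c 1 * m + (s - 2 : ℕ) * (c 2 * (x ^ 2 + y ^ 2) + c 3 * (x * y)) +
        (s - 3 : ℕ) * c 4 * (x * y) * m = s * C * ρ := by
    intro x y hx hy hxy
    have hd1 : HasDerivAt (fun κ : ℝ => pairPolynomial s 1 c x y κ)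
        (s * c 0 + (s - 1 : ℕ) * c 1 * m + (s - 2 : ℕ) * (c 2 * (x ^ 2 + y ^ 2) + c 3 * (x * y)) +
          (s - 3 : ℕ) * c 4 * (x * y) * m) 1 := by
      have hpw : ∀ n : ℕ, HasDerivAt (fun κ : ℝ => κ ^ n) (n : ℝ) 1 := by
        intro n
        simpa using hasDerivAt_pow n (1 : ℝ)
      have := (((((hpw s).const_mul (c 0)).add (((hpw (s - 1)).const_mul (c 1)).mul_const m)).add
        (((hpw (s - 2)).const_mul (c 2)).mul_const (x ^ 2 + y ^ 2))).add
        (((hpw (s - 2)).const_mul (c 3)).mul_const (x * y))).add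
        (((hpw (s - 3)).const_mul (c 4)).mul_const (x * y * m))
      refine (this.congr_deriv (by ring)).congr_of_eventuallyEq (Eventually.of_forall fun κ => ?_)
      simp only [pairPolynomial, z5, pow_one, Pi.add_apply, ← hxy]
      ring
    have hd2 : HasDerivAt (fun κ : ℝ => C * (x + y + κ * ρ) ^ s) (s * C * ρ) 1 := by
      have h7 : HasDerivAt (fun κ : ℝ => x + y + κ * ρ) ρ 1 := by
        simpa using ((hasDerivAt_id (1 : ℝ)).mul_const ρ).const_add (x + y)
      have h8 := (h7.pow s).const_mul C
      refine h8.congr_deriv ?_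
      rw [show x + y + 1 * ρ = 1 by linarith, one_pow]
      ring
    have hmax : IsLocalMax (fun κ : ℝ => pairPolynomial s 1 c x y κ - C * (x + y + κ * ρ) ^ s)
        1 := by
      filter_upwards [lt_mem_nhds (zero_lt_one (α := ℝ))] with κ hκ
      rw [hval x y hxy, z5, show x + y + 1 * ρ = 1 by linarith]
      have := h2 x y κ hx hy hκ.le
      simp only [one_pow]
      linarith
    have := hmax.hasDerivAt_eq_zero (hd1.sub hd2)
    linarith
  have t1 := htan 0 m le_rfl hm0.le (by ring)
  have t2 := htan (m / 2) (m / 2) (by positivity) (by positivity) (by ring)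
  -- After eliminating `c 3`, the derivative in `κ` varies along the segment only through `-c 4 * m
  -- * (x * y)`; its two values at an end and at the midpoint agree.
  have z4 : c 4 = 0 := by
    have e3 : c 3 = 2 * c 2 - c 4 * m := by linarith
    rw [e3] at t1 t2
    have e : ((s - 2 : ℕ) : ℝ) = (s - 3 : ℕ) + 1 := by
      have : s - 2 = (s - 3) + 1 := by omega
      rw [this]; push_cast; ring
    rw [e] at t1 t2
    have : c 4 * m ^ 3 = 0 := by linarith
    exact (mul_eq_zero.1 this).resolve_right (by positivity)
  have z3 := h4.1 z4
  have z2 : c 2 = 0 := by rw [z3, z4] at hL; linarith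
  have z1 := h4.2 z2
  have hf := h2 0 0 1 le_rfl le_rfl zero_le_one
  have hv := hP a b
  rw [h1, z1, z2, z3, z4, z5] at hv
  have hv0 := hP 0 0
  rw [hv0] at hf
  have : (0 + 0 + 1 * ρ) ^ s < 1 := pow_lt_one₀ (by linarith) (by linarith) (by omega)
  nlinarith

/-- Adjacent atoms of an extremal weighting have equal weights. -/
theorem pairPolynomial_false (hp1 : 1 ≤ p) (hp3 : p ≤ 3) (hs : 3 ≤ s)
    (hc : ∀ i, 0 ≤ c i) (hC : 0 < C) (ha : 0 ≤ a) (hb : 0 ≤ b) (hρ : 0 ≤ ρ)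
    (hsum : a + b + ρ = 1) (hab : a ≠ b) (h1 : pairPolynomial s p c a b 1 = C)
    (h2 : ∀ x y κ : ℝ, 0 ≤ x → 0 ≤ y → 0 ≤ κ →
      pairPolynomial s p c x y κ ≤ C * (x + y + κ * ρ) ^ s)
    (h3 : ∀ ε : ℝ, 0 ≤ ε → C + s * C * ε ≤ pairPolynomial s p c (a + ε) b 1)
    (h3' : ∀ ε : ℝ, 0 ≤ ε → C + s * C * ε ≤ pairPolynomial s p c a (b + ε) 1)
    (h4 : p = 1 → (c 4 = 0 → c 3 = 0) ∧ (c 2 = 0 → c 1 = 0)) : False := by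
  rcases Nat.lt_or_ge 1 p with hp | hp
  -- For `p ≥ 2` an atom of mass zero gains only `O(ε^2)` from mass `ε`, not the required `s * C *
  -- ε`.
  · have hflat : ∀ y : ℝ, 0 ≤ y → pairPolynomial s p c 0 y 1 = C →
        (∀ ε : ℝ, 0 ≤ ε → C + s * C * ε ≤ pairPolynomial s p c ε y 1) → False := by
      intro y hy hval hlow
      have hneg : s * C ≤ 0 := by
        refine nonpos_of_forall_le_mul (K := c 1 + c 2 + c 3 * y ^ p + c 4 * y ^ p * (1 + y) +
          c 5 * y ^ (p + 1)) fun ε h0 hε => ?_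
        have h5 := hlow ε h0.le
        simp only [pairPolynomial, one_pow, mul_one, mul_pow] at h5
        have e1 : ε ^ p ≤ ε ^ 2 := pow_le_pow_of_le_one h0.le hε (by omega)
        have e2 : ε ^ (p + 1) ≤ ε ^ 2 := pow_le_pow_of_le_one h0.le hε (by omega)
        have f1 := mul_le_mul_of_nonneg_left e1 (hc 1)
        have f2 := mul_le_mul_of_nonneg_left e2 (hc 2)
        have f3 := mul_le_mul_of_nonneg_left e1 (mul_nonneg (hc 3) (pow_nonneg hy p))
        have f4 := mul_le_mul_of_nonneg_left e1 (mul_nonneg (mul_nonneg (hc 4) (pow_nonneg hy p))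
          (show 0 ≤ 1 + y by linarith))
        have f4' := mul_le_mul_of_nonneg_left (show ε + y ≤ 1 + y by linarith)
          (mul_nonneg (mul_nonneg (hc 4) (pow_nonneg hy p)) (pow_nonneg h0.le p))
        have f5 := mul_le_mul_of_nonneg_left e2 (mul_nonneg (hc 5) (pow_nonneg hy (p + 1)))
        have h8 : ε * (s * C) ≤ ε * (ε * (c 1 + c 2 + c 3 * y ^ p + c 4 * y ^ p * (1 + y) +
          c 5 * y ^ (p + 1))) := by
          have hval' := hval
          simp only [pairPolynomial, one_pow, mul_one, zero_mul, zero_pow (show p ≠ 0 by omega),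
            zero_pow (Nat.succ_ne_zero p), zero_add, mul_zero, add_zero] at hval'
          linarith
        exact le_of_mul_le_mul_left h8 h0
      have : 0 < s * C := mul_pos (by exact_mod_cast (by omega : 0 < s)) hC
      linarith
    rcases ha.lt_or_eq with ha' | rfl
    · rcases hb.lt_or_eq with hb' | rfl
      · exact pairPolynomial_false_of_two_le hp hp3 (by omega) hc hC ha' hb' hρ hsum hab h1 h2
      · refine hflat a ha (by rw [pairPolynomial_comm, h1]) fun ε h0 => ?_
        rw [pairPolynomial_comm]
        simpa using h3' ε h0
    · exact hflat b hb h1 fun ε h0 => by simpa using h3 ε h0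
  · obtain rfl : p = 1 := by omega
    exact pairPolynomial_false_of_one hs hc hC ha hb hρ hsum hab h1 h2 h3 h3' (h4 rfl)

end PairPolynomial

end Inducibility

namespace Inducibility

open scoped NNReal ENNReal

/-! ### Graphs given by colour classes of equal measure -/

section Tuples

variable {V Ω : Type*} [Fintype V] [MeasurableSpace Ω] {μ : Measure Ω} [IsProbabilityMeasure μ]

theorem ae_pi_pairwise {Q : Ω → Ω → Prop} (h : ∀ᵐ q ∂μ.prod μ, Q q.1 q.2) :
    ∀ᵐ t ∂Measure.pi fun _ : V => μ, ∀ u v : V, u ≠ v → Q (t u) (t v) := by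
  refine eventually_all.2 fun u => eventually_all.2 fun v =>
    eventually_imp_distrib_left.2 fun huv => ?_
  have hinj : Function.Injective (![u, v] : Fin 2 → V) := by
    intro i j
    fin_cases i <;> fin_cases j <;> simp [huv, huv.symm]
  exact ((measurePreserving_finTwoArrow μ).comp
    (measurePreserving_comp_of_injective μ hinj)).quasiMeasurePreserving.ae h

variable {G : SimpleGraph Ω} {r p : ℕ}

/-- A random point of the space with a colouring by classes of equal measure. -/
theorem blowupDensity_eq_of_adj_iff {s n : ℕ} {π : Ω → Fin n} (hπ : Measurable π)
    (hn : ∀ i, μ.real (π ⁻¹' {i}) = 1 / n)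
    (hadj : ∀ᵐ q ∂μ.prod μ, G.Adj q.1 q.2 ↔ π q.1 ≠ π q.2) :
    blowupDensity (Fin s) r p G μ = equipartiteDensity s r p n := by
  classical
  have h1 : (fun t : Fin s → Ω => t ∈ balancedTuples (Fin s) r p G) =ᵐ[Measure.pi fun _ => μ]
      fun t => IsBalanced r p ((⊤ : SimpleGraph (Fin n)).comap (π ∘ t)) := by
    filter_upwards [ae_pi_pairwise (V := Fin s) (Q := fun x y => G.Adj x y ↔ π x ≠ π y) hadj]
      with t ht
    have : G.comap t = (⊤ : SimpleGraph (Fin n)).comap (π ∘ t) := by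
      ext u v
      by_cases huv : u = v
      · subst huv; simp
      · exact ht u v huv
    simp only [balancedTuples, Set.mem_ofPred_eq, this]
  have inst : IsProbabilityMeasure (μ.map π) := Measure.isProbabilityMeasure_map hπ.aemeasurable
  have hm : Measurable fun t : Fin s → Ω => π ∘ t :=
    measurable_pi_lambda _ fun v => hπ.comp (measurable_pi_apply v)
  have h2 : (Measure.pi fun _ : Fin s => μ).map (fun t => π ∘ t) =
      Measure.pi fun _ : Fin s => μ.map π :=
    (Measure.pi_map_pi (fun _ => hπ.aemeasurable))
  have h3 : blowupDensity (Fin s) r p G μ = (Measure.pi fun _ : Fin s => μ.map π).real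
      {σ | IsBalanced r p ((⊤ : SimpleGraph (Fin n)).comap σ)} := by
    rw [← h2, measureReal_def, Measure.map_apply hm (Set.toFinite _).measurableSet,
      blowupDensity, measureReal_def]
    exact congrArg _ (measure_congr h1)
  have h4 : ∀ σ : Fin s → Fin n, (Measure.pi fun _ : Fin s => μ.map π).real {σ} =
      (1 / (n : ℝ)) ^ s := by
    intro σ
    have : ({σ} : Set (Fin s → Fin n)) = Set.univ.pi fun v => {σ v} := by
      ext τ; simp [funext_iff]
    rw [this, measureReal_def, Measure.pi_pi, ENNReal.toReal_prod]
    have h5 : ∀ v, (μ.map π {σ v}).toReal = 1 / n := by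
      intro v
      rw [Measure.map_apply hπ (measurableSet_singleton _)]
      exact hn _
    simp [h5]
  have hfin : {σ : Fin s → Fin n | IsBalanced r p ((⊤ : SimpleGraph (Fin n)).comap σ)} =
      ((Finset.univ.filter fun σ : Fin s → Fin n =>
        IsBalanced r p ((⊤ : SimpleGraph (Fin n)).comap σ) : Finset _) : Set _) := by
    ext; simp
  rw [h3, hfin, ← sum_measureReal_singleton, Finset.sum_congr rfl fun σ _ => h4 σ,
    Finset.sum_const, equipartiteDensity, balancedMaps, Nat.card_eq_fintype_card,
    Fintype.card_subtype, nsmul_eq_mul, one_div, inv_pow, div_eq_mul_inv]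

/-- Tuples with all coordinates in distinct classes have positive measure whenever there are enough
classes. -/
theorem aecliqueFree_iff_of_adj_iff {n j : ℕ} {π : Ω → Fin n}
    (hn : ∀ i, μ.real (π ⁻¹' {i}) = 1 / n)
    (hadj : ∀ᵐ q ∂μ.prod μ, G.Adj q.1 q.2 ↔ π q.1 ≠ π q.2) :
    AECliqueFree G μ j ↔ n < j := by
  have h1 : ∀ᵐ t ∂Measure.pi fun _ : Fin j => μ, G.comap t = ⊤ ↔ Function.Injective (π ∘ t) := by
    filter_upwards [ae_pi_pairwise (V := Fin j) (Q := fun x y => G.Adj x y ↔ π x ≠ π y) hadj]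
      with t ht
    constructor
    · intro h u v huv
      by_contra hne
      have : (G.comap t).Adj u v := by rw [h]; exact hne
      exact (ht u v hne).1 this huv
    · intro h
      ext u v
      constructor
      · exact fun h' => h'.ne
      · exact fun h' => (ht u v h').2 fun heq => h' (h heq)
  constructor
  · intro hfree
    by_contra hjn
    rw [not_lt] at hjn
    have h2 : (Measure.pi fun _ : Fin j => μ)
        (Set.univ.pi fun v => π ⁻¹' {Fin.castLE hjn v}) = 0 := by
      have : ∀ᵐ t ∂Measure.pi fun _ : Fin j => μ,
          t ∉ Set.univ.pi fun v => π ⁻¹' {Fin.castLE hjn v} := by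
        filter_upwards [h1, hfree] with t ht hne hmem
        refine hne (ht.2 fun u v huv => ?_)
        have hu := hmem u (Set.mem_univ u)
        have hv := hmem v (Set.mem_univ v)
        simp only [Set.mem_preimage, Set.mem_singleton_iff] at hu hv
        simp only [Function.comp_apply, hu, hv] at huv
        exact Fin.castLE_injective hjn huv
      exact measure_eq_zero_iff_ae_notMem.2 this
    rw [Measure.pi_pi, Finset.prod_eq_zero_iff] at h2
    obtain ⟨v, -, hv⟩ := h2
    have := hn (Fin.castLE hjn v)
    rw [measureReal_def, hv] at this
    have hpos : (0 : ℝ) < n := by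
      have := v.isLt
      exact_mod_cast (by omega : 0 < n)
    have : (0 : ℝ) < 1 / n := by positivity
    simp_all
  · intro hj
    filter_upwards [h1] with t ht htop
    have := Fintype.card_le_of_injective _ (ht.1 htop)
    simp at this
    omega

end Tuples

end Inducibility

namespace Inducibility

open scoped NNReal ENNReal

/-! ### Collapsing two classes to atoms -/

section Replacement

variable {Ω : Type*} {G : SimpleGraph Ω}

open Classical in
/-- The map moving the non-neighbours of `x` to `x` and the other non-neighbours of `y` to `y`. -/
noncomputable def collapse (G : SimpleGraph Ω) (x y z : Ω) : Ω :=
  if ¬G.Adj x z then x else if ¬G.Adj y z then y else z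

theorem collapse_of_not_adj {x y z : Ω} (h : ¬G.Adj x z) : collapse G x y z = x := if_pos h

theorem collapse_of_adj_not_adj {x y z : Ω} (h : G.Adj x z) (h' : ¬G.Adj y z) :
    collapse G x y z = y := by
  rw [collapse, if_neg (not_not.2 h), if_pos h']

theorem collapse_of_adj_adj {x y z : Ω} (h : G.Adj x z) (h' : G.Adj y z) :
    collapse G x y z = z := by
  rw [collapse, if_neg (not_not.2 h), if_neg (not_not.2 h')]

theorem adj_left_collapse {x y z : Ω} (hxy : G.Adj x y) :
    G.Adj x (collapse G x y z) ↔ G.Adj x z := by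
  by_cases h1 : G.Adj x z
  · by_cases h2 : G.Adj y z
    · rw [collapse_of_adj_adj h1 h2]
    · rw [collapse_of_adj_not_adj h1 h2]
      exact iff_of_true hxy h1
  · rw [collapse_of_not_adj h1]
    exact iff_of_false G.irrefl h1

theorem adj_right_collapse {x y z : Ω} (hxy : G.Adj x y) (hz : G.Adj x z ∨ G.Adj y z) :
    G.Adj y (collapse G x y z) ↔ G.Adj y z := by
  by_cases h1 : G.Adj x z
  · by_cases h2 : G.Adj y z
    · rw [collapse_of_adj_adj h1 h2]
    · rw [collapse_of_adj_not_adj h1 h2]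
      exact iff_of_false G.irrefl h2
  · rw [collapse_of_not_adj h1]
    exact iff_of_true hxy.symm (hz.resolve_left h1)

variable [MeasurableSpace Ω] {μ : Measure Ω}

/-- Non-adjacency is transitive at almost all triples containing `x`. -/
def IsConsistent (G : SimpleGraph Ω) (μ : Measure Ω) (x : Ω) : Prop :=
  ∀ᵐ y ∂μ, ∀ᵐ z ∂μ, (¬G.Adj x y → ¬G.Adj y z → ¬G.Adj x z) ∧
    (¬G.Adj x z → ¬G.Adj z y → ¬G.Adj x y) ∧ (¬G.Adj y x → ¬G.Adj x z → ¬G.Adj y z)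

theorem MeasurableAdj.measurableSet_adj (hG : MeasurableAdj G) (x : Ω) :
    MeasurableSet {z | G.Adj x z} := by
  have : Measurable fun z : Ω => (x, z) := by fun_prop
  exact this (show MeasurableSet {z : Ω × Ω | G.Adj z.1 z.2} from hG)

theorem measurable_collapse (hG : MeasurableAdj G) (x y : Ω) : Measurable (collapse G x y) :=
  Measurable.ite (hG.measurableSet_adj x).compl measurable_const
    (Measurable.ite (hG.measurableSet_adj y).compl measurable_const measurable_id)

theorem toNNReal_smul (a : ℝ≥0∞) (ha : a ≠ ⊤) (ν : Measure Ω) : a.toNNReal • ν = a • ν := by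
  ext B _
  simp [ENNReal.smul_def, ENNReal.coe_toNNReal ha]

variable [IsProbabilityMeasure μ]

/-- Almost no point is a non-neighbour of both `x` and `y`, so the second atom receives the full
mass of the non-neighbours of `y`. -/
theorem map_collapse (hG : MeasurableAdj G) {x y : Ω}
    (hd : ∀ᵐ z ∂μ, G.Adj x z ∨ G.Adj y z) : μ.map (collapse G x y) =
      (μ {z | ¬G.Adj x z}).toNNReal • Measure.dirac x +
      (μ {z | ¬G.Adj y z}).toNNReal • Measure.dirac y +
      (1 : ℝ≥0) • μ.restrict {z | G.Adj x z ∧ G.Adj y z} := by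
  have hx := (hG.measurableSet_adj x)
  have hy := (hG.measurableSet_adj y)
  have hA : MeasurableSet {z | ¬G.Adj x z} := hx.compl
  have hB : MeasurableSet {z | G.Adj x z ∧ ¬G.Adj y z} := hx.inter hy.compl
  have hN : MeasurableSet {z | G.Adj x z ∧ G.Adj y z} := hx.inter hy
  have e : μ = μ.restrict {z | ¬G.Adj x z} + μ.restrict {z | G.Adj x z ∧ ¬G.Adj y z} +
      μ.restrict {z | G.Adj x z ∧ G.Adj y z} := by
    rw [← Measure.restrict_union _ hB, ← Measure.restrict_union _ hN]
    · conv_lhs => rw [← Measure.restrict_univ (μ := μ)]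
      congr 1
      ext z
      simp only [Set.mem_univ, Set.mem_union, Set.mem_ofPred_eq, true_iff]
      tauto
    · rw [Set.disjoint_left]
      intro z hz
      simp only [Set.mem_union, Set.mem_ofPred_eq] at hz ⊢
      tauto
    · rw [Set.disjoint_left]
      intro z hz
      simp only [Set.mem_ofPred_eq] at hz ⊢
      tauto
  have hm := measurable_collapse hG x y
  have hBy : μ {z | G.Adj x z ∧ ¬G.Adj y z} = μ {z | ¬G.Adj y z} := by
    refine measure_congr ?_
    filter_upwards [hd] with z hz
    apply propext
    change G.Adj x z ∧ ¬G.Adj y z ↔ ¬G.Adj y z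
    tauto
  have m1 : (μ.restrict {z | ¬G.Adj x z}).map (collapse G x y) =
      (μ {z | ¬G.Adj x z}).toNNReal • Measure.dirac x := by
    rw [Measure.map_congr (g := fun _ => x) ((ae_restrict_iff' hA).2
      (Eventually.of_forall fun z hz => collapse_of_not_adj hz)), Measure.map_const,
      Measure.restrict_apply_univ, toNNReal_smul _ (measure_ne_top _ _)]
  have m2 : (μ.restrict {z | G.Adj x z ∧ ¬G.Adj y z}).map (collapse G x y) =
      (μ {z | ¬G.Adj y z}).toNNReal • Measure.dirac y := by
    rw [Measure.map_congr (g := fun _ => y) ((ae_restrict_iff' hB).2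
      (Eventually.of_forall fun z hz => collapse_of_adj_not_adj hz.1 hz.2)), Measure.map_const,
      Measure.restrict_apply_univ, hBy, toNNReal_smul _ (measure_ne_top _ _)]
  have m3 : (μ.restrict {z | G.Adj x z ∧ G.Adj y z}).map (collapse G x y) =
      (1 : ℝ≥0) • μ.restrict {z | G.Adj x z ∧ G.Adj y z} := by
    rw [Measure.map_congr (f := collapse G x y) (g := id) ((ae_restrict_iff' hN).2
      (Eventually.of_forall fun z hz => collapse_of_adj_adj hz.1 hz.2)), Measure.map_id, one_smul]
  conv_lhs => rw [e]
  rw [Measure.map_add _ _ hm, Measure.map_add _ _ hm, m1, m2, m3]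

/-- Consistency makes the non-neighbours of `x` pairwise non-adjacent and equally adjacent to
outside points, and likewise for `y`. Replacing them by `x` and `y` therefore changes no adjacency.
-/
theorem ae_adj_collapse (hG : MeasurableAdj G) {x y : Ω} (hx : IsConsistent G μ x)
    (hy : IsConsistent G μ y) (hxy : G.Adj x y) :
    ∀ᵐ q ∂μ.prod μ, G.Adj (collapse G x y q.1) (collapse G x y q.2) ↔ G.Adj q.1 q.2 := by
  have hm := measurable_collapse hG x y
  have hms : MeasurableSet {q : Ω × Ω |
      G.Adj (collapse G x y q.1) (collapse G x y q.2) ↔ G.Adj q.1 q.2} := by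
    have h1 : MeasurableSet {q : Ω × Ω | G.Adj (collapse G x y q.1) (collapse G x y q.2)} :=
      (hm.prodMap hm) (show MeasurableSet {z : Ω × Ω | G.Adj z.1 z.2} from hG)
    exact h1.iff (show MeasurableSet {z : Ω × Ω | G.Adj z.1 z.2} from hG)
  refine (Measure.ae_prod_iff_ae_ae hms).2 ?_
  filter_upwards [hx, hy] with z hx1 hy1
  filter_upwards [hx1, hy1] with w hx2 hy2
  by_cases a1 : G.Adj x z
  · have h1 : ¬G.Adj x w → G.Adj z w := fun h => by
      by_contra hzw
      exact hx2.2.1 h (fun h' => hzw h'.symm) a1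
    by_cases a2 : G.Adj y z
    · rw [collapse_of_adj_adj a1 a2]
      by_cases a3 : G.Adj x w
      · by_cases a4 : G.Adj y w
        · rw [collapse_of_adj_adj a3 a4]
        · rw [collapse_of_adj_not_adj a3 a4]
          refine iff_of_true a2.symm ?_
          by_contra hzw
          exact hy2.2.1 a4 (fun h' => hzw h'.symm) a2
      · rw [collapse_of_not_adj a3]
        exact iff_of_true a1.symm (h1 a3)
    · rw [collapse_of_adj_not_adj a1 a2]
      by_cases a3 : G.Adj x w
      · by_cases a4 : G.Adj y w
        · rw [collapse_of_adj_adj a3 a4]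
          exact iff_of_true a4 (by_contra fun hzw => hy2.1 a2 hzw a4)
        · rw [collapse_of_adj_not_adj a3 a4]
          exact iff_of_false G.irrefl (hy2.2.2 (fun h => a2 h.symm) a4)
      · rw [collapse_of_not_adj a3]
        exact iff_of_true hxy.symm (h1 a3)
  · rw [collapse_of_not_adj a1]
    have h1 : G.Adj x w → G.Adj z w := fun h => by_contra fun hzw => hx2.1 a1 hzw h
    by_cases a3 : G.Adj x w
    · by_cases a4 : G.Adj y w
      · rw [collapse_of_adj_adj a3 a4]
        exact iff_of_true a3 (h1 a3)
      · rw [collapse_of_adj_not_adj a3 a4]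
        exact iff_of_true hxy (h1 a3)
    · rw [collapse_of_not_adj a3]
      exact iff_of_false G.irrefl (hx2.2.2 (fun h => a1 h.symm) a3)

theorem blowupDensity_map_collapse (hG : MeasurableAdj G) {s r p : ℕ} {x y : Ω}
    (hadj : ∀ᵐ q ∂μ.prod μ, G.Adj (collapse G x y q.1) (collapse G x y q.2) ↔ G.Adj q.1 q.2) :
    blowupDensity (Fin s) r p G (μ.map (collapse G x y)) = blowupDensity (Fin s) r p G μ := by
  have hm := measurable_collapse hG x y
  have inst : IsProbabilityMeasure (μ.map (collapse G x y)) :=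
    Measure.isProbabilityMeasure_map hm.aemeasurable
  have hm' : Measurable fun t : Fin s → Ω => fun v => collapse G x y (t v) :=
    measurable_pi_lambda _ fun v => hm.comp (measurable_pi_apply v)
  rw [blowupDensity, ← Measure.pi_map_pi (fun _ => hm.aemeasurable), measureReal_def,
    Measure.map_apply hm' (hG.measurableSet_balancedTuples r p), blowupDensity, measureReal_def]
  refine congrArg _ (measure_congr ?_)
  filter_upwards [ae_pi_pairwise (V := Fin s)
    (Q := fun z w => G.Adj (collapse G x y z) (collapse G x y w) ↔ G.Adj z w) hadj] with t ht
  have : G.comap (fun v => collapse G x y (t v)) = G.comap t := by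
    ext u v
    by_cases huv : u = v
    · subst huv; simp
    · exact ht u v huv
  change IsBalanced r p (G.comap fun v => collapse G x y (t v)) = IsBalanced r p (G.comap t)
  rw [this]

/-- If collapsing does not alter adjacency to `a`, tuples through `a` are unaffected. This gives the
growth rate of the density at the new atoms. -/
theorem pointDensity_map_collapse (hG : MeasurableAdj G) {s r p : ℕ} {x y a : Ω}
    (hadj : ∀ᵐ q ∂μ.prod μ, G.Adj (collapse G x y q.1) (collapse G x y q.2) ↔ G.Adj q.1 q.2)
    (ha : ∀ᵐ z ∂μ, G.Adj a (collapse G x y z) ↔ G.Adj a z) :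
    pointDensity (Fin s) r p G (μ.map (collapse G x y)) a = pointDensity (Fin s) r p G μ a := by
  have hm := measurable_collapse hG x y
  have inst : IsProbabilityMeasure (μ.map (collapse G x y)) :=
    Measure.isProbabilityMeasure_map hm.aemeasurable
  have hm' : Measurable fun t : Fin s → Ω => fun v => collapse G x y (t v) :=
    measurable_pi_lambda _ fun v => hm.comp (measurable_pi_apply v)
  refine Finset.sum_congr rfl fun u _ => ?_
  have hms : MeasurableSet {t : Fin s → Ω |
      Function.update t u a ∈ balancedTuples (Fin s) r p G} := by
    have : Measurable fun t : Fin s → Ω => (a, t) := by fun_prop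
    exact this (measurableSet_update hG u)
  rw [← Measure.pi_map_pi (fun _ => hm.aemeasurable), measureReal_def,
    Measure.map_apply hm' hms, measureReal_def]
  refine congrArg _ (measure_congr ?_)
  filter_upwards [ae_pi_pairwise (V := Fin s)
    (Q := fun z w => G.Adj (collapse G x y z) (collapse G x y w) ↔ G.Adj z w) hadj,
    ae_pi_forall (V := Fin s) (P := fun _ z => G.Adj a (collapse G x y z) ↔ G.Adj a z)
      fun _ => ha] with t ht hta
  have : G.comap (Function.update (fun v => collapse G x y (t v)) u a) =
      G.comap (Function.update t u a) := by
    ext v w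
    simp only [SimpleGraph.comap_adj]
    by_cases hvw : v = w
    · subst hvw; simp
    by_cases hv : v = u
    · subst hv
      rw [Function.update_self, Function.update_self, Function.update_of_ne (Ne.symm hvw),
        Function.update_of_ne (Ne.symm hvw)]
      exact hta w
    by_cases hw : w = u
    · subst hw
      rw [Function.update_self, Function.update_self, Function.update_of_ne hvw,
        Function.update_of_ne hvw, G.adj_comm, G.adj_comm (t v)]
      exact hta v
    · rw [Function.update_of_ne hv, Function.update_of_ne hv, Function.update_of_ne hw,
        Function.update_of_ne hw]
      exact ht v w hvw
  change IsBalanced r p (G.comap (Function.update (fun v => collapse G x y (t v)) u a)) =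
    IsBalanced r p (G.comap (Function.update t u a))
  rw [this]

end Replacement

namespace IsExtremal

variable {Ω : Type*} [MeasurableSpace Ω] [MeasurableSingletonClass Ω] {s r p : ℕ} {K : Set ℕ}
  {c : ℝ} {G : SimpleGraph Ω} {μ : Measure Ω} [IsProbabilityMeasure μ]

/-- Generic adjacent points have equally many non-neighbours. -/
theorem measureReal_not_adj_eq (h : IsExtremal s r p K c G μ) (hp : 1 ≤ p) (hp3 : p ≤ 3)
    (hr : 2 ≤ r) (hrs : r < s) {x y : Ω} (hx : IsConsistent G μ x) (hy : IsConsistent G μ y)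
    (hxy : G.Adj x y) (hd : ∀ᵐ z ∂μ, G.Adj x z ∨ G.Adj y z)
    (hx1 : pointDensity (Fin s) r p G μ x = s * c) (hy1 : pointDensity (Fin s) r p G μ y = s * c)
    (hfree : ∀ j ∈ K, AECliqueFree G (μ + Measure.dirac x + Measure.dirac y) j) :
    μ.real {z | ¬G.Adj x z} = μ.real {z | ¬G.Adj y z} := by
  by_contra hne
  have hG := h.measurableAdj
  have hadj := ae_adj_collapse hG hx hy hxy
  have hN : MeasurableSet {z | G.Adj x z ∧ G.Adj y z} :=
    (hG.measurableSet_adj x).inter (hG.measurableSet_adj y)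
  set ρ := μ.restrict {z | G.Adj x z ∧ G.Adj y z} with hρ
  set a : ℝ≥0 := (μ {z | ¬G.Adj x z}).toNNReal with ha
  set b : ℝ≥0 := (μ {z | ¬G.Adj y z}).toNNReal with hb
  have hmap := map_collapse hG hd
  rw [← hρ, ← ha, ← hb] at hmap
  have inst : IsProbabilityMeasure (μ.map (collapse G x y)) :=
    Measure.isProbabilityMeasure_map (measurable_collapse hG x y).aemeasurable
  obtain ⟨d, hd0, hpoly, hone⟩ := exists_pairPolynomial (V := Fin s) (r := r) (s := s) hG hp
    (Fintype.card_fin s) hrs (by omega) hxy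
    (ρ := ρ) ((ae_restrict_iff' hN).2 (Eventually.of_forall fun z hz => hz.1))
    ((ae_restrict_iff' hN).2 (Eventually.of_forall fun z hz => hz.2))
  have hsum : (a : ℝ) + b + ρ.real Set.univ = 1 := by
    have h1 : (μ.map (collapse G x y)).real Set.univ = 1 := probReal_univ
    rw [hmap, measureReal_add_apply, measureReal_add_apply, measureReal_nnreal_smul_apply,
      measureReal_nnreal_smul_apply, measureReal_nnreal_smul_apply, probReal_univ,
      probReal_univ] at h1
    simpa using h1
  -- The first-order term at `z` survives the collapse, so adding mass `ε` at `z` gains at least `s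
  -- * c * ε`.
  have hlow : ∀ z : Ω, (∀ᵐ w ∂μ, G.Adj z (collapse G x y w) ↔ G.Adj z w) →
      pointDensity (Fin s) r p G μ z = s * c → ∀ ε : ℝ≥0, c + s * c * ε ≤
      blowupDensity (Fin s) r p G (μ.map (collapse G x y) + ε • Measure.dirac z) := by
    intro z hz hz1 ε
    have h1 := le_blowupDensity_add_smul (V := Fin s) (r := r) (p := p)
      (μ := μ.map (collapse G x y)) hG (Measure.dirac z) ε
    rw [integral_dirac, pointDensity_map_collapse hG hadj hz, hz1,
      blowupDensity_map_collapse hG hadj, h.eq] at h1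
    have h2 : 0 ≤ ∫ q, pairDensity (Fin s) r p G (μ.map (collapse G x y)) q.1 q.2
        ∂((Measure.dirac z).prod (Measure.dirac z)) :=
      integral_nonneg fun q => pairDensity_nonneg _ _
    have h3 : 0 ≤ (ε : ℝ) ^ 2 * ((∫ q, pairDensity (Fin s) r p G (μ.map (collapse G x y)) q.1 q.2
        ∂((Measure.dirac z).prod (Measure.dirac z))) / 2) := by positivity
    linarith
  refine pairPolynomial_false (C := c) (ρ := ρ.real Set.univ) (a := a) (b := b) hp hp3
    (by omega : 3 ≤ s) hd0 h.pos a.2 b.2 measureReal_nonneg hsum hne ?_ ?_ ?_ ?_ hone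
  · have h1 := hpoly a b 1
    rw [← hmap, blowupDensity_map_collapse hG hadj, h.eq] at h1
    exact_mod_cast h1.symm
  · intro x' y' κ hx' hy' hκ
    lift x' to ℝ≥0 using hx'
    lift y' to ℝ≥0 using hy'
    lift κ to ℝ≥0 using hκ
    rw [← hpoly]
    -- All masses are at most `x' + y' + κ`, so the measure is dominated by that multiple of `μ`
    -- plus the two generic atoms.
    refine (h.le _ inferInstance fun j hj =>
      ((hfree j hj).smul (x' + y' + κ)).mono ?_).trans_eq ?_
    · rw [smul_add, smul_add, show (x' + y' + κ) • μ + (x' + y' + κ) • Measure.dirac x +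
        (x' + y' + κ) • Measure.dirac y = (x' + y' + κ) • Measure.dirac x +
        (x' + y' + κ) • Measure.dirac y + (x' + y' + κ) • μ by abel]
      refine add_le_add (add_le_add ?_ ?_) ?_
      all_goals
        refine Measure.le_iff.2 fun B _ => ?_
        simp only [Measure.smul_apply, ENNReal.smul_def, smul_eq_mul]
      · refine mul_le_mul' ?_ le_rfl
        exact_mod_cast le_add_right (le_add_right le_rfl)
      · refine mul_le_mul' ?_ le_rfl
        exact_mod_cast le_add_right le_add_self
      · refine mul_le_mul' ?_ (Measure.restrict_le_self B)
        exact_mod_cast le_add_self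
    · rw [measureReal_add_apply, measureReal_add_apply, measureReal_nnreal_smul_apply,
        measureReal_nnreal_smul_apply, measureReal_nnreal_smul_apply, probReal_univ,
        probReal_univ, mul_one, mul_one]
  · intro ε hε
    lift ε to ℝ≥0 using hε
    have h1 := hlow x (Eventually.of_forall fun z => adj_left_collapse hxy) hx1 ε
    rw [hmap, show a • Measure.dirac x + b • Measure.dirac y + (1 : ℝ≥0) • ρ +
      ε • Measure.dirac x = (a + ε) • Measure.dirac x + b • Measure.dirac y + (1 : ℝ≥0) • ρ by
        rw [add_smul]; abel, hpoly] at h1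
    exact_mod_cast h1
  · intro ε hε
    lift ε to ℝ≥0 using hε
    have h1 := hlow y (by
      filter_upwards [hd] with z hz
      exact adj_right_collapse hxy hz) hy1 ε
    rw [hmap, show a • Measure.dirac x + b • Measure.dirac y + (1 : ℝ≥0) • ρ +
      ε • Measure.dirac y = a • Measure.dirac x + (b + ε) • Measure.dirac y + (1 : ℝ≥0) • ρ by
        rw [add_smul]; abel, hpoly] at h1
    exact_mod_cast h1

variable [MeasurableSpace.CountablyGenerated Ω]

theorem ae_isConsistent (h : IsExtremal s r p K c G μ) (hp : 1 ≤ p) (hr : 2 ≤ r) (hrs : r < s) :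
    ∀ᵐ x ∂μ, IsConsistent G μ x := h.ae_consistent hp hr hrs

/-- Adjacent points are handled by the polynomial argument; non-adjacent generic points have the
same non-neighbours up to a null set. -/
theorem ae_measureReal_not_adj_eq (h : IsExtremal s r p K c G μ) (hp : 1 ≤ p) (hp3 : p ≤ 3)
    (hr : 2 ≤ r) (hrs : r < s) :
    ∀ᵐ x ∂μ, ∀ᵐ y ∂μ, μ.real {z | ¬G.Adj x z} = μ.real {z | ¬G.Adj y z} := by
  filter_upwards [h.ae_isConsistent hp hr hrs, h.ae_pointDensity_eq, h.ae_add_dirac_add_dirac]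
    with x hx hx1 hx2
  filter_upwards [h.ae_isConsistent hp hr hrs, h.ae_pointDensity_eq, hx2, hx] with y hy hy1 hy2 hy3
  by_cases hxy : G.Adj x y
  · refine h.measureReal_not_adj_eq hp hp3 hr hrs hx hy hxy ?_ hx1 hy1 hy2
    filter_upwards [hy3] with z hz
    have := G.adj_comm y z
    tauto
  · refine measureReal_congr ?_
    filter_upwards [hy3] with z hz
    apply propext
    change ¬G.Adj x z ↔ ¬G.Adj y z
    have := G.adj_comm y x
    tauto

end IsExtremal

end Inducibility

/-! ### Structure of extremal measures -/

namespace Inducibility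

open scoped NNReal ENNReal

namespace IsExtremal

variable {Ω : Type*} [MeasurableSpace Ω] [MeasurableSingletonClass Ω]
  [MeasurableSpace.CountablyGenerated Ω] {s r p : ℕ} {K : Set ℕ}
  {c : ℝ} {G : SimpleGraph Ω} {μ : Measure Ω} [IsProbabilityMeasure μ]

/-- If the common value were zero, almost every `s`-tuple would be a clique, and a clique on more
than `r` vertices is not balanced. -/
theorem exists_ae_measureReal_not_adj_eq (h : IsExtremal s r p K c G μ) (hp : 1 ≤ p) (hp3 : p ≤ 3)
    (hr : 2 ≤ r) (hrs : r < s) : ∃ a : ℝ, 0 < a ∧ ∀ᵐ x ∂μ, μ.real {z | ¬G.Adj x z} = a := by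
  have hG := h.measurableAdj
  obtain ⟨x, hx⟩ := (h.ae_measureReal_not_adj_eq hp hp3 hr hrs).exists
  refine ⟨μ.real {z | ¬G.Adj x z}, lt_of_le_of_ne measureReal_nonneg fun h0 => ?_, ?_⟩
  · have h1 : ∀ᵐ q ∂μ.prod μ, G.Adj q.1 q.2 := by
      refine (Measure.ae_prod_iff_ae_ae
        (show MeasurableSet {z : Ω × Ω | G.Adj z.1 z.2} from hG)).2 ?_
      filter_upwards [hx] with y hy
      rw [← h0] at hy
      exact (measureReal_eq_zero_iff (measure_ne_top _ _)).1 hy.symm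
    have h2 : ∀ᵐ t ∂Measure.pi fun _ : Fin s => μ, t ∉ balancedTuples (Fin s) r p G := by
      filter_upwards [ae_pi_pairwise (V := Fin s) (Q := fun x y => G.Adj x y) h1] with t ht hbal
      obtain ⟨f, hf, -⟩ := hbal
      have hinj : Function.Injective f := fun u v huv => by
        by_contra hne
        exact (hf u v).1 (ht u v hne) huv
      have := Fintype.card_le_of_injective f hinj
      simp at this
      omega
    have h3 : blowupDensity (Fin s) r p G μ = 0 := by
      rw [blowupDensity, measureReal_def, measure_eq_zero_iff_ae_notMem.2 h2, ENNReal.toReal_zero]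
    have h4 := h.pos
    rw [← h.eq, h3] at h4
    exact lt_irrefl _ h4
  · filter_upwards [hx] with y hy using hy.symm

/-- An extremal measure is the blow-up of a clique with equal weights. -/
theorem exists_colouring (h : IsExtremal s r p K c G μ) (hp : 1 ≤ p) (hp3 : p ≤ 3)
    (hr : 2 ≤ r) (hrs : r < s) : ∃ n : ℕ, 1 ≤ n ∧ ∃ π : Ω → Fin n, Measurable π ∧
      (∀ i, μ.real (π ⁻¹' {i}) = 1 / n) ∧
      ∀ᵐ q ∂μ.prod μ, G.Adj q.1 q.2 ↔ π q.1 ≠ π q.2 := by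
  have hG := h.measurableAdj
  obtain ⟨a, ha, hae⟩ := h.exists_ae_measureReal_not_adj_eq hp hp3 hr hrs
  have hms : ∀ x, MeasurableSet {z | ¬G.Adj x z} := fun x => (hG.measurableSet_adj x).compl
  -- `Q n` provides `n` representatives whose non-neighbour sets are almost disjoint, each of
  -- measure `a`. As `a > 0`, such families have bounded size.
  let Q : ℕ → Prop := fun n => ∃ x : Fin n → Ω,
    (∀ i, μ.real {z | ¬G.Adj (x i) z} = a ∧ IsConsistent G μ (x i)) ∧
    ∀ i j, i ≠ j → ∀ᵐ z ∂μ, G.Adj (x i) z ∨ G.Adj (x j) z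
  have hunion : ∀ n (x : Fin n → Ω), (∀ i, μ.real {z | ¬G.Adj (x i) z} = a) →
      (∀ i j, i ≠ j → ∀ᵐ z ∂μ, G.Adj (x i) z ∨ G.Adj (x j) z) →
      μ.real (⋃ i, {z | ¬G.Adj (x i) z}) = n * a := by
    intro n x hx hdis
    have hd : Pairwise (Function.onFun (AEDisjoint μ) fun i => {z | ¬G.Adj (x i) z}) := by
      intro i j hij
      refine measure_eq_zero_iff_ae_notMem.2 ?_
      filter_upwards [hdis i j hij] with z hz hmem
      exact hz.elim hmem.1 hmem.2
    rw [measureReal_def, measure_iUnion₀ hd fun i => (hms _).nullMeasurableSet, tsum_fintype,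
      ENNReal.toReal_sum fun i _ => measure_ne_top _ _]
    refine (Finset.sum_congr rfl fun i _ => hx i).trans ?_
    simp
  have hQ0 : Q 0 := ⟨Fin.elim0, fun i => i.elim0, fun i => i.elim0⟩
  have hmax : ∃ n, Q n ∧ ¬Q (n + 1) := by
    by_contra! hne
    have hall : ∀ n, Q n := fun n => Nat.rec hQ0 (fun n ih => hne n ih) n
    obtain ⟨n, hn⟩ := exists_nat_gt (1 / a)
    obtain ⟨x, hx, hdis⟩ := hall n
    have h1 := hunion n x (fun i => (hx i).1) hdis
    have h2 : μ.real (⋃ i, {z | ¬G.Adj (x i) z}) ≤ 1 := measureReal_le_one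
    rw [div_lt_iff₀ ha] at hn
    linarith
  obtain ⟨n, ⟨x, hx, hdis⟩, hlast⟩ := hmax
  -- If the classes left a set of positive measure uncovered, a generic point of it would enlarge
  -- the maximal family.
  have hcover : ∀ᵐ z ∂μ, ∃ i, ¬G.Adj (x i) z := by
    by_contra hnc
    have hfreq : ∃ᶠ z in ae μ, ¬∃ i, ¬G.Adj (x i) z := not_eventually.1 hnc
    have hgen : ∀ᵐ y ∂μ, μ.real {z | ¬G.Adj y z} = a ∧ IsConsistent G μ y ∧
        ∀ i, G.Adj (x i) y → ∀ᵐ z ∂μ, G.Adj (x i) z ∨ G.Adj y z := by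
      have h1 : ∀ᵐ y ∂μ, ∀ i, G.Adj (x i) y → ∀ᵐ z ∂μ, G.Adj (x i) z ∨ G.Adj y z := by
        rw [ae_all_iff]
        intro i
        filter_upwards [(hx i).2] with y hy hadj
        filter_upwards [hy] with z hz
        by_contra hne
        rw [not_or] at hne
        exact hz.2.1 hne.1 (fun h => hne.2 h.symm) hadj
      filter_upwards [hae, h.ae_isConsistent hp hr hrs, h1] with y h2 h3 h4
      exact ⟨h2, h3, h4⟩
    obtain ⟨y, hy, hy1, hy2, hy3⟩ := (hfreq.and_eventually hgen).exists
    push Not at hy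
    refine hlast ⟨Fin.cons y x, ?_, ?_⟩
    · intro i
      refine Fin.cases ⟨hy1, hy2⟩ (fun i => ?_) i
      rw [Fin.cons_succ]
      exact hx i
    · intro i j
      refine Fin.cases ?_ (fun i => ?_) i <;> refine Fin.cases ?_ (fun j => ?_) j
      · exact fun h => absurd rfl h
      · intro _
        simp only [Fin.cons_zero, Fin.cons_succ]
        filter_upwards [hy3 j (hy j)] with z hz using hz.symm
      · intro _
        simp only [Fin.cons_zero, Fin.cons_succ]
        exact hy3 i (hy i)
      · intro hij
        simp only [Fin.cons_succ]
        exact hdis i j fun h => hij (by rw [h])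
  have hn1 : 1 ≤ n := by
    by_contra hn
    obtain rfl : n = 0 := by omega
    obtain ⟨z, i, -⟩ := hcover.exists
    exact i.elim0
  have hna : n * a = 1 := by
    rw [← hunion n x (fun i => (hx i).1) hdis]
    have : μ (⋃ i, {z | ¬G.Adj (x i) z})ᶜ = 0 := by
      refine measure_eq_zero_iff_ae_notMem.2 ?_
      filter_upwards [hcover] with z hz hmem
      simp only [Set.mem_compl_iff, Set.mem_iUnion] at hmem
      exact hmem hz
    rw [measureReal_def, (prob_compl_eq_zero_iff (MeasurableSet.iUnion fun i => hms _)).1 this,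
      ENNReal.toReal_one]
  have hna' : a = 1 / n := by
    have : (n : ℝ) ≠ 0 := by positivity
    field_simp
    linarith
  classical
  -- The colour is chosen from the finite pattern of adjacencies to the representatives, so it is
  -- measurable; the default value is used only on a null set.
  let g : (Fin n → Prop) → Fin n := fun P => if hP : ∃ i, P i then hP.choose else ⟨0, hn1⟩
  let π : Ω → Fin n := fun z => g fun i => ¬G.Adj (x i) z
  have hπ : Measurable π := by
    refine (measurable_of_countable g).comp (measurable_pi_lambda _ fun i => ?_)
    exact measurableSet_setOfPred.1 (hms (x i))
  have hchar : ∀ᵐ z ∂μ, ∀ i, π z = i ↔ ¬G.Adj (x i) z := by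
    have hdis' : ∀ᵐ z ∂μ, ∀ i j, i ≠ j → G.Adj (x i) z ∨ G.Adj (x j) z :=
      eventually_all.2 fun i => eventually_all.2 fun j =>
        eventually_imp_distrib_left.2 fun hij => hdis i j hij
    filter_upwards [hcover, hdis'] with z hz hd i
    have h1 : ¬G.Adj (x (π z)) z := by
      simp only [π, g, dif_pos hz]
      exact hz.choose_spec
    constructor
    · rintro rfl
      exact h1
    · intro h2
      by_contra hne
      exact (hd _ _ hne).elim h1 h2
  refine ⟨n, hn1, π, hπ, fun i => ?_, ?_⟩
  · rw [← hna', ← (hx i).1]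
    refine measureReal_congr ?_
    filter_upwards [hchar] with z hz
    exact propext (hz i)
  · have hmπ : MeasurableSet {q : Ω × Ω | G.Adj q.1 q.2 ↔ π q.1 ≠ π q.2} := by
      have h1 : MeasurableSet {q : Ω × Ω | π q.1 = π q.2} :=
        measurableSet_eq_fun (hπ.comp measurable_fst) (hπ.comp measurable_snd)
      exact (show MeasurableSet {z : Ω × Ω | G.Adj z.1 z.2} from hG).iff h1.compl
    refine (Measure.ae_prod_iff_ae_ae hmπ).2 ?_
    have hcons : ∀ᵐ z ∂μ, ∀ i, ∀ᵐ w ∂μ, (¬G.Adj (x i) z → ¬G.Adj z w → ¬G.Adj (x i) w) ∧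
        (¬G.Adj z (x i) → ¬G.Adj (x i) w → ¬G.Adj z w) := by
      rw [ae_all_iff]
      intro i
      filter_upwards [(hx i).2] with z hz
      filter_upwards [hz] with w hw using ⟨hw.1, hw.2.2⟩
    filter_upwards [hcons, hchar] with z hz hz'
    filter_upwards [hz (π z), hchar] with w hw hw'
    have h1 := (hz' (π z)).1 rfl
    constructor
    · intro hzw heq
      exact hw.2 (fun h => h1 h.symm) ((hw' (π z)).1 heq.symm) hzw
    · intro hne
      by_contra hzw
      exact hne ((hw' (π z)).2 (hw.1 h1 hzw)).symm

/-- An extremal measure is the blow-up of a clique of admissible size with equal weights, and this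
blow-up has the greatest density. -/
theorem exists_extremal_colouring (h : IsExtremal s r p K c G μ) (hp : 1 ≤ p) (hp3 : p ≤ 3)
    (hr : 2 ≤ r) (hrs : r < s) : ∃ n : ℕ, (∀ j ∈ K, n < j) ∧ equipartiteDensity s r p n = c ∧
      ∃ π : Ω → Fin n, Measurable π ∧ (∀ i, μ.real (π ⁻¹' {i}) = 1 / n) ∧
      ∀ᵐ q ∂μ.prod μ, G.Adj q.1 q.2 ↔ π q.1 ≠ π q.2 := by
  obtain ⟨n, -, π, hπ, hn, hadj⟩ := h.exists_colouring hp hp3 hr hrs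
  exact ⟨n, fun j hj => (aecliqueFree_iff_of_adj_iff hn hadj).1 (h.cliqueFree j hj),
    (blowupDensity_eq_of_adj_iff hπ hn hadj).symm.trans h.eq, π, hπ, hn, hadj⟩

end IsExtremal

end Inducibility

namespace Inducibility

open scoped NNReal ENNReal Nat

/-! ### Limits of the finite extremal densities -/

section FiniteSamples

variable {Ω : Type*} [MeasurableSpace Ω] {s r p q : ℕ} {K : Set ℕ} {c : ℝ}

theorem inducedDensity_le (hpq : s = p * r + q) (hq : q < r)
    (hp : 1 ≤ p) (hp3 : p ≤ 3) (hrs : r < s) (hs2 : 2 ≤ s) (hc : IsCliqueBound s r p K c) {n : ℕ}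
    (hn : s ≤ n) (G : SimpleGraph (Fin n)) (hG : ∀ j ∈ K, G.CliqueFree j) :
    inducedDensity (SimpleGraph.turanGraph s r) G ≤ (n : ℝ) ^ s / (s ! * n.choose s) * c := by
  have h1 := factorial_mul_inducedCopies_le_of_isCliqueBound hpq hq hp hp3 hrs hs2 hc
    (by omega : 1 ≤ n) G hG
  have h2 : (0 : ℝ) < n.choose s := by exact_mod_cast Nat.choose_pos hn
  have h3 : (0 : ℝ) < s ! := by exact_mod_cast Nat.factorial_pos s
  rw [inducedDensity, Nat.card_eq_fintype_card, Nat.card_eq_fintype_card, Fintype.card_fin,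
    Fintype.card_fin, div_mul_eq_mul_div, div_le_div_iff₀ h2 (by positivity)]
  nlinarith

/-- Some sample outside the null set does at least as well as the mean, for every `n ≥ s`. -/
theorem exists_le_inducedDensity (hpq : s = p * r + q) (hq : q < r) {G : SimpleGraph Ω}
    (hG : MeasurableAdj G) (ν : Measure Ω) [IsProbabilityMeasure ν]
    (hν : ∀ j ∈ K, AECliqueFree G ν j) {n : ℕ} (hn : s ≤ n) :
    ∃ H : SimpleGraph (Fin n), (∀ j ∈ K, H.CliqueFree j) ∧
      blowupDensity (Fin s) r p G ν ≤ inducedDensity (SimpleGraph.turanGraph s r) H := by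
  obtain ⟨hint, hval⟩ := integral_inducedCopies hpq hq hG ν n
  have hfree : ∀ᵐ t ∂(Measure.pi fun _ : Fin n => ν), ∀ j ∈ K, (G.comap t).CliqueFree j := by
    rw [ae_ball_iff K.to_countable]
    exact fun j hj => (hν j hj).ae_cliqueFree (Fin n)
  obtain ⟨t, ht, hle⟩ := exists_notMem_null_integral_le hint (ae_iff.1 hfree)
  refine ⟨G.comap t, not_not.1 ht, ?_⟩
  have h2 : (0 : ℝ) < n.choose s := by exact_mod_cast Nat.choose_pos hn
  rw [inducedDensity, Nat.card_eq_fintype_card, Nat.card_eq_fintype_card, Fintype.card_fin,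
    Fintype.card_fin, le_div_iff₀ h2, mul_comm, ← hval]
  exact hle

theorem hasInducibility_of_bounds {F : SimpleGraph (Fin s)}
    (hle : ∀ n, s ≤ n → ∀ G : SimpleGraph (Fin n),
      inducedDensity F G ≤ (n : ℝ) ^ s / (s ! * n.choose s) * c)
    (hge : ∀ n, s ≤ n → ∃ G : SimpleGraph (Fin n), c ≤ inducedDensity F G) :
    HasInducibility F c := by
  have hlim : Tendsto (fun n : ℕ => (n : ℝ) ^ s / (s ! * n.choose s) * c) atTop (𝓝 c) := by
    simpa using (tendsto_pow_div_choose s).mul_const c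
  refine tendsto_of_tendsto_of_tendsto_of_le_of_le' tendsto_const_nhds hlim ?_ ?_
  · filter_upwards [eventually_ge_atTop s] with n hn
    obtain ⟨G, hG⟩ := hge n hn
    exact hG.trans (le_ciSup (f := fun G => inducedDensity F G) (Set.finite_range _).bddAbove G)
  · filter_upwards [eventually_ge_atTop s] with n hn
    exact ciSup_le fun G => hle n hn G

theorem hasCliqueFreeInducibility_of_bounds {k : ℕ} {F : SimpleGraph (Fin s)}
    (hle : ∀ n, s ≤ n → ∀ G : SimpleGraph (Fin n), G.CliqueFree k →
      inducedDensity F G ≤ (n : ℝ) ^ s / (s ! * n.choose s) * c)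
    (hge : ∀ n, s ≤ n → ∃ G : SimpleGraph (Fin n), G.CliqueFree k ∧ c ≤ inducedDensity F G) :
    HasCliqueFreeInducibility k F c := by
  have hlim : Tendsto (fun n : ℕ => (n : ℝ) ^ s / (s ! * n.choose s) * c) atTop (𝓝 c) := by
    simpa using (tendsto_pow_div_choose s).mul_const c
  refine tendsto_of_tendsto_of_tendsto_of_le_of_le' tendsto_const_nhds hlim ?_ ?_
  · filter_upwards [eventually_ge_atTop s] with n hn
    obtain ⟨G, hGk, hG⟩ := hge n hn
    exact hG.trans (le_ciSup (f := fun G : {G : SimpleGraph (Fin n) // G.CliqueFree k} =>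
      inducedDensity F G.1) (Set.finite_range _).bddAbove ⟨G, hGk⟩)
  · filter_upwards [eventually_ge_atTop s] with n hn
    obtain ⟨G, hGk, -⟩ := hge n hn
    have : Nonempty {G : SimpleGraph (Fin n) // G.CliqueFree k} := ⟨⟨G, hGk⟩⟩
    exact ciSup_le fun G => hle n hn G.1 G.2

end FiniteSamples

/-! ### Graphons as measurable graphs; the equipartite graphon -/

namespace Graphon

/-- The graph on `[0,1]` in which distinct points `a`, `b` with `W(a,b) = 1` are adjacent. -/
def pointGraph (W : Graphon) : SimpleGraph unitInterval := W.graphOn id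

theorem measurableAdj_pointGraph (W : Graphon) : MeasurableAdj W.pointGraph := by
  have h1 : MeasurableSet {z : unitInterval × unitInterval | z.1 ≠ z.2} :=
    (measurableSet_eq_fun measurable_fst measurable_snd).compl
  exact h1.inter (W.measurable (measurableSet_singleton 1))

theorem ae_prod_ne : ∀ᵐ q ∂(volume : Measure unitInterval).prod volume, q.1 ≠ q.2 := by
  have h1 : MeasurableSet {z : unitInterval × unitInterval | z.1 ≠ z.2} :=
    (measurableSet_eq_fun measurable_fst measurable_snd).compl
  refine (Measure.ae_prod_iff_ae_ae h1).2 (Eventually.of_forall fun x => ?_)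
  have : ∀ᵐ y : unitInterval, y ∉ ({x} : Set unitInterval) :=
    measure_eq_zero_iff_ae_notMem.1 (measure_singleton x)
  filter_upwards [this] with y hy h
  exact hy h.symm

/-- One side requires distinct indices, the other distinct points; coincidences of points are null.
-/
theorem ae_graphOn_eq (W : Graphon) (V : Type*) [Fintype V] :
    ∀ᵐ x ∂Measure.pi fun _ : V => (volume : Measure unitInterval),
      W.graphOn x = W.pointGraph.comap x := by
  filter_upwards [ae_pi_pairwise (V := V) (Q := fun a b => a ≠ b) ae_prod_ne] with x hx
  ext u v
  constructor
  · exact fun h => ⟨hx u v h.1, h.2⟩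
  · exact fun h => ⟨fun huv => h.1 (by rw [huv]), h.2⟩

theorem density_turanGraph (W : Graphon) {s r p q : ℕ} (hpq : s = p * r + q) (hq : q < r) :
    W.density (SimpleGraph.turanGraph s r) = blowupDensity (Fin s) r p W.pointGraph volume := by
  rw [density, blowupDensity, volume_pi]
  refine measureReal_congr ?_
  filter_upwards [W.ae_graphOn_eq (Fin s)] with x hx
  apply propext
  change Nonempty (W.graphOn x ≃g SimpleGraph.turanGraph s r) ↔
    IsBalanced r p (W.pointGraph.comap x)
  rw [hx]
  exact nonempty_iso_turanGraph_iff hpq hq (Fintype.card_fin s) _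

theorem cliqueFree_iff (W : Graphon) (k : ℕ) :
    W.CliqueFree k ↔ AECliqueFree W.pointGraph volume k := by
  rw [CliqueFree, density, volume_pi, measureReal_eq_zero_iff (measure_ne_top _ _),
    measure_eq_zero_iff_ae_notMem, AECliqueFree]
  refine eventually_congr ?_
  filter_upwards [W.ae_graphOn_eq (Fin k)] with x hx
  rw [hx, not_iff_not]
  constructor
  · rintro ⟨e⟩
    ext u v
    rw [← e.map_adj_iff]
    simp
  · intro h
    rw [h]
    exact ⟨SimpleGraph.Iso.refl⟩

/-- The index of the part of the equipartite graphon that contains a point. -/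
noncomputable def partIndex (l : ℕ) (a : unitInterval) : ℕ := min ⌊l * (a : ℝ)⌋₊ (l - 1)

/-- The cap `l - 1` matters only at the endpoint `a = 1`, and it is invisible here because `j < l`.
-/
theorem le_partIndex_iff {l j : ℕ} (hj : j < l) (a : unitInterval) :
    j ≤ partIndex l a ↔ (j : ℝ) / l ≤ a := by
  have hl : (0 : ℝ) < l := by exact_mod_cast (by omega : 0 < l)
  rw [partIndex, le_min_iff, Nat.le_floor_iff (mul_nonneg hl.le a.2.1), div_le_iff₀ hl, mul_comm]
  exact and_iff_left (by omega)

theorem partIndex_lt {l : ℕ} (hl : 0 < l) (a : unitInterval) : partIndex l a < l :=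
  lt_of_le_of_lt (min_le_right _ _) (by omega)

theorem partIndex_mono (l : ℕ) : Monotone (partIndex l) := fun a b hab =>
  min_le_min_right _ (Nat.floor_mono (mul_le_mul_of_nonneg_left hab (by positivity)))

/-- The cut points are `j / l` with `j < l`; the cut at `0` separates nothing, and any other cut
between two points is counted by their part indices. -/
theorem equipartite_eq_one_iff {l : ℕ} (hl : 0 < l) (a b : unitInterval) :
    (equipartite l).toFun a b = 1 ↔ partIndex l a ≠ partIndex l b := by
  have hsum : ∀ j : Fin l, ∑ _i ∈ Finset.Iio j, (1 : ℝ) / l = (j : ℕ) / l := by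
    intro j
    rw [Finset.sum_const, Fin.card_Iio, nsmul_eq_mul, mul_one_div]
  have key : ∀ a b : unitInterval, a ≤ b → ((∃ j : Fin l, (a : ℝ) < (j : ℕ) / l ∧
      ((j : ℕ) : ℝ) / l ≤ b) ↔ partIndex l a ≠ partIndex l b) := by
    intro a b hab
    constructor
    · rintro ⟨j, h1, h2⟩
      rw [← le_partIndex_iff j.2] at h2
      rw [← not_le, ← le_partIndex_iff j.2] at h1
      omega
    · intro hne
      have hlt := lt_of_le_of_ne (partIndex_mono l hab) hne
      refine ⟨⟨partIndex l b, partIndex_lt hl b⟩, ?_, ?_⟩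
      · rw [← not_le, ← le_partIndex_iff (partIndex_lt hl b), not_le]
        exact hlt
      · exact (le_partIndex_iff (partIndex_lt hl b) b).1 le_rfl
  have h1 : (equipartite l).toFun a b = 1 ↔ ∃ j : Fin l, min (a : ℝ) b < (j : ℕ) / l ∧
      ((j : ℕ) : ℝ) / l ≤ max (a : ℝ) b := by
    simp only [equipartite, completePartite, hsum]
    split_ifs with h
    · exact iff_of_true rfl h
    · exact iff_of_false (by decide) h
  rw [h1]
  rcases le_total a b with hab | hab
  · have hab' : (a : ℝ) ≤ b := hab
    rw [min_eq_left hab', max_eq_right hab']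
    exact key a b hab
  · have hab' : (b : ℝ) ≤ a := hab
    rw [min_eq_right hab', max_eq_left hab', ne_comm]
    exact key b a hab

theorem measurable_partIndex (l : ℕ) : Measurable (partIndex l) :=
  (Nat.measurable_floor.comp (measurable_const.mul measurable_subtype_coe)).min measurable_const

theorem volume_le_partIndex {l j : ℕ} (hl : 0 < l) (hj : j ≤ l) :
    (volume : Measure unitInterval).real {a | j ≤ partIndex l a} = 1 - (j : ℝ) / l := by
  have hl' : (0 : ℝ) < l := by exact_mod_cast hl
  rcases hj.lt_or_eq with h | rfl
  · have hmem : (j : ℝ) / l ∈ unitInterval :=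
      ⟨by positivity, by rw [div_le_one hl']; exact_mod_cast hj⟩
    have : {a : unitInterval | j ≤ partIndex l a} = Set.Ici ⟨(j : ℝ) / l, hmem⟩ := by
      ext a
      exact le_partIndex_iff h a
    rw [this, measureReal_def, unitInterval.volume_Ici, ENNReal.toReal_ofReal]
    have := hmem.2
    simp only
    linarith
  · have : {a : unitInterval | j ≤ partIndex j a} = ∅ := by
      ext a
      simp [partIndex_lt hl a]
    rw [this, div_self hl'.ne']
    simp

/-- The part of the equipartite graphon that contains a point. -/
noncomputable def part {l : ℕ} (hl : 0 < l) (a : unitInterval) : Fin l :=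
  ⟨partIndex l a, partIndex_lt hl a⟩

theorem measurable_part {l : ℕ} (hl : 0 < l) : Measurable (part hl) :=
  measurable_to_countable' fun i => by
    have : part hl ⁻¹' {i} = partIndex l ⁻¹' {(i : ℕ)} := by
      ext a
      simp [part, Fin.ext_iff]
    rw [this]
    exact measurable_partIndex l (measurableSet_singleton _)

theorem volume_part {l : ℕ} (hl : 0 < l) (i : Fin l) :
    (volume : Measure unitInterval).real (part hl ⁻¹' {i}) = 1 / l := by
  have h1 : part hl ⁻¹' {i} =
      {a | (i : ℕ) ≤ partIndex l a} \ {a | (i : ℕ) + 1 ≤ partIndex l a} := by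
    ext a
    simp only [part, Set.mem_preimage, Set.mem_singleton_iff, Fin.ext_iff, Set.mem_sdiff,
      Set.mem_ofPred_eq]
    omega
  rw [h1, measureReal_sdiff, volume_le_partIndex hl i.2.le, volume_le_partIndex hl i.2]
  · push_cast
    ring
  · intro a ha
    simp only [Set.mem_ofPred_eq] at ha ⊢
    omega
  · exact measurable_partIndex l measurableSet_Ici

theorem equipartite_adj_iff {l : ℕ} (hl : 0 < l) (a b : unitInterval) :
    (equipartite l).pointGraph.Adj a b ↔ part hl a ≠ part hl b := by
  have h1 := equipartite_eq_one_iff hl a b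
  have h2 : part hl a ≠ part hl b ↔ partIndex l a ≠ partIndex l b := by
    simp [part]
  rw [h2]
  constructor
  · exact fun h => h1.1 h.2
  · exact fun h => ⟨fun hab => h (by rw [show a = b from hab]), h1.2 h⟩

end Graphon

end Inducibility

namespace Inducibility

/-! ### Rearranging colour classes into intervals -/

namespace Graphon

/-- The distribution function of the restriction of the uniform measure to `P`. -/
noncomputable def distFun (P : Set unitInterval) (x : unitInterval) : ℝ :=
  (volume : Measure unitInterval).real (P ∩ Set.Iic x)

theorem distFun_mono (P : Set unitInterval) : Monotone (distFun P) := fun _ _ hxy =>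
  measureReal_mono (Set.inter_subset_inter_right P (Set.Iic_subset_Iic.2 hxy)) (measure_ne_top _ _)

/-- This Lipschitz bound makes the distribution function continuous, whatever the set `P`. -/
theorem distFun_le_add_dist (P : Set unitInterval) (x y : unitInterval) :
    distFun P x ≤ distFun P y + dist x y := by
  rcases le_total x y with hxy | hxy
  · exact (distFun_mono P hxy).trans (le_add_of_nonneg_right dist_nonneg)
  · have h1 : P ∩ Set.Iic x ⊆ (P ∩ Set.Iic y) ∪ Set.Ioc y x := by
      rintro z ⟨hz, hzx⟩
      rcases le_or_gt z y with h | h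
      · exact Or.inl ⟨hz, h⟩
      · exact Or.inr ⟨h, hzx⟩
    have h2 : (volume : Measure unitInterval).real (Set.Ioc y x) = dist x y := by
      have hxy' : (y : ℝ) ≤ x := hxy
      rw [measureReal_def, unitInterval.volume_Ioc, ENNReal.toReal_ofReal (by linarith),
        Subtype.dist_eq, Real.dist_eq, abs_of_nonneg (by linarith)]
    rw [← h2]
    exact (measureReal_mono h1 (measure_ne_top _ _)).trans (measureReal_union_le _ _)

theorem continuous_distFun (P : Set unitInterval) : Continuous (distFun P) :=
  (LipschitzWith.of_le_add (distFun_le_add_dist P)).continuous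

theorem distFun_one (P : Set unitInterval) :
    distFun P 1 = (volume : Measure unitInterval).real P := by
  rw [distFun, show Set.Iic (1 : unitInterval) = Set.univ from Set.eq_univ_of_forall
    fun x => unitInterval.le_one', Set.inter_univ]

theorem distFun_zero (P : Set unitInterval) : distFun P 0 = 0 := by
  rw [distFun, measureReal_eq_zero_iff (measure_ne_top _ _)]
  refine measure_mono_null (t := {0}) ?_ (measure_singleton _)
  rintro x ⟨-, hx⟩
  exact le_antisymm hx unitInterval.nonneg'

theorem distFun_nonneg (P : Set unitInterval) (x : unitInterval) : 0 ≤ distFun P x :=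
  measureReal_nonneg

theorem distFun_le (P : Set unitInterval) (x : unitInterval) :
    distFun P x ≤ (volume : Measure unitInterval).real P :=
  measureReal_mono Set.inter_subset_left (measure_ne_top _ _)

/-- On `P`, the distribution function is uniformly distributed. -/
theorem volume_distFun_le (P : Set unitInterval) {d : ℝ} (h0 : 0 ≤ d)
    (hd : d ≤ (volume : Measure unitInterval).real P) :
    (volume : Measure unitInterval).real (P ∩ {x | distFun P x ≤ d}) = d := by
  have hcont := continuous_distFun P
  refine le_antisymm ?_ ?_
  -- The sublevel set has a greatest point `y`, where the function is still at most `d`; the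
  -- converse bound uses a point where the value `d` is attained.
  · have hclosed : IsClosed {x | distFun P x ≤ d} := isClosed_le hcont continuous_const
    obtain ⟨y, hy, hmax⟩ := hclosed.isCompact.exists_isGreatest
      ⟨0, by rw [Set.mem_ofPred_eq, distFun_zero]; exact h0⟩
    refine le_trans (measureReal_mono ?_ (measure_ne_top _ _)) hy
    exact Set.inter_subset_inter_right P fun x hx => hmax hx
  · obtain ⟨y, hy⟩ : d ∈ Set.range (distFun P) := mem_range_of_exists_le_of_exists_ge hcont
      ⟨0, by rw [distFun_zero]; exact h0⟩ ⟨1, by rw [distFun_one]; exact hd⟩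
    conv_lhs => rw [← hy]
    refine measureReal_mono ?_ (measure_ne_top _ _)
    exact Set.inter_subset_inter_right P fun x hx => (distFun_mono P hx).trans hy.le

variable {l : ℕ} {π : unitInterval → Fin l}

/-- The rearrangement that moves the colour classes of `π` to consecutive intervals. -/
noncomputable def sortFun (π : unitInterval → Fin l) (x : unitInterval) : ℝ :=
  (π x : ℕ) / l + distFun (π ⁻¹' {π x}) x

theorem sortFun_le (hn : ∀ i, (volume : Measure unitInterval).real (π ⁻¹' {i}) = 1 / l)
    (x : unitInterval) : sortFun π x ≤ ((π x : ℕ) + 1) / l := by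
  have := distFun_le (π ⁻¹' {π x}) x
  rw [hn] at this
  rw [sortFun, add_div]
  linarith

theorem sortFun_mem (hn : ∀ i, (volume : Measure unitInterval).real (π ⁻¹' {i}) = 1 / l)
    (x : unitInterval) : sortFun π x ∈ unitInterval := by
  have hl : (0 : ℝ) < l := by exact_mod_cast (π x).pos
  refine ⟨add_nonneg (by positivity) (distFun_nonneg _ _), (sortFun_le hn x).trans ?_⟩
  rw [div_le_one hl]
  exact_mod_cast (π x).isLt

theorem measurable_sortFun (hπ : Measurable π) : Measurable (sortFun π) := by
  have h1 : Measurable fun q : Fin l × unitInterval =>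
      ((q.1 : ℕ) : ℝ) / l + distFun (π ⁻¹' {q.1}) q.2 :=
    measurable_from_prod_countable_right fun i =>
      (continuous_distFun (π ⁻¹' {i})).measurable.const_add (((i : ℕ) : ℝ) / l)
  exact h1.comp (hπ.prodMk measurable_id)

/-- Written as a difference of minima, so that the sum over the classes telescopes to `a`. -/
theorem volume_sortFun_le_inter
    (hn : ∀ i, (volume : Measure unitInterval).real (π ⁻¹' {i}) = 1 / l) (i : Fin l)
    {a : ℝ} : (volume : Measure unitInterval).real (π ⁻¹' {i} ∩ {x | sortFun π x ≤ a}) =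
      min a (((i : ℕ) + 1 : ℕ) / l) - min a ((i : ℕ) / l) := by
  have h1 : π ⁻¹' {i} ∩ {x | sortFun π x ≤ a} =
      π ⁻¹' {i} ∩ {x | distFun (π ⁻¹' {i}) x ≤ a - (i : ℕ) / l} := by
    ext x
    simp only [Set.mem_inter_iff, Set.mem_preimage, Set.mem_singleton_iff, Set.mem_ofPred_eq]
    refine and_congr_right fun hx => ?_
    rw [sortFun, hx, le_sub_iff_add_le, add_comm]
  have hstep : (((i : ℕ) + 1 : ℕ) : ℝ) / l = (i : ℕ) / l + 1 / l := by
    push_cast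
    rw [add_div]
  have hpos : (0 : ℝ) ≤ 1 / l := by positivity
  rw [h1, hstep]
  rcases lt_or_ge a ((i : ℕ) / l) with h | h
  · rw [min_eq_left h.le, min_eq_left (by linarith), sub_self]
    have : π ⁻¹' {i} ∩ {x | distFun (π ⁻¹' {i}) x ≤ a - (i : ℕ) / l} = ∅ := by
      ext x
      simp only [Set.mem_inter_iff, Set.mem_ofPred_eq, Set.mem_empty_iff_false, iff_false, not_and,
        not_le]
      intro _
      have := distFun_nonneg (π ⁻¹' {i}) x
      linarith
    rw [this, measureReal_empty]
  · rw [min_eq_right h]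
    rcases le_total a ((i : ℕ) / l + 1 / l) with h' | h'
    · rw [min_eq_left h']
      exact volume_distFun_le _ (by linarith) (by rw [hn]; linarith)
    · rw [min_eq_right h']
      have : π ⁻¹' {i} ∩ {x | distFun (π ⁻¹' {i}) x ≤ a - (i : ℕ) / l} = π ⁻¹' {i} := by
        refine Set.inter_eq_left.2 fun x _ => ?_
        have := distFun_le (π ⁻¹' {i}) x
        rw [hn] at this
        simp only [Set.mem_ofPred_eq]
        linarith
      rw [this, hn]
      ring

theorem measurePreserving_sortFun (hπ : Measurable π)
    (hn : ∀ i, (volume : Measure unitInterval).real (π ⁻¹' {i}) = 1 / l) :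
    MeasurePreserving (fun x => (⟨sortFun π x, sortFun_mem hn x⟩ : unitInterval)) := by
  have hm : Measurable (fun x => (⟨sortFun π x, sortFun_mem hn x⟩ : unitInterval)) :=
    (measurable_sortFun hπ).subtype_mk
  refine ⟨hm, Measure.ext_of_Iic _ _ fun a => ?_⟩
  have hl : (0 : ℝ) < l := by exact_mod_cast (π 0).pos
  have hms : MeasurableSet {x | sortFun π x ≤ a} :=
    measurableSet_le (measurable_sortFun hπ) measurable_const
  have h1 : (volume : Measure unitInterval).real {x | sortFun π x ≤ a} = a := by
    have h2 := sum_measureReal_preimage_singleton (μ := volume.restrict {x | sortFun π x ≤ a})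
      (Finset.univ : Finset (Fin l)) (f := π) fun i _ => hπ (measurableSet_singleton i)
    rw [Finset.coe_univ, Set.preimage_univ, measureReal_restrict_apply_univ] at h2
    rw [← h2, Finset.sum_congr rfl fun i _ => (measureReal_restrict_apply
      (hπ (measurableSet_singleton i))).trans (volume_sortFun_le_inter hn i),
      Fin.sum_univ_eq_sum_range (fun i => min (a : ℝ) ((i + 1 : ℕ) / l) - min (a : ℝ) (i / l)) l,
      Finset.sum_range_sub (fun i => min (a : ℝ) (i / l)), div_self hl.ne']
    simp [a.2.1, a.2.2]
  rw [Measure.map_apply hm measurableSet_Iic, unitInterval.volume_Iic, ← h1,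
    ofReal_measureReal (measure_ne_top _ _)]
  rfl

/-- Points sent to a cut `j / l` could fall into the next interval; they form a null set because the
map preserves measure. -/
theorem ae_part_sortFun (hl : 0 < l) (hπ : Measurable π)
    (hn : ∀ i, (volume : Measure unitInterval).real (π ⁻¹' {i}) = 1 / l) :
    ∀ᵐ x : unitInterval, part hl ⟨sortFun π x, sortFun_mem hn x⟩ = π x := by
  have h1 : ∀ᵐ y : unitInterval, ∀ j : ℕ, (y : ℝ) ≠ j / l := by
    rw [ae_all_iff]
    intro j
    refine measure_mono_null (t := Subtype.val ⁻¹' {(j : ℝ) / l}) (fun y hy => by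
      simpa using hy) ?_
    exact Set.Subsingleton.measure_zero
      (Set.subsingleton_singleton.preimage Subtype.val_injective) _
  filter_upwards [(measurePreserving_sortFun hπ hn).quasiMeasurePreserving.ae h1] with x hx
  refine Fin.ext (le_antisymm ?_ ?_)
  · change partIndex l _ ≤ π x
    rw [← Nat.lt_succ_iff]
    rcases Nat.lt_or_ge ((π x : ℕ) + 1) l with h | h
    · rw [← not_le, Nat.succ_eq_add_one, le_partIndex_iff h, not_le]
      refine lt_of_le_of_ne ?_ (hx _)
      push_cast
      exact sortFun_le hn x
    · exact (partIndex_lt hl _).trans_le h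
  · change (π x : ℕ) ≤ partIndex l _
    rw [le_partIndex_iff (π x).isLt]
    exact le_add_of_nonneg_right (distFun_nonneg _ _)

/-- A graphon given by a colouring with classes of equal measure is equipartite up to
rearrangement. -/
theorem isRearrangement_equipartite (W : Graphon) (hl : 0 < l) (hπ : Measurable π)
    (hn : ∀ i, (volume : Measure unitInterval).real (π ⁻¹' {i}) = 1 / l)
    (hadj : ∀ᵐ q ∂(volume : Measure unitInterval).prod volume,
      W.pointGraph.Adj q.1 q.2 ↔ π q.1 ≠ π q.2) : W.IsRearrangement (equipartite l) := by
  refine ⟨_, measurePreserving_sortFun hπ hn, ?_⟩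
  have h1 := ae_part_sortFun hl hπ hn
  rw [Measure.volume_eq_prod]
  filter_upwards [hadj, ae_prod_ne, Measure.quasiMeasurePreserving_fst.ae h1,
    Measure.quasiMeasurePreserving_snd.ae h1] with z hz hne h2 h3
  have h4 : W.toFun z.1 z.2 = 1 ↔ π z.1 ≠ π z.2 := by
    rw [← hz]
    exact ⟨fun h => ⟨hne, h⟩, fun h => h.2⟩
  have h5 := equipartite_eq_one_iff hl ⟨sortFun π z.1, sortFun_mem hn z.1⟩
    ⟨sortFun π z.2, sortFun_mem hn z.2⟩
  rw [← h2, ← h3] at h4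
  have h6 : W.toFun z.1 z.2 = 1 ↔ (equipartite l).toFun ⟨sortFun π z.1, sortFun_mem hn z.1⟩
      ⟨sortFun π z.2, sortFun_mem hn z.2⟩ = 1 := by
    rw [h4, h5]
    simp [part]
  omega

variable {s r p q : ℕ} {K : Set ℕ} {c : ℝ}

theorem ae_adj_equipartite (hl : 0 < l) : ∀ᵐ z ∂(volume : Measure unitInterval).prod volume,
    (equipartite l).pointGraph.Adj z.1 z.2 ↔ part hl z.1 ≠ part hl z.2 :=
  Eventually.of_forall fun _ => equipartite_adj_iff hl _ _

theorem density_equipartite (hpq : s = p * r + q) (hq : q < r) (hl : 0 < l) :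
    (equipartite l).density (SimpleGraph.turanGraph s r) = equipartiteDensity s r p l := by
  rw [density_turanGraph _ hpq hq]
  exact blowupDensity_eq_of_adj_iff (measurable_part hl) (volume_part hl) (ae_adj_equipartite hl)

theorem aecliqueFree_equipartite (hl : 0 < l) (j : ℕ) :
    AECliqueFree (equipartite l).pointGraph volume j ↔ l < j :=
  aecliqueFree_iff_of_adj_iff (volume_part hl) (ae_adj_equipartite hl)

/-- Since `l` is the only optimal number of parts allowed by `K`, `W` is extremal, and the clique of
which it is a blow-up must have `l` vertices. -/
theorem isRearrangement_of_density_eq (hpq : s = p * r + q) (hq : q < r) (hp : 1 ≤ p)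
    (hp3 : p ≤ 3) (hr : 2 ≤ r) (hrs : r < s) (hl : 0 < l)
    (hpos : 0 < equipartiteDensity s r p l)
    (hlt : ∀ n, (∀ j ∈ K, n < j) → n ≠ l → equipartiteDensity s r p n < equipartiteDensity s r p l)
    (W : Graphon) (hW : ∀ j ∈ K, W.CliqueFree j)
    (hd : W.density (SimpleGraph.turanGraph s r) = equipartiteDensity s r p l) :
    W.IsRearrangement (equipartite l) := by
  have hbound : IsCliqueBound s r p K (equipartiteDensity s r p l) := fun n hn => by
    by_cases h : n = l
    · rw [h]
    · exact (hlt n hn h).le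
  have hfree : ∀ j ∈ K, AECliqueFree W.pointGraph volume j := fun j hj =>
    (W.cliqueFree_iff j).1 (hW j hj)
  have hext : IsExtremal s r p K (equipartiteDensity s r p l) W.pointGraph volume :=
    ⟨W.measurableAdj_pointGraph, hfree, (W.density_turanGraph hpq hq).symm.trans hd,
      fun ν _ hν => blowupDensity_le hpq hq hp hp3 hrs (by omega) hbound
        W.measurableAdj_pointGraph ν hν, hpos⟩
  obtain ⟨n, hnK, hn, π, hπ, hπn, hadj⟩ := hext.exists_extremal_colouring hp hp3 hr hrs
  obtain rfl : n = l := by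
    by_contra h
    exact (hlt n hnK h).ne hn
  exact W.isRearrangement_equipartite hl hπ hπn hadj

end Graphon

end Inducibility
-- The theorem: forbidden sizes `{k}` for `i_k` and `∅` for `i`
theorem theorem1p6 (r s p q : ℕ) (hr : 2 ≤ r) (hrs : r < s) (hs : s ≤ 3 * r + 1)
    (hpq : s = p * r + q) (hq : q < r) :
    ∃ t : ℕ,
      IsGreatest {n : ℕ | n = r ∨
        (r < n ∧ (1 : ℝ) < (n : ℝ) / ((n : ℝ) - r) * (1 - 1 / (n : ℝ)) ^ s)} t ∧
      (∀ k l : ℕ, r < k → l = min (k - 1) t →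
        ∃ c : ℝ,
          c = ((l.factorial : ℝ) * s.factorial) /
            ((l - r).factorial * (r - q).factorial * q.factorial * (p.factorial : ℝ) ^ r *
              ((p : ℝ) + 1) ^ q * (l : ℝ) ^ s) ∧
          Inducibility.HasCliqueFreeInducibility k (SimpleGraph.turanGraph s r) c ∧
          (Inducibility.Graphon.equipartite l).CliqueFree k ∧
          (Inducibility.Graphon.equipartite l).density (SimpleGraph.turanGraph s r) = c ∧
          ∀ W : Inducibility.Graphon, W.CliqueFree k →
            W.density (SimpleGraph.turanGraph s r) = c →
            W.IsRearrangement (Inducibility.Graphon.equipartite l)) ∧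
      ∃ c : ℝ,
        c = ((t.factorial : ℝ) * s.factorial) /
          ((t - r).factorial * (r - q).factorial * q.factorial * (p.factorial : ℝ) ^ r *
            ((p : ℝ) + 1) ^ q * (t : ℝ) ^ s) ∧
        Inducibility.HasInducibility (SimpleGraph.turanGraph s r) c ∧
        (Inducibility.Graphon.equipartite t).density (SimpleGraph.turanGraph s r) = c ∧
        ∀ W : Inducibility.Graphon,
          W.density (SimpleGraph.turanGraph s r) = c →
          W.IsRearrangement (Inducibility.Graphon.equipartite t) := by
  obtain ⟨t, ht, hrt, hmono, hdec⟩ :=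
    Inducibility.exists_isGreatest_equipartiteDensity hr hrs hpq hq
  have hp : 1 ≤ p := by
    rcases Nat.eq_zero_or_pos p with h | h
    · subst h
      omega
    · exact h
  have hp3 : p ≤ 3 := by
    by_contra h
    -- If `p ≥ 4`, then `4r ≤ s ≤ 3r + 1`, against `r ≥ 2`.
    have : 4 * r ≤ p * r := Nat.mul_le_mul_right r (by omega)
    omega
  have hs2 : 2 ≤ s := by omega
  refine ⟨t, ht, fun k l hk hl => ?_, ?_⟩
  · have hrl : r ≤ l := by omega
    have hl0 : 0 < l := by omega
    have hpos := Inducibility.equipartiteDensity_pos hp hpq hq hrl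
    have hlt : ∀ n, (∀ j ∈ ({k} : Set ℕ), n < j) → n ≠ l →
        Inducibility.equipartiteDensity s r p n < Inducibility.equipartiteDensity s r p l := by
      intro n hn hne
      have hnk : n < k := hn k rfl
      rcases Nat.lt_or_ge n l with h | h
      · exact hmono l n hrl h (by omega)
      -- Here `l < n ≤ k - 1`, so the minimum defining `l` is `t`.
      · obtain rfl : l = t := by omega
        exact hdec n (by omega)
    have hbound : Inducibility.IsCliqueBound s r p {k}
        (Inducibility.equipartiteDensity s r p l) := fun n hn => by
      by_cases h : n = l
      · rw [h]
      · exact (hlt n hn h).le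
    have hfree : ∀ j ∈ ({k} : Set ℕ), Inducibility.AECliqueFree
        (Inducibility.Graphon.equipartite l).pointGraph volume j := by
      rintro j rfl
      exact (Inducibility.Graphon.aecliqueFree_equipartite hl0 j).2 (by omega)
    have hdens := Inducibility.Graphon.density_equipartite hpq hq hl0
    refine ⟨_, Inducibility.equipartiteDensity_eq hp hpq hq hrl ▸ rfl, ?_,
      (Inducibility.Graphon.cliqueFree_iff _ _).2 (hfree k rfl), hdens, fun W hW hd =>
      Inducibility.Graphon.isRearrangement_of_density_eq hpq hq hp hp3 hr hrs hl0 hpos hlt W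
        (by rintro j rfl; exact hW) hd⟩
    refine Inducibility.hasCliqueFreeInducibility_of_bounds (fun n hn G hG =>
      Inducibility.inducedDensity_le hpq hq hp hp3 hrs hs2 hbound hn G
        (by rintro j rfl; exact hG)) fun n hn => ?_
    obtain ⟨H, hH, hle⟩ := Inducibility.exists_le_inducedDensity hpq hq
      (Inducibility.Graphon.measurableAdj_pointGraph _) volume hfree hn
    rw [← Inducibility.Graphon.density_turanGraph _ hpq hq, hdens] at hle
    exact ⟨H, hH k rfl, hle⟩
  · have ht0 : 0 < t := by omega
    have hpos := Inducibility.equipartiteDensity_pos hp hpq hq hrt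
    have hlt : ∀ n, (∀ j ∈ (∅ : Set ℕ), n < j) → n ≠ t →
        Inducibility.equipartiteDensity s r p n < Inducibility.equipartiteDensity s r p t := by
      intro n _ hne
      rcases Nat.lt_or_ge n t with h | h
      · exact hmono t n hrt h le_rfl
      · exact hdec n (by omega)
    have hbound : Inducibility.IsCliqueBound s r p ∅
        (Inducibility.equipartiteDensity s r p t) := fun n hn => by
      by_cases h : n = t
      · rw [h]
      · exact (hlt n hn h).le
    have hdens := Inducibility.Graphon.density_equipartite hpq hq ht0
    refine ⟨_, Inducibility.equipartiteDensity_eq hp hpq hq hrt ▸ rfl, ?_, hdens, fun W hd =>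
      Inducibility.Graphon.isRearrangement_of_density_eq hpq hq hp hp3 hr hrs ht0 hpos hlt W
        (by simp) hd⟩
    refine Inducibility.hasInducibility_of_bounds (fun n hn G =>
      Inducibility.inducedDensity_le hpq hq hp hp3 hrs hs2 hbound hn G (by simp)) fun n hn => ?_
    obtain ⟨H, -, hle⟩ := Inducibility.exists_le_inducedDensity (K := ∅) hpq hq
      (Inducibility.Graphon.measurableAdj_pointGraph (Inducibility.Graphon.equipartite t)) volume
      (by simp) hn
    rw [← Inducibility.Graphon.density_turanGraph _ hpq hq, hdens] at hle
    exact ⟨H, hle⟩
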